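/- **Setting.** Let $1\le r$ and let $X^\star\in\mathbb R^{n\times q}$ be a rank-$r$ matrix with columns $x_k^\star$ and reduced SVD $X^\star=U^\star\Sigma V^{\star\top}=U^\star B^\star$; let $\sigma_{\max},\sigma_{\min}$ be its largest and smallest nonzero singular values, $\kappa=\sigma_{\max}/\sigma_{\min}$. Assume right incoherence: $\|b_k^\star\|\le\mu\sqrt{r/q}\,\sigma_{\max}$ for every column $b_k^\star$ of $B^\star$, with some $\mu\ge1$. For $n\times r$ matrices with orthonormal columns put $\mathrm{SD}_F(U_1,U_2)=\|(I-U_1U_1^\top)U_2\|_F$. There are $L=\tilde L\rho$ nodes, arranged in $\tilde L$ batches of $\rho$ nodes, and $m=L\tilde m$. Write $M^\dagger=(M^\top M)^{-1}M^\top$ and $\psi(a,b)=(1-a)\log\frac{1-a}{1-b}+a\log\frac ab$. **Algorithm (sample splitting).** In each iteration $s=0,1,2,\dots$ every node $\ell$ has, for each $k\in[q]$, two $\tilde m\times n$ matrices $(A_k)_\ell$, $(A_k')_\ell$ with measurements $(A_k)_\ell x_k^\star$, $(A'_k)_\ell x_k^\star$; all the entries are i.i.d. standard Gaussian, and the data of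 iteration $s$ are independent of everything that exists before iteration $s$ (including $U_0,\dots,U_s$). With $U=U_s$, node $\ell$ computes $(b_k)_\ell=((A_k)_\ell U)^\dagger (A_k)_\ell x_k^\star$ and $\nabla f_\ell=\sum_k (A'_k)_\ell^\top\big((A'_k)_\ell U(b_k)_\ell-(A'_k)_\ell x_k^\star\big)(b_k)_\ell^\top$ and sends $\nabla f_\ell$ to the center. At most $\tau L$ nodes are Byzantine in each iteration (the set may change with $s$); they send arbitrary matrices, which may depend on all the data up to and including iteration $s$. The center sums the received matrices over each batch, $\nabla f_{(\vartheta)}=\sum_{\ell\in\vartheta}\nabla f_\ell$, discards the batches with $\|\nabla f_{(\vartheta)}\|_F>\omega$, computes an approximate geometric median $\nabla f_{\rm gm}$ of the remaining ones, and sets $U_{s+1}=QR\big(U_s-\frac{\eta}{\rho\tilde m}\nabla f_{\rm gm}\big)$. The approximate geometric median of $z_1,\dots,z_N$ is computed by the path-following algorithm of Cohen et al. with $T_{\rm gm}$ iterations and accuracy parameter $\epsilon_{\rm GM}\in(0,1)$: with $f(x)=\sum_i\|x-z_i\|$, $x^{(0)}$ the mean of the $z_i$, $s_i=\frac{1}{400f(x^{(0)})}(1+\frac1{600})^{i-1}$,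 $f_s(x)=\sum_i\big(g_i-\log(1+g_i)\big)$, $g_i=\sqrt{1+s^2\|x-z_i\|^2}$, $\epsilon_v=\frac18\big(\frac{\epsilon_{\rm GM}/3}{7N}\big)^2$ and $\epsilon_c=(\epsilon_v/36)^{3/2}$, line searches produce $x^{(1)},\dots,x^{(T_{\rm gm}+1)}$, and the output is $x^{(T_{\rm gm}+1)}$ (or $x^{(0)}$ if $f(x^{(0)})=0$). The computation *succeeds* if $f(x^{(0)})=0$ or $\|x^{(i)}-\arg\min f_{s_i}\|\le\epsilon_c/s_i$ for all $i\le T_{\rm gm}+1$. **Theorem.** There are numerical constants $C_1,C_2,C_3\ge1$ and, for every $C_\omega\ge1$, a constant $C_{\rm gm}\ge1$ depending only on $C_\omega$, such that the following holds. Let $0<\eta\le0.5/\sigma_{\max}^2$, $0<\epsilon<1$, $T_{\rm gm}\ge C_{\rm gm}\log\frac{Lr}{\epsilon}$, $\omega=C_\omega\,\rho\tilde m\,\sigma_{\min}^2$, and suppose $$mq\ge C_1\tilde L\kappa^4\mu^2(n+r)r^2,\qquad \tilde m\ge C_2\max(\log q,\log n,r),\qquad 0\le\tau<0.4\,\tilde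 L/L,$$ and that $U_0$ has orthonormal columns with $\mathrm{SD}_F(U^\star,U_0)\le\delta_0:=0.1/\kappa^2$ (almost surely). Put $\delta_t=\big(1-\eta\sigma_{\max}^2\frac{0.12}{\kappa^2}\big)^t\delta_0$. 1. Let $t\ge0$ be such that $\delta_t\ge\epsilon$, and let $c_{\rm approxgm}\geq 0$ bound the probability that one of the geometric median computations in iterations $0,\dots,t$ does not succeed. Then, with probability at least $$1-c_{\rm approxgm}-(t+1)\Big[Ln^{-10}+\exp\big(-L\,\psi(0.4-\tau,n^{-10})\big)\Big],$$ $\mathrm{SD}_F(U^\star,U_{t+1})\le\delta_{t+1}$, and $\|x_k^\star-(x_k)_{t+1}\|\le1.4\,\delta_{t+1}\|x_k^\star\|$ for all $k\in[q]$, where $(x_k)_{t+1}=U_{t+1}(b_k)_\ell$ is the column estimate that any good node $\ell$ computes from $U_{t+1}$ (with the next, fresh set of measurements). 2. For the first $T$ with $\delta_T\le\epsilon$, the number of real scalars exchanged between the center and one node in the $T$ iterations is at most $C_3\,\frac{\kappa^2}{\eta\sigma_{\max}^2}\,nr\log\frac1\epsilon$; for $\eta=0.5/\sigma_{\max}^2$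 this is of order $\kappa^2nr\log\frac1\epsilon$. -/

import Mathlib

open MeasureTheory ProbabilityTheory
open scoped Matrix Matrix.Norms.Frobenius

/-!
Throughout, the norm of a matrix is the Frobenius norm, and the norm of a vector `v` is the
Euclidean norm `‖WithLp.toLp 2 v‖`.
-/

namespace ByzAltGDmin

noncomputable section

/-- `SD_F(U₁, U₂) = ‖(I - U₁ U₁ᵀ) U₂‖_F`. -/
def subspaceDist {n r : ℕ} (U₁ U₂ : Matrix (Fin n) (Fin r) ℝ) : ℝ :=
  ‖(1 - U₁ * U₁ᵀ) * U₂‖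

/-- `Q` is the orthonormal factor of a QR decomposition `M = Q R`. -/
def IsQRFactor {n r : ℕ} (M Q : Matrix (Fin n) (Fin r) ℝ) : Prop :=
  Qᵀ * Q = 1 ∧ ∃ R : Matrix (Fin r) (Fin r) ℝ, R.BlockTriangular id ∧ M = Q * R

/-- `M† = (Mᵀ M)⁻¹ Mᵀ`. -/
def pinv {m r : ℕ} (M : Matrix (Fin m) (Fin r) ℝ) : Matrix (Fin r) (Fin m) ℝ :=
  (Mᵀ * M)⁻¹ * Mᵀ

/-- Binary Kullback-Leibler divergence. -/
def psi (a b : ℝ) : ℝ :=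
  (1 - a) * Real.log ((1 - a) / (1 - b)) + a * Real.log (a / b)

/-- The reduced SVD `X = U diag(σ) Vᵀ` of a rank `r` matrix. (The `σ i` need not be listed in
decreasing order; only their maximum and minimum are used.) -/
structure IsReducedSVD {n q r : ℕ} (X : Matrix (Fin n) (Fin q) ℝ)
    (U : Matrix (Fin n) (Fin r) ℝ) (σ : Fin r → ℝ) (V : Matrix (Fin q) (Fin r) ℝ) : Prop where
  left_orthonormal : Uᵀ * U = 1
  right_orthonormal : Vᵀ * V = 1
  pos : ∀ i, 0 < σ i
  eq : X = U * Matrix.diagonal σ * Vᵀ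

/-- The largest singular value. -/
def sigmaMax {r : ℕ} (σ : Fin r → ℝ) : ℝ := ⨆ i, σ i

/-- The smallest nonzero singular value. -/
def sigmaMin {r : ℕ} (σ : Fin r → ℝ) : ℝ := ⨅ i, σ i

/-- The condition number. -/
def kappa {r : ℕ} (σ : Fin r → ℝ) : ℝ := sigmaMax σ / sigmaMin σ

/-- Incoherence of the right singular vectors: with `B = diag(σ) Vᵀ` and `b_k` its `k`-th column,
`‖b_k‖ ≤ μ √(r/q) σ_max` for all `k`. -/
def RightIncoherent {q r : ℕ} (σ : Fin r → ℝ) (V : Matrix (Fin q) (Fin r) ℝ) (μ : ℝ) : Prop :=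
  ∀ k, ‖WithLp.toLp 2 ((Matrix.diagonal σ * Vᵀ).col k)‖ ≤
    μ * Real.sqrt ((r : ℝ) / q) * sigmaMax σ

/-! ### Geometric median -/

section GeometricMedian

variable {ι E : Type*} [NormedAddCommGroup E] [NormedSpace ℝ E]

/-- The geometric median objective of the points `z i`, `i ∈ K`. -/
def gmObjective (K : Finset ι) (z : ι → E) (x : E) : ℝ := ∑ i ∈ K, ‖x - z i‖

/-- The smoothed objective `f_s` whose minimizers `x_s` form the central path. -/
def gmPenalized (K : Finset ι) (z : ι → E) (s : ℝ) (x : E) : ℝ :=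
  ∑ i ∈ K, (Real.sqrt (1 + s ^ 2 * ‖x - z i‖ ^ 2)
    - Real.log (1 + Real.sqrt (1 + s ^ 2 * ‖x - z i‖ ^ 2)))

/-- The starting point of the algorithm: the mean of the input points. -/
def gmStart (K : Finset ι) (z : ι → E) : E := (K.card : ℝ)⁻¹ • ∑ i ∈ K, z i

/-- The path parameters `s_{i+1} = (1 + 1/600)^i / (400 f(x⁽⁰⁾))`, `i = 0, 1, …`. -/
def gmPathParam (K : Finset ι) (z : ι → E) (i : ℕ) : ℝ :=
  1 / (400 * gmObjective K z (gmStart K z)) * (1 + 1 / 600) ^ i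

/-- `ε_v = (1/8) ((ε_GM / 3) / (7 N))²` for `N` input points. -/
def gmEpsV (N : ℕ) (εGM : ℝ) : ℝ := 1 / 8 * (εGM / 3 / (7 * N)) ^ 2

/-- The centering tolerance `ε_c = (ε_v / 36)^(3/2)`. -/
def gmEpsC (N : ℕ) (εGM : ℝ) : ℝ := (gmEpsV N εGM / 36) ^ (3 / 2 : ℝ)

/-- The path-following median algorithm produces `x⁽¹⁾, x⁽²⁾, …, x⁽ᵀ⁺¹⁾` by line searches
(`x i` stands for `x⁽ⁱ⁺¹⁾`). All of them meet their target: `x⁽ⁱ⁾` is within `ε_c / s_i` of the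
minimizer of `f_{s_i}`. No line search takes place if all input points coincide. -/
def LineSearchesSucceed (K : Finset ι) (z : ι → E) (εGM : ℝ) (T : ℕ) (x : ℕ → E) : Prop :=
  gmObjective K z (gmStart K z) = 0 ∨
    ∀ i ≤ T, ∃ c : E, IsMinOn (gmPenalized K z (gmPathParam K z i)) Set.univ c ∧
      ‖x i - c‖ ≤ gmEpsC K.card εGM / gmPathParam K z i

open Classical in
/-- The output after `T` iterations: the last iterate, or the starting point if the latter has
objective value zero (all input points coincide, or there are none). -/
def approxGM (K : Finset ι) (z : ι → E) (T : ℕ) (x : ℕ → E) : E :=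
  if gmObjective K z (gmStart K z) = 0 then gmStart K z else x T

end GeometricMedian

/-! ### Node computations -/

/-- The least squares coefficient `b_k = (A_k U)† y_k`, with `y_k = A_k x_k`. -/
def lsCoeff {m n r : ℕ} (A : Matrix (Fin m) (Fin n) ℝ) (U : Matrix (Fin n) (Fin r) ℝ)
    (x : Fin n → ℝ) : Fin r → ℝ :=
  pinv (A * U) *ᵥ (A *ᵥ x)

/-- The column estimate `U b_k`. -/
def columnEstimate {m n r : ℕ} (A : Matrix (Fin m) (Fin n) ℝ) (U : Matrix (Fin n) (Fin r) ℝ)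
    (x : Fin n → ℝ) : Fin n → ℝ :=
  U *ᵥ lsCoeff A U x

/-- The gradient `∑ₖ A_kᵀ (A_k U b_k - y_k) b_kᵀ` of a node. By sample splitting the coefficients
`b_k` are computed from `A₁`, while the gradient is computed from the independent `A₂`. -/
def nodeGradient {m n q r : ℕ} (A₁ A₂ : Fin q → Matrix (Fin m) (Fin n) ℝ)
    (X : Matrix (Fin n) (Fin q) ℝ) (U : Matrix (Fin n) (Fin r) ℝ) : Matrix (Fin n) (Fin r) ℝ :=
  ∑ k, Matrix.vecMulVec
    ((A₂ k)ᵀ *ᵥ (A₂ k *ᵥ (U *ᵥ lsCoeff (A₁ k) U (X.col k)) - A₂ k *ᵥ X.col k))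
    (lsCoeff (A₁ k) U (X.col k))

/-! ### The federated system -/

/-- The `L = Lt ρ` nodes, arranged in `Lt` batches of `ρ` nodes each. -/
abbrev Node (Lt ρ : ℕ) : Type := Fin Lt × Fin ρ

/-- Each iteration uses two independent sets of measurements: one to update `B`
and one to update `U`. -/
inductive Phase : Type
  | updateB : Phase
  | updateU : Phase

/-- Sum of the messages of the nodes of batch `θ`. -/
def batchSum {Lt ρ n r : ℕ} (Z : Node Lt ρ → Matrix (Fin n) (Fin r) ℝ) (θ : Fin Lt) :
    Matrix (Fin n) (Fin r) ℝ :=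
  ∑ j, Z (θ, j)

open Classical in
/-- The batches that survive thresholding. -/
def keptBatches {Lt ρ n r : ℕ} (thr : ℝ) (Z : Node Lt ρ → Matrix (Fin n) (Fin r) ℝ) :
    Finset (Fin Lt) :=
  Finset.univ.filter fun θ => ‖batchSum Z θ‖ ≤ thr

/-- Random Gaussian measurements with sample splitting. `A s p ℓ k` is the `mt × n` measurement
matrix of node `ℓ` for column `k`, used in phase `p` of iteration `s` (iterations are numbered
`s = 0, 1, …`; iteration `s` turns `U_s` into `U_{s+1}`). `F s` is the information that exists
before iteration `s`: the data of iteration `s` are independent of it. -/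
structure IsSampleSplitGaussian {Ω : Type*} [mΩ : MeasurableSpace Ω] (P : Measure Ω)
    {mt n q Lt ρ : ℕ} (F : Filtration ℕ mΩ)
    (A : ℕ → Phase → Node Lt ρ → Fin q → Ω → Matrix (Fin mt) (Fin n) ℝ) : Prop where
  adapted : ∀ s p ℓ k i j, Measurable[F (s + 1)] fun ω => A s p ℓ k ω i j
  gaussian : ∀ s p ℓ k i j, P.map (fun ω => A s p ℓ k ω i j) = gaussianReal 0 1
  indep_entries : ∀ s, iIndepFun
    (fun (a : Phase × Node Lt ρ × Fin q × Fin mt × Fin n) ω =>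
      A s a.1 a.2.1 a.2.2.1 ω a.2.2.2.1 a.2.2.2.2) P
  fresh : ∀ s, Indep
    (MeasurableSpace.comap
      (fun ω (a : Phase × Node Lt ρ × Fin q × Fin mt × Fin n) =>
        A s a.1 a.2.1 a.2.2.1 ω a.2.2.2.1 a.2.2.2.2) inferInstance)
    (F s) P

/-- A run of the Byzantine-resilient altGDmin iterations.

* `good s` is the set of non-Byzantine nodes in iteration `s`;
* `Z s ℓ` is the message that the center receives from node `ℓ` in iteration `s`. It is the honest
  gradient if `ℓ` is good. The Byzantine messages are arbitrary: they may depend on everything that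
  exists up to and including iteration `s`, in particular on the data of all the nodes;
* `x s` are the iterates of the geometric median computation in iteration `s`;
* `U s` is the subspace estimate, known before iteration `s`. -/
structure IsRun {Ω : Type*} [mΩ : MeasurableSpace Ω] {mt n q r Lt ρ : ℕ} (F : Filtration ℕ mΩ)
    (A : ℕ → Phase → Node Lt ρ → Fin q → Ω → Matrix (Fin mt) (Fin n) ℝ)
    (X : Matrix (Fin n) (Fin q) ℝ) (good : ℕ → Finset (Node Lt ρ))
    (η thr : ℝ) (Tgm : ℕ)
    (Z : ℕ → Node Lt ρ → Ω → Matrix (Fin n) (Fin r) ℝ)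
    (x : ℕ → Ω → ℕ → Matrix (Fin n) (Fin r) ℝ)
    (U : ℕ → Ω → Matrix (Fin n) (Fin r) ℝ) : Prop where
  init : ∀ ω, (U 0 ω)ᵀ * U 0 ω = 1
  adapted : ∀ s i j, Measurable[F s] fun ω => U s ω i j
  honest : ∀ s, ∀ ℓ ∈ good s, ∀ ω, Z s ℓ ω =
    nodeGradient (fun k => A s .updateB ℓ k ω) (fun k => A s .updateU ℓ k ω) X (U s ω)
  update : ∀ s ω, IsQRFactor
    (U s ω - (η / (ρ * mt : ℝ)) •
      approxGM (keptBatches thr fun ℓ => Z s ℓ ω) (batchSum fun ℓ => Z s ℓ ω) Tgm (x s ω))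
    (U (s + 1) ω)

/-- The geometric median computation of iteration `s` succeeds in outcome `ω`. -/
def GMSucceeds {Ω : Type*} {n r Lt ρ : ℕ} (thr εGM : ℝ) (Tgm : ℕ)
    (Z : ℕ → Node Lt ρ → Ω → Matrix (Fin n) (Fin r) ℝ)
    (x : ℕ → Ω → ℕ → Matrix (Fin n) (Fin r) ℝ) (s : ℕ) (ω : Ω) : Prop :=
  LineSearchesSucceed (keptBatches thr fun ℓ => Z s ℓ ω) (batchSum fun ℓ => Z s ℓ ω) εGM Tgm
    (x s ω)

/-- `δ_t = (1 - η σ_max² · 0.12 / κ²)^t · 0.1 / κ²`. -/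
def errorBound {r : ℕ} (σ : Fin r → ℝ) (η : ℝ) (t : ℕ) : ℝ :=
  (1 - η * sigmaMax σ ^ 2 * (0.12 / kappa σ ^ 2)) ^ t * (0.1 / kappa σ ^ 2)

/-- The number of real scalars exchanged between the center and one node in `T` iterations: in each
of them the node pushes an `n × r` gradient and the center pushes back an `n × r` matrix. -/
def scalarsExchanged (n r T : ℕ) : ℕ :=
  ∑ _s ∈ Finset.range T, (Fintype.card (Fin n × Fin r) + Fintype.card (Fin n × Fin r))

end

end ByzAltGDmin

/-! Write `G = Uᵀ X`. The ideal gradient `(U G - X) Gᵀ` is the gradient of `½‖U B - X‖²` at the best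
coefficients `B = G`. It has no component along `U`. On the part of `U` orthogonal to the range of
`Ustar`, a step along it acts as `1 - η G Gᵀ`, which shrinks at rate `0.74 η σ_min²`. Hence a step
along any `Y` within `0.3 δ σ_min²` of the ideal gradient still contracts the subspace distance by
`1 - 0.12 η σ_min²` (`IsReducedSVD.subspaceDist_update_le`). It remains to show that the median,
divided by `ρ m`, is such a `Y`.

Robustness is deterministic. A Byzantine node spoils at most one batch, so more than 60% of the
batches are honest. A near-minimizer of the median objective is then within six times the honest
error, plus an optimization gap (`norm_sub_le_of_gmObjective_le`). Thresholding bounds all inputs of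
the median, so the path-following gap decays like `(600/601)^T` relative to the threshold
(`gmObjective_approxGM_le`), and `T` logarithmic in `L r / ε` is enough.

The accuracy of honest batches is a Gaussian concentration statement, proved by Bernstein bounds on
finite nets. Given the least squares coefficients, fresh measurements make the batch gradient
concentrate around its conditional mean (`CoeffsAccurate.measure_gradient_le`). This mean differs
from the ideal gradient by terms quadratic in `δ`, harmless because `δ ≤ 0.1 / κ²`, and by one term
linear in the least squares errors. The linear term is small only because the errors of different
columns cancel: the residual of a column is orthogonal to `U`, so its measurements are independent
of `A U` (`measure_lt_norm_lsError_le`).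

A union bound over all nodes, columns and batches makes everything accurate in one iteration, except
with probability `L n⁻¹⁰ / 2`. Since the data of an iteration are independent of `U_s`, the bound
for fixed `U` carries over, and induction on the iterations concludes. The `exp(-L ψ)` term of the
theorem is additional slack: no second concentration argument over batches is needed. -/

namespace ByzAltGDmin

noncomputable section

/-! ### Euclidean norms of vectors and Frobenius norms of matrices -/

section LinearAlgebra

variable {ι κ ν : Type*} [Fintype ι] [Fintype κ] [Fintype ν]

/-- The Euclidean norm of a vector. -/
def vnorm (v : ι → ℝ) : ℝ := ‖WithLp.toLp 2 v‖

theorem vnorm_nonneg (v : ι → ℝ) : 0 ≤ vnorm v := norm_nonneg _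

theorem vnorm_sq (v : ι → ℝ) : vnorm v ^ 2 = v ⬝ᵥ v := by
  rw [vnorm, EuclideanSpace.norm_sq_eq]
  simp [dotProduct, pow_two]

theorem vnorm_zero : vnorm (0 : ι → ℝ) = 0 := by simp [vnorm]

theorem vnorm_eq_zero {v : ι → ℝ} : vnorm v = 0 ↔ v = 0 := by
  simp [vnorm]

theorem vnorm_add_le (v w : ι → ℝ) : vnorm (v + w) ≤ vnorm v + vnorm w := by
  simpa [vnorm] using norm_add_le (WithLp.toLp 2 v) (WithLp.toLp 2 w)

theorem vnorm_sub_le (v w : ι → ℝ) : vnorm (v - w) ≤ vnorm v + vnorm w := by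
  simpa [vnorm] using norm_sub_le (WithLp.toLp 2 v) (WithLp.toLp 2 w)

theorem vnorm_smul (c : ℝ) (v : ι → ℝ) : vnorm (c • v) = |c| * vnorm v := by
  simp [vnorm, norm_smul]

theorem dotProduct_le_vnorm (v w : ι → ℝ) : v ⬝ᵥ w ≤ vnorm v * vnorm w := by
  have := real_inner_le_norm (WithLp.toLp 2 w) (WithLp.toLp 2 v)
  simp only [EuclideanSpace.inner_toLp_toLp, star_trivial] at this
  rw [mul_comm]; exact this

theorem vnorm_le_of_sq_le {v : ι → ℝ} {c : ℝ} (hc : 0 ≤ c) (h : v ⬝ᵥ v ≤ c ^ 2) :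
    vnorm v ≤ c :=
  abs_le_of_sq_le_sq (by rwa [vnorm_sq]) hc |>.trans' (le_abs_self _)

theorem frob_sq (M : Matrix ι κ ℝ) : ‖M‖ ^ 2 = ∑ i, ∑ j, M i j ^ 2 := by
  rw [Matrix.frobenius_norm_def, ← Real.sqrt_eq_rpow, Real.sq_sqrt (by positivity)]
  simp

theorem frob_sq_eq_sum_col (M : Matrix ι κ ℝ) : ‖M‖ ^ 2 = ∑ k, vnorm (M.col k) ^ 2 := by
  rw [frob_sq, Finset.sum_comm]
  exact Finset.sum_congr rfl fun k _ => by rw [vnorm_sq]; simp [dotProduct, pow_two]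

theorem frob_sq_eq_sum_row (M : Matrix ι κ ℝ) : ‖M‖ ^ 2 = ∑ i, vnorm (M i) ^ 2 := by
  rw [frob_sq]
  exact Finset.sum_congr rfl fun k _ => by rw [vnorm_sq]; simp [dotProduct, pow_two]

theorem frob_sq_eq_trace (M : Matrix ι κ ℝ) : ‖M‖ ^ 2 = (Mᵀ * M).trace := by
  rw [frob_sq, Finset.sum_comm]
  simp [Matrix.trace, Matrix.mul_apply, pow_two]

theorem frob_vecMulVec (v : ι → ℝ) (w : κ → ℝ) :
    ‖Matrix.vecMulVec v w‖ = vnorm v * vnorm w := by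
  rw [← sq_eq_sq₀ (norm_nonneg _) (mul_nonneg (vnorm_nonneg _) (vnorm_nonneg _)), frob_sq, mul_pow,
    vnorm_sq, vnorm_sq, dotProduct, dotProduct, Finset.sum_mul_sum]
  refine Finset.sum_congr rfl fun i _ => Finset.sum_congr rfl fun j _ => ?_
  simp [Matrix.vecMulVec_apply]; ring

theorem vnorm_mulVec_le (M : Matrix ι κ ℝ) (v : κ → ℝ) : vnorm (M *ᵥ v) ≤ ‖M‖ * vnorm v := by
  refine vnorm_le_of_sq_le (mul_nonneg (norm_nonneg _) (vnorm_nonneg _)) ?_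
  rw [mul_pow, frob_sq_eq_sum_row, Finset.sum_mul, dotProduct]
  refine Finset.sum_le_sum fun i _ => ?_
  have h := dotProduct_le_vnorm (M i) v
  have h' := dotProduct_le_vnorm (-M i) v
  rw [← neg_one_smul ℝ, vnorm_smul, smul_dotProduct] at h'
  simp only [abs_neg, abs_one, one_mul, smul_eq_mul] at h'
  rw [← mul_pow, ← pow_two]
  exact sq_le_sq' (by simp only [Matrix.mulVec]; linarith) h

/-- The squared Frobenius norm is the sum over the columns. Bounding a factor by its operator norm
instead of its Frobenius norm avoids losing a power of `r`. -/
theorem frob_mul_le_of_vnorm_le {M : Matrix ι κ ℝ} {c : ℝ} (hc : 0 ≤ c)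
    (hM : ∀ v, vnorm (M *ᵥ v) ≤ c * vnorm v) (N : Matrix κ ν ℝ) : ‖M * N‖ ≤ c * ‖N‖ := by
  refine abs_le_of_sq_le_sq ?_ (by positivity) |>.trans' (le_abs_self _)
  rw [mul_pow, frob_sq_eq_sum_col, frob_sq_eq_sum_col, Finset.mul_sum]
  refine Finset.sum_le_sum fun k _ => ?_
  have : (M * N).col k = M *ᵥ N.col k := by ext i; simp [Matrix.mul_apply, Matrix.mulVec, dotProduct]
  rw [this, ← mul_pow]
  exact pow_le_pow_left₀ (vnorm_nonneg _) (hM _) 2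

variable [DecidableEq κ]

theorem vnorm_mulVec_of_orthonormal {U : Matrix ι κ ℝ} (hU : Uᵀ * U = 1) (v : κ → ℝ) :
    vnorm (U *ᵥ v) = vnorm v := by
  rw [← sq_eq_sq₀ (vnorm_nonneg _) (vnorm_nonneg _), vnorm_sq, vnorm_sq,
    Matrix.dotProduct_mulVec, ← Matrix.mulVec_transpose, Matrix.mulVec_mulVec, hU,
    Matrix.one_mulVec]

/-- Pythagoras for the orthogonal projection to the range of `U`. -/
theorem vnorm_sq_transpose_mulVec {U : Matrix ι κ ℝ} (hU : Uᵀ * U = 1) (v : ι → ℝ) :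
    vnorm (Uᵀ *ᵥ v) ^ 2 + vnorm (v - U *ᵥ (Uᵀ *ᵥ v)) ^ 2 = vnorm v ^ 2 := by
  have h1 : v ⬝ᵥ U *ᵥ (Uᵀ *ᵥ v) = (Uᵀ *ᵥ v) ⬝ᵥ (Uᵀ *ᵥ v) := by
    rw [Matrix.dotProduct_mulVec, ← Matrix.mulVec_transpose]
  have h2 : (U *ᵥ (Uᵀ *ᵥ v)) ⬝ᵥ (U *ᵥ (Uᵀ *ᵥ v)) = (Uᵀ *ᵥ v) ⬝ᵥ (Uᵀ *ᵥ v) := by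
    rw [← vnorm_sq, vnorm_mulVec_of_orthonormal hU, vnorm_sq]
  rw [vnorm_sq, vnorm_sq, vnorm_sq, sub_dotProduct, dotProduct_sub, dotProduct_sub, h2,
    dotProduct_comm (U *ᵥ (Uᵀ *ᵥ v)) v, h1]
  ring

theorem vnorm_transpose_mulVec_le {U : Matrix ι κ ℝ} (hU : Uᵀ * U = 1) (v : ι → ℝ) :
    vnorm (Uᵀ *ᵥ v) ≤ vnorm v := by
  have := vnorm_sq_transpose_mulVec hU v
  exact abs_le_of_sq_le_sq (by nlinarith [sq_nonneg (vnorm (v - U *ᵥ (Uᵀ *ᵥ v)))])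
    (vnorm_nonneg _) |>.trans' (le_abs_self _)

theorem frob_orthonormal_mul_le {U : Matrix ι κ ℝ} (hU : Uᵀ * U = 1) (M : Matrix κ ν ℝ) :
    ‖U * M‖ ≤ ‖M‖ := by
  simpa using frob_mul_le_of_vnorm_le zero_le_one
    (fun v => by rw [one_mul, vnorm_mulVec_of_orthonormal hU]) M

theorem frob_transpose_mul_le {U : Matrix ι κ ℝ} (hU : Uᵀ * U = 1) (M : Matrix ι ν ℝ) :
    ‖Uᵀ * M‖ ≤ ‖M‖ := by
  simpa using frob_mul_le_of_vnorm_le zero_le_one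
    (fun v => by rw [one_mul]; exact vnorm_transpose_mulVec_le hU v) M

theorem frob_mul_orthonormal_le {U : Matrix ι κ ℝ} (hU : Uᵀ * U = 1) (M : Matrix ν ι ℝ) :
    ‖M * U‖ ≤ ‖M‖ := by
  rw [← Matrix.frobenius_norm_transpose, Matrix.transpose_mul, ← Matrix.frobenius_norm_transpose M]
  exact frob_transpose_mul_le hU _

theorem frob_mul_transpose_le {U : Matrix ι κ ℝ} (hU : Uᵀ * U = 1) (M : Matrix ν κ ℝ) :
    ‖M * Uᵀ‖ ≤ ‖M‖ := by
  rw [← Matrix.frobenius_norm_transpose, Matrix.transpose_mul, ← Matrix.frobenius_norm_transpose M,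
    Matrix.transpose_transpose]
  exact frob_orthonormal_mul_le hU _

theorem vnorm_proj_compl_le [DecidableEq ι] {U : Matrix ι κ ℝ} (hU : Uᵀ * U = 1) (v : ι → ℝ) :
    vnorm ((1 - U * Uᵀ) *ᵥ v) ≤ vnorm v := by
  have := vnorm_sq_transpose_mulVec hU v
  rw [Matrix.sub_mulVec, Matrix.one_mulVec, ← Matrix.mulVec_mulVec]
  exact abs_le_of_sq_le_sq (by nlinarith [sq_nonneg (vnorm (Uᵀ *ᵥ v))])
    (vnorm_nonneg _) |>.trans' (le_abs_self _)

theorem frob_proj_compl_mul_le [DecidableEq ι] {U : Matrix ι κ ℝ} (hU : Uᵀ * U = 1)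
    (M : Matrix ι ν ℝ) : ‖(1 - U * Uᵀ) * M‖ ≤ ‖M‖ := by
  simpa using frob_mul_le_of_vnorm_le zero_le_one
    (fun v => by rw [one_mul]; exact vnorm_proj_compl_le hU v) M

theorem vnorm_diagonal_mulVec_le {σ : κ → ℝ} {c : ℝ} (hσ : ∀ i, |σ i| ≤ c) (hc : 0 ≤ c)
    (v : κ → ℝ) : vnorm (Matrix.diagonal σ *ᵥ v) ≤ c * vnorm v := by
  refine vnorm_le_of_sq_le (mul_nonneg hc (vnorm_nonneg _)) ?_
  rw [mul_pow, vnorm_sq, dotProduct, dotProduct, Finset.mul_sum]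
  refine Finset.sum_le_sum fun i _ => ?_
  rw [Matrix.mulVec_diagonal]
  have := sq_le_sq' (by linarith [abs_nonneg (σ i), hσ i]) (hσ i)
  rw [sq_abs] at this
  nlinarith [mul_self_nonneg (v i)]

theorem le_vnorm_diagonal_mulVec {σ : κ → ℝ} {c : ℝ} (hσ : ∀ i, c ≤ σ i) (hc : 0 ≤ c)
    (v : κ → ℝ) : c * vnorm v ≤ vnorm (Matrix.diagonal σ *ᵥ v) := by
  refine abs_le_of_sq_le_sq ?_ (vnorm_nonneg _) |>.trans' (le_abs_self _)
  rw [mul_pow, vnorm_sq, vnorm_sq, dotProduct, dotProduct, Finset.mul_sum]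
  refine Finset.sum_le_sum fun i _ => ?_
  rw [Matrix.mulVec_diagonal]
  nlinarith [mul_self_nonneg (v i), pow_le_pow_left₀ hc (hσ i) 2]

end LinearAlgebra

/-! ### Subspace distance -/

section SubspaceDist

variable {n r : ℕ}

theorem subspaceDist_nonneg (U₁ U₂ : Matrix (Fin n) (Fin r) ℝ) : 0 ≤ subspaceDist U₁ U₂ :=
  norm_nonneg _

theorem subspaceDist_sq {U₁ U₂ : Matrix (Fin n) (Fin r) ℝ} (h₁ : U₁ᵀ * U₁ = 1)
    (h₂ : U₂ᵀ * U₂ = 1) : subspaceDist U₁ U₂ ^ 2 = r - ‖U₁ᵀ * U₂‖ ^ 2 := by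
  rw [subspaceDist, frob_sq_eq_trace, frob_sq_eq_trace]
  have : ((1 - U₁ * U₁ᵀ) * U₂)ᵀ * ((1 - U₁ * U₁ᵀ) * U₂) = 1 - (U₁ᵀ * U₂)ᵀ * (U₁ᵀ * U₂) := by
    have e : (1 - U₁ * U₁ᵀ)ᵀ * (1 - U₁ * U₁ᵀ) = 1 - U₁ * U₁ᵀ := by
      simp only [Matrix.transpose_sub, Matrix.transpose_one, Matrix.transpose_mul,
        Matrix.transpose_transpose, sub_mul, mul_sub, one_mul, mul_one]
      rw [show U₁ * U₁ᵀ * (U₁ * U₁ᵀ) = U₁ * (U₁ᵀ * U₁) * U₁ᵀ by simp only [Matrix.mul_assoc], h₁]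
      simp
    rw [Matrix.transpose_mul, Matrix.mul_assoc, ← Matrix.mul_assoc _ _ U₂, e, Matrix.sub_mul,
      Matrix.mul_sub, Matrix.one_mul, h₂]
    simp only [Matrix.transpose_mul, Matrix.transpose_transpose, Matrix.mul_assoc]
  rw [this, Matrix.trace_sub, Matrix.trace_one]
  simp

/-- Symmetry holds because both matrices have the same number `r` of columns. It is needed since the
contraction controls the part of `U` outside `Ustar`, whereas the residuals of the columns of `X`
involve the part of `Ustar` outside `U`. -/
theorem subspaceDist_comm {U₁ U₂ : Matrix (Fin n) (Fin r) ℝ} (h₁ : U₁ᵀ * U₁ = 1)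
    (h₂ : U₂ᵀ * U₂ = 1) : subspaceDist U₁ U₂ = subspaceDist U₂ U₁ := by
  rw [← sq_eq_sq₀ (subspaceDist_nonneg _ _) (subspaceDist_nonneg _ _), subspaceDist_sq h₁ h₂, subspaceDist_sq h₂ h₁,
    ← Matrix.frobenius_norm_transpose (U₁ᵀ * U₂), Matrix.transpose_mul, Matrix.transpose_transpose]

end SubspaceDist

/-! ### Contraction of one perturbed gradient step -/

section Contraction

variable {n q r : ℕ}

theorem le_sigmaMax (σ : Fin r → ℝ) (i : Fin r) : σ i ≤ sigmaMax σ :=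
  le_ciSup (Set.finite_range σ).bddAbove i

theorem sigmaMin_le (σ : Fin r → ℝ) (i : Fin r) : sigmaMin σ ≤ σ i :=
  ciInf_le (Set.finite_range σ).bddBelow i

theorem sigmaMin_pos (hr : 0 < r) {σ : Fin r → ℝ} (hσ : ∀ i, 0 < σ i) : 0 < sigmaMin σ := by
  have : Nonempty (Fin r) := ⟨⟨0, hr⟩⟩
  obtain ⟨i, hi⟩ := exists_eq_ciInf_of_finite (f := σ)
  rw [sigmaMin, ← hi]
  exact hσ i

theorem sigmaMin_le_sigmaMax (hr : 0 < r) (σ : Fin r → ℝ) : sigmaMin σ ≤ sigmaMax σ :=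
  (sigmaMin_le σ ⟨0, hr⟩).trans (le_sigmaMax σ _)

variable {X : Matrix (Fin n) (Fin q) ℝ} {Ustar : Matrix (Fin n) (Fin r) ℝ} {σ : Fin r → ℝ}
  {V : Matrix (Fin q) (Fin r) ℝ}

theorem IsReducedSVD.sigmaMin_pos (hX : IsReducedSVD X Ustar σ V) (hr : 0 < r) :
    0 < sigmaMin σ := ByzAltGDmin.sigmaMin_pos hr hX.pos

theorem IsReducedSVD.sigmaMax_pos (hX : IsReducedSVD X Ustar σ V) (hr : 0 < r) :
    0 < sigmaMax σ := (hX.sigmaMin_pos hr).trans_le (sigmaMin_le_sigmaMax hr σ)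

theorem IsReducedSVD.one_le_kappa (hX : IsReducedSVD X Ustar σ V) (hr : 0 < r) :
    1 ≤ kappa σ := by
  rw [kappa, le_div_iff₀ (hX.sigmaMin_pos hr), one_mul]
  exact sigmaMin_le_sigmaMax hr σ

theorem IsReducedSVD.abs_le_sigmaMax (hX : IsReducedSVD X Ustar σ V) (i : Fin r) :
    |σ i| ≤ sigmaMax σ := by
  rw [abs_of_pos (hX.pos i)]; exact le_sigmaMax σ i

theorem IsReducedSVD.vnorm_mulVec_le (hX : IsReducedSVD X Ustar σ V) (hr : 0 < r)
    (v : Fin q → ℝ) : vnorm (X *ᵥ v) ≤ sigmaMax σ * vnorm v := by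
  rw [hX.eq, ← Matrix.mulVec_mulVec, ← Matrix.mulVec_mulVec,
    vnorm_mulVec_of_orthonormal hX.left_orthonormal]
  refine (vnorm_diagonal_mulVec_le hX.abs_le_sigmaMax (hX.sigmaMax_pos hr).le _).trans ?_
  exact mul_le_mul_of_nonneg_left (vnorm_transpose_mulVec_le hX.right_orthonormal v)
    (hX.sigmaMax_pos hr).le

/-- Here `Xᵀ U v = V Σ (Ustarᵀ U v)`. By Pythagoras, projecting `U v` to the range of `Ustar` loses
at most `δ² ‖v‖²` of its squared norm, and `Σ` stretches by at least `σ_min`. -/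
theorem IsReducedSVD.le_vnorm_transpose_mulVec (hX : IsReducedSVD X Ustar σ V) (hr : 0 < r)
    {U : Matrix (Fin n) (Fin r) ℝ} (hU : Uᵀ * U = 1) {δ : ℝ} (hδ : subspaceDist Ustar U ≤ δ)
    (v : Fin r → ℝ) :
    sigmaMin σ ^ 2 * ((1 - δ ^ 2) * vnorm v ^ 2) ≤ vnorm ((Uᵀ * X)ᵀ *ᵥ v) ^ 2 := by
  have e : (Uᵀ * X)ᵀ *ᵥ v = V *ᵥ (Matrix.diagonal σ *ᵥ (Ustarᵀ *ᵥ (U *ᵥ v))) := by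
    rw [hX.eq]
    simp only [Matrix.transpose_mul, Matrix.transpose_transpose, Matrix.diagonal_transpose,
      Matrix.mulVec_mulVec, Matrix.mul_assoc]
  rw [e, vnorm_mulVec_of_orthonormal hX.right_orthonormal]
  have h1 := le_vnorm_diagonal_mulVec (sigmaMin_le σ) (hX.sigmaMin_pos hr).le
    (Ustarᵀ *ᵥ (U *ᵥ v))
  have h2 := vnorm_sq_transpose_mulVec hX.left_orthonormal (U *ᵥ v)
  have h3 : vnorm (U *ᵥ v - Ustar *ᵥ (Ustarᵀ *ᵥ (U *ᵥ v))) ≤ δ * vnorm v := by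
    have := ByzAltGDmin.vnorm_mulVec_le ((1 - Ustar * Ustarᵀ) * U) v
    rw [← Matrix.mulVec_mulVec, Matrix.sub_mulVec, Matrix.one_mulVec, ← Matrix.mulVec_mulVec]
      at this
    exact this.trans (mul_le_mul_of_nonneg_right hδ (vnorm_nonneg _))
  rw [vnorm_mulVec_of_orthonormal hU] at h2
  have h4 := pow_le_pow_left₀ (vnorm_nonneg _) h3 2
  have h5 := pow_le_pow_left₀ (mul_nonneg (hX.sigmaMin_pos hr).le (vnorm_nonneg _)) h1 2
  refine le_trans ?_ h5
  rw [mul_pow]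
  exact mul_le_mul_of_nonneg_left (by nlinarith) (sq_nonneg _)

/-- With `p = ‖Gᵀ v‖²`, expanding the square gives `‖v‖² - 2 η p + η² ‖G Gᵀ v‖²`. The last term is
at most `0.5 η p` because `η σ_max² ≤ 0.5`, and `η p ≥ 0.99 a ‖v‖²` with `a = η σ_min²`. This leaves
the factor `1 - 1.485 a ≤ (1 - 0.74 a)²`. -/
theorem IsReducedSVD.vnorm_step_le (hX : IsReducedSVD X Ustar σ V) (hr : 0 < r)
    {U : Matrix (Fin n) (Fin r) ℝ} (hU : Uᵀ * U = 1) {δ : ℝ} (hδ : subspaceDist Ustar U ≤ δ)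
    (hδ1 : δ ≤ 0.1) {η : ℝ} (hη : 0 < η) (hη1 : η * sigmaMax σ ^ 2 ≤ 0.5) (v : Fin r → ℝ) :
    vnorm ((1 - η • ((Uᵀ * X) * (Uᵀ * X)ᵀ)) *ᵥ v) ≤ (1 - 0.74 * (η * sigmaMin σ ^ 2)) * vnorm v := by
  set G := Uᵀ * X with hG
  have hmin := hX.sigmaMin_pos hr
  have hmax := hX.sigmaMax_pos hr
  have ha : η * sigmaMin σ ^ 2 ≤ 0.5 := le_trans (mul_le_mul_of_nonneg_left
    (pow_le_pow_left₀ hmin.le (sigmaMin_le_sigmaMax hr σ) 2) hη.le) hη1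
  refine vnorm_le_of_sq_le (mul_nonneg (by linarith) (vnorm_nonneg _)) ?_
  have hlow := hX.le_vnorm_transpose_mulVec hr hU hδ v
  rw [← hG] at hlow
  have hup : vnorm (G *ᵥ (Gᵀ *ᵥ v)) ≤ sigmaMax σ * vnorm (Gᵀ *ᵥ v) := by
    rw [hG, ← Matrix.mulVec_mulVec]
    exact (vnorm_transpose_mulVec_le hU _).trans (hX.vnorm_mulVec_le hr _)
  have hup2 := pow_le_pow_left₀ (vnorm_nonneg _) hup 2
  have hdot : v ⬝ᵥ (G *ᵥ (Gᵀ *ᵥ v)) = vnorm (Gᵀ *ᵥ v) ^ 2 := by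
    rw [vnorm_sq, Matrix.dotProduct_mulVec, ← Matrix.mulVec_transpose]
  have e : (1 - η • (G * Gᵀ)) *ᵥ v = v - η • (G *ᵥ (Gᵀ *ᵥ v)) := by
    rw [Matrix.sub_mulVec, Matrix.one_mulVec, Matrix.smul_mulVec, Matrix.mulVec_mulVec]
  rw [e, sub_dotProduct, dotProduct_sub, dotProduct_sub, smul_dotProduct, dotProduct_smul,
    smul_dotProduct, dotProduct_smul, dotProduct_comm (G *ᵥ (Gᵀ *ᵥ v)) v, hdot, ← vnorm_sq,
    ← vnorm_sq]
  simp only [smul_eq_mul]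
  set p := vnorm (Gᵀ *ᵥ v) ^ 2
  set w := vnorm v ^ 2 with hw
  have hp : 0 ≤ p := sq_nonneg _
  have hw0 : 0 ≤ w := sq_nonneg _
  have h1 : η * (η * vnorm (G *ᵥ (Gᵀ *ᵥ v)) ^ 2) ≤ 0.5 * (η * p) := by
    calc η * (η * vnorm (G *ᵥ (Gᵀ *ᵥ v)) ^ 2) ≤ η * (η * (sigmaMax σ * vnorm (Gᵀ *ᵥ v)) ^ 2) := by
          gcongr
      _ = (η * sigmaMax σ ^ 2) * (η * p) := by simp only [p]; ring
      _ ≤ 0.5 * (η * p) := mul_le_mul_of_nonneg_right hη1 (by positivity)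
  have hδ0 : 0 ≤ δ := (subspaceDist_nonneg _ _).trans hδ
  have h2 : 0.99 * (η * sigmaMin σ ^ 2) * w ≤ η * p := by
    have : 0.99 * w ≤ (1 - δ ^ 2) * w := mul_le_mul_of_nonneg_right (by nlinarith) hw0
    calc 0.99 * (η * sigmaMin σ ^ 2) * w = η * (sigmaMin σ ^ 2 * (0.99 * w)) := by ring
      _ ≤ η * (sigmaMin σ ^ 2 * ((1 - δ ^ 2) * w)) := by gcongr
      _ ≤ η * p := by gcongr
  rw [mul_pow, ← hw]
  set a := η * sigmaMin σ ^ 2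
  have ha0 : 0 ≤ a := by positivity
  nlinarith [mul_nonneg (sq_nonneg a) hw0, mul_nonneg ha0 hw0]

/-- A QR step along a perturbation `Y` of the expected gradient contracts the subspace distance. -/
theorem IsReducedSVD.subspaceDist_update_le (hX : IsReducedSVD X Ustar σ V) (hr : 0 < r)
    {U U' Y : Matrix (Fin n) (Fin r) ℝ} (hU : Uᵀ * U = 1) {δ : ℝ}
    (hδ : subspaceDist Ustar U ≤ δ) (hδ1 : δ ≤ 0.1) {η : ℝ} (hη : 0 < η)
    (hη1 : η * sigmaMax σ ^ 2 ≤ 0.5)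
    (hY : ‖Y - (U * (Uᵀ * X) - X) * (Uᵀ * X)ᵀ‖ ≤ 0.3 * δ * sigmaMin σ ^ 2)
    (hQR : IsQRFactor (U - η • Y) U') :
    subspaceDist Ustar U' ≤ (1 - 0.12 * (η * sigmaMin σ ^ 2)) * δ := by
  set G := Uᵀ * X with hG
  set Err := Y - (U * G - X) * Gᵀ with hErr
  have hmin := hX.sigmaMin_pos hr
  have ha : η * sigmaMin σ ^ 2 ≤ 0.5 := le_trans (mul_le_mul_of_nonneg_left
    (pow_le_pow_left₀ hmin.le (sigmaMin_le_sigmaMax hr σ) 2) hη.le) hη1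
  have hδ0 : 0 ≤ δ := (subspaceDist_nonneg _ _).trans hδ
  obtain ⟨hU', R, -, hR⟩ := hQR
  set a := η * sigmaMin σ ^ 2 with haa
  have ha0 : 0 ≤ a := by positivity
  have hYE : Y = (U * G - X) * Gᵀ + Err := by rw [hErr]; abel
  -- the component along `U`
  set D := η • (Uᵀ * Err) with hD
  have hUM : Uᵀ * (U - η • Y) = 1 - D := by
    -- Because `G = Uᵀ X`, the ideal gradient is orthogonal to `U`; only the error moves `Uᵀ (U - η
    -- Y)` away from the identity.
    have : Uᵀ * ((U * G - X) * Gᵀ) = 0 := by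
      rw [← Matrix.mul_assoc, Matrix.mul_sub, ← Matrix.mul_assoc, hU, Matrix.one_mul, hG, sub_self,
        Matrix.zero_mul]
    rw [Matrix.mul_sub, hU, Matrix.mul_smul, hYE, Matrix.mul_add, this, zero_add]
  have hEn : η * ‖Err‖ ≤ 0.3 * a * δ := by
    calc η * ‖Err‖ ≤ η * (0.3 * δ * sigmaMin σ ^ 2) := by gcongr
      _ = 0.3 * a * δ := by rw [haa]; ring
  have hDn : ‖D‖ ≤ 0.03 * a := by
    rw [hD, norm_smul, Real.norm_of_nonneg hη.le]
    calc η * ‖Uᵀ * Err‖ ≤ η * ‖Err‖ := by gcongr; exact frob_transpose_mul_le hU _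
      _ ≤ 0.3 * a * δ := hEn
      _ ≤ 0.03 * a := by nlinarith
  have hunit : IsUnit (1 - D) := isUnit_one_sub_of_norm_lt_one (by linarith)
  have hdet := (Matrix.isUnit_iff_isUnit_det _).1 hunit
  -- the component orthogonal to `Ustar`
  set Q := (1 - Ustar * Ustarᵀ) with hQ
  have hQX : Q * X = 0 := by
    rw [hQ, hX.eq, Matrix.sub_mul, Matrix.one_mul, Matrix.mul_assoc Ustar, Matrix.mul_assoc Ustar,
      ← Matrix.mul_assoc Ustarᵀ, hX.left_orthonormal, Matrix.one_mul, sub_self]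
  have hQM : Q * (U - η • Y) = (Q * U) * (1 - η • (G * Gᵀ)) - η • (Q * Err) := by
    have h1 : Q * Y = Q * U * (G * Gᵀ) + Q * Err := by
      conv_lhs => rw [hYE]
      rw [Matrix.mul_add, ← Matrix.mul_assoc, Matrix.mul_sub, hQX, sub_zero]
      simp only [Matrix.mul_assoc]
    rw [Matrix.mul_sub, Matrix.mul_smul, h1, Matrix.mul_sub (Q * U), Matrix.mul_one, Matrix.mul_smul,
      smul_add, sub_sub]
  have hQMn : ‖Q * (U - η • Y)‖ ≤ (1 - 0.44 * a) * δ := by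
    rw [hQM]
    have h1 : ‖(Q * U) * (1 - η • (G * Gᵀ))‖ ≤ (1 - 0.74 * a) * ‖Q * U‖ := by
      rw [← Matrix.frobenius_norm_transpose, Matrix.transpose_mul,
        ← Matrix.frobenius_norm_transpose (Q * U)]
      have : (1 - η • (G * Gᵀ))ᵀ = 1 - η • (G * Gᵀ) := by simp
      rw [this]
      exact frob_mul_le_of_vnorm_le (by linarith)
        (fun v => hX.vnorm_step_le hr hU hδ hδ1 hη hη1 v) _
    have h2 : ‖η • (Q * Err)‖ ≤ 0.3 * a * δ := by
      rw [norm_smul, Real.norm_of_nonneg hη.le]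
      refine le_trans ?_ hEn
      gcongr
      exact frob_proj_compl_mul_le hX.left_orthonormal _
    have h3 : (1 - 0.74 * a) * ‖Q * U‖ ≤ (1 - 0.74 * a) * δ :=
      mul_le_mul_of_nonneg_left hδ (by linarith)
    refine (norm_sub_le _ _).trans ?_
    linarith
  -- combine
  set T := Q * (U - η • Y) * (1 - D)⁻¹ with hT
  have hTn : ‖T‖ ≤ (1 - 0.12 * a) * δ := by
    have e : T = Q * (U - η • Y) + T * D := by
      have : T * (1 - D) = Q * (U - η • Y) := by
        rw [hT, Matrix.mul_assoc, Matrix.nonsing_inv_mul _ hdet, Matrix.mul_one]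
      rw [← this, Matrix.mul_sub, Matrix.mul_one]; abel
    -- The bound on `T` is implicit, which avoids estimating the norm of `(1 - D)⁻¹`. It suffices
    -- that `1 - 0.44 a ≤ (1 - 0.12 a) (1 - 0.03 a)`.
    have h1 : ‖T‖ ≤ (1 - 0.44 * a) * δ + ‖T‖ * (0.03 * a) := by
      calc ‖T‖ = ‖Q * (U - η • Y) + T * D‖ := by rw [← e]
        _ ≤ ‖Q * (U - η • Y)‖ + ‖T * D‖ := norm_add_le _ _
        _ ≤ _ := add_le_add hQMn ((Matrix.frobenius_norm_mul _ _).trans (by gcongr))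
    by_contra hcon
    push Not at hcon
    nlinarith [mul_nonneg ha0 hδ0, mul_nonneg (mul_nonneg ha0 ha0) hδ0]
  -- Invertibility of `1 - D` forces `R` to be invertible with inverse `(1 - D)⁻¹ Uᵀ U'`. Hence `Q
  -- U' = T (Uᵀ U')`, where multiplication by `Uᵀ U'` does not increase the norm, so no lower bound
  -- on the singular values of `R` is required.
  have hNR : (Uᵀ * U') * R = 1 - D := by rw [Matrix.mul_assoc, ← hR, hUM]
  have hRinv : R * ((1 - D)⁻¹ * (Uᵀ * U')) = 1 := by
    rw [mul_eq_one_comm, Matrix.mul_assoc, hNR, Matrix.nonsing_inv_mul _ hdet]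
  have : Q * U' = T * (Uᵀ * U') := by
    rw [hT, hR]
    calc Q * U' = Q * U' * (R * ((1 - D)⁻¹ * (Uᵀ * U'))) := by rw [hRinv, Matrix.mul_one]
      _ = _ := by simp only [Matrix.mul_assoc]
  calc subspaceDist Ustar U' = ‖T * Uᵀ * U'‖ := by
        rw [subspaceDist, ← hQ, this, Matrix.mul_assoc T]
    _ ≤ ‖T * Uᵀ‖ := frob_mul_orthonormal_le hU' _
    _ ≤ ‖T‖ := frob_mul_transpose_le hU _
    _ ≤ _ := hTn

end Contraction

/-! ### Accuracy of the approximate geometric median -/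

section GeometricMedianAccuracy

variable {ι E : Type*} [NormedAddCommGroup E]

theorem gmObjective_nonneg (K : Finset ι) (z : ι → E) (x : E) : 0 ≤ gmObjective K z x :=
  Finset.sum_nonneg fun _ _ => norm_nonneg _

theorem gmObjective_le_add (K : Finset ι) (z : ι → E) (x y : E) :
    gmObjective K z x ≤ gmObjective K z y + K.card * ‖x - y‖ := by
  rw [gmObjective, gmObjective, ← nsmul_eq_mul, ← Finset.sum_const, ← Finset.sum_add_distrib]
  refine Finset.sum_le_sum fun i _ => ?_
  have := norm_add_le (y - z i) (x - y)
  simpa [add_comm] using this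

/-- Robustness: a near-optimal point is close to `y` if most of the points are. -/
theorem norm_sub_le_of_gmObjective_le [DecidableEq ι] {K S : Finset ι} {z : ι → E} {x y : E}
    {R gap : ℝ} (hSK : S ⊆ K) (hS : ∀ i ∈ S, ‖z i - y‖ ≤ R)
    (hcard : (3 : ℝ) * (K \ S).card ≤ 2 * S.card) (hpos : 0 < S.card)
    (hx : gmObjective K z x ≤ gmObjective K z y + gap) :
    ‖x - y‖ ≤ 6 * R + 3 * gap / S.card := by
  have hsplit (w : E) : gmObjective K z w =
      ∑ i ∈ K \ S, ‖w - z i‖ + ∑ i ∈ S, ‖w - z i‖ := (Finset.sum_sdiff hSK).symm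
  rw [hsplit, hsplit] at hx
  have h1 : ∑ i ∈ K \ S, (‖y - z i‖ - ‖x - y‖) ≤ ∑ i ∈ K \ S, ‖x - z i‖ :=
    Finset.sum_le_sum fun i _ => by
      have := norm_sub_le (x - z i) (x - y)
      rw [show x - z i - (x - y) = y - z i by abel] at this
      linarith
  have h2 : ∑ i ∈ S, (‖x - y‖ - R) ≤ ∑ i ∈ S, ‖x - z i‖ :=
    Finset.sum_le_sum fun i hi => by
      have := norm_add_le (x - z i) (z i - y)
      rw [sub_add_sub_cancel] at this
      linarith [hS i hi]
  have h3 : ∑ i ∈ S, ‖y - z i‖ ≤ ∑ i ∈ S, R :=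
    Finset.sum_le_sum fun i hi => by rw [norm_sub_rev]; exact hS i hi
  simp only [Finset.sum_sub_distrib, Finset.sum_const, nsmul_eq_mul] at h1 h2 h3
  have hg : (0 : ℝ) < S.card := by exact_mod_cast hpos
  set g : ℝ := (S.card : ℝ)
  set b : ℝ := ((K \ S).card : ℝ)
  set d := ‖x - y‖
  have hd : 0 ≤ d := norm_nonneg _
  -- The triangle inequalities add up to `(g - b) d ≤ 2 g R + gap`, and `3 b ≤ 2 g` gives `g - b ≥ g
  -- / 3`.
  have h4 : g * d ≤ 6 * R * g + 3 * gap := by nlinarith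
  rw [← mul_le_mul_iff_right₀ hg]
  refine h4.trans (le_of_eq ?_)
  field_simp

variable [NormedSpace ℝ E]

/-- The penalty `√(1 + s² d²) - log (1 + √(1 + s² d²))`. -/
def gmPenalty (s d : ℝ) : ℝ :=
  Real.sqrt (1 + s ^ 2 * d ^ 2) - Real.log (1 + Real.sqrt (1 + s ^ 2 * d ^ 2))

theorem hasDerivAt_gmPenalty (s d : ℝ) :
    HasDerivAt (gmPenalty s) (s ^ 2 * d / (1 + Real.sqrt (1 + s ^ 2 * d ^ 2))) d := by
  have hpos : 0 < 1 + s ^ 2 * d ^ 2 := by positivity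
  have h0 : HasDerivAt (fun d : ℝ => 1 + s ^ 2 * d ^ 2) (s ^ 2 * (2 * d)) d := by
    have := ((hasDerivAt_pow 2 d).const_mul (s ^ 2)).const_add 1
    simpa using this
  have h1 := h0.sqrt hpos.ne'
  have h2 := h1.const_add 1
  have hg : 0 < Real.sqrt (1 + s ^ 2 * d ^ 2) := Real.sqrt_pos.2 hpos
  have h3 := h1.sub (h2.log (by positivity))
  refine h3.congr_deriv ?_
  field_simp
  ring

theorem gmPenalty_monotoneOn (s : ℝ) : MonotoneOn (gmPenalty s) (Set.Ici 0) := by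
  refine monotoneOn_of_deriv_nonneg (convex_Ici 0)
    (fun d _ => (hasDerivAt_gmPenalty s d).continuousAt.continuousWithinAt)
    (fun d _ => (hasDerivAt_gmPenalty s d).differentiableAt.differentiableWithinAt) ?_
  intro d hd
  rw [interior_Ici] at hd
  rw [(hasDerivAt_gmPenalty s d).deriv]
  have : 0 < d := hd
  positivity

/-- A point of the central path has objective value within `2 N / s` of the optimum. -/
theorem gmObjective_le_of_isMinOn {K : Finset ι} {z : ι → E} {s : ℝ} (hs : 0 < s) {c : E}
    (hc : IsMinOn (gmPenalized K z s) Set.univ c) (y : E) :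
    s * gmObjective K z c ≤ s * gmObjective K z y + 2 * K.card := by
  set φ : ι → ℝ := fun i =>
    s ^ 2 * ‖c - z i‖ / (1 + Real.sqrt (1 + s ^ 2 * ‖c - z i‖ ^ 2)) with hφ
  -- A first-order condition without differentiating the norm of `E`. On the segment from `c` to
  -- `y`, each distance to `z i` is replaced by its linear interpolation. By convexity and
  -- monotonicity of the penalty this majorizes the smoothed objective, with equality at `c`, so its
  -- derivative at `0` is nonnegative.
  have hkey : 0 ≤ ∑ i ∈ K, φ i * (‖y - z i‖ - ‖c - z i‖) := by
    set H : ℝ → ℝ := fun h => ∑ i ∈ K, gmPenalty s (‖c - z i‖ + h * (‖y - z i‖ - ‖c - z i‖)) with hH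
    have hder : HasDerivAt H (∑ i ∈ K, φ i * (‖y - z i‖ - ‖c - z i‖)) 0 := by
      refine HasDerivAt.fun_sum fun i _ => ?_
      have h1 : HasDerivAt (fun h : ℝ => ‖c - z i‖ + h * (‖y - z i‖ - ‖c - z i‖))
          (‖y - z i‖ - ‖c - z i‖) 0 := by
        simpa using ((hasDerivAt_id (0 : ℝ)).mul_const (‖y - z i‖ - ‖c - z i‖)).const_add ‖c - z i‖
      have h2 := hasDerivAt_gmPenalty s (‖c - z i‖ + 0 * (‖y - z i‖ - ‖c - z i‖))
      have h3 := h2.comp (0 : ℝ) h1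
      rw [zero_mul, add_zero] at h3
      exact h3
    have hmin : ∀ h ∈ Set.Ioo (0 : ℝ) 1, H 0 ≤ H h := by
      intro h hh
      have h0 : H 0 = gmPenalized K z s c := by simp [hH, gmPenalized, gmPenalty]
      have h1 : gmPenalized K z s c ≤ gmPenalized K z s ((1 - h) • c + h • y) :=
        hc (Set.mem_univ _)
      refine (h0.le.trans h1).trans ?_
      refine Finset.sum_le_sum fun i _ => ?_
      have hle : ‖(1 - h) • c + h • y - z i‖ ≤ ‖c - z i‖ + h * (‖y - z i‖ - ‖c - z i‖) := by
        have : (1 - h) • c + h • y - z i = (1 - h) • (c - z i) + h • (y - z i) := by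
          module
        rw [this]
        refine (norm_add_le _ _).trans ?_
        rw [norm_smul, norm_smul, Real.norm_of_nonneg hh.1.le,
          Real.norm_of_nonneg (by linarith [hh.2])]
        linarith
      exact gmPenalty_monotoneOn s (norm_nonneg _) ((norm_nonneg _).trans hle) hle
    have htend := (hasDerivAt_iff_tendsto_slope.1 hder).mono_left
      (nhdsWithin_mono (0 : ℝ) (s := Set.Ioi 0) (fun x hx => ne_of_gt hx))
    refine ge_of_tendsto htend ?_
    filter_upwards [Ioo_mem_nhdsGT (zero_lt_one' ℝ)] with h hh
    rw [slope_def_field, sub_zero]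
    exact div_nonneg (sub_nonneg.2 (hmin h hh)) hh.1.le
  -- The slope `φ i` of the penalty replaces the slope `s` of the true objective at a cost of at
  -- most `2` per point. Both parts follow from `s d ≤ g ≤ 1 + s d`.
  have hφle : ∀ i ∈ K, φ i ≤ s ∧ (s - φ i) * ‖c - z i‖ ≤ 2 := by
    intro i _
    set d := ‖c - z i‖
    set g := Real.sqrt (1 + s ^ 2 * d ^ 2) with hg
    have hd : 0 ≤ d := norm_nonneg _
    have hg0 : 0 ≤ g := Real.sqrt_nonneg _
    have hg1 : s * d ≤ g := Real.le_sqrt_of_sq_le (by nlinarith)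
    have hg2 : g ≤ 1 + s * d := Real.sqrt_le_iff.2 ⟨by positivity, by nlinarith [mul_nonneg hs.le hd]⟩
    constructor
    · rw [hφ]
      change s ^ 2 * d / (1 + g) ≤ s
      rw [div_le_iff₀ (by positivity)]
      nlinarith
    · change (s - s ^ 2 * d / (1 + g)) * d ≤ 2
      rw [sub_mul, div_mul_eq_mul_div, sub_le_iff_le_add, ← sub_le_iff_le_add', le_div_iff₀ (by positivity)]
      nlinarith [mul_nonneg hs.le hd]
  have h1 : ∑ i ∈ K, φ i * ‖c - z i‖ ≤ ∑ i ∈ K, φ i * ‖y - z i‖ := by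
    simp only [mul_sub, Finset.sum_sub_distrib] at hkey
    linarith
  have h2 : ∑ i ∈ K, φ i * ‖y - z i‖ ≤ s * gmObjective K z y := by
    rw [gmObjective, Finset.mul_sum]
    exact Finset.sum_le_sum fun i hi => mul_le_mul_of_nonneg_right (hφle i hi).1 (norm_nonneg _)
  have h3 : s * gmObjective K z c - ∑ i ∈ K, φ i * ‖c - z i‖ ≤ 2 * K.card := by
    rw [gmObjective, Finset.mul_sum, ← Finset.sum_sub_distrib]
    calc ∑ i ∈ K, (s * ‖c - z i‖ - φ i * ‖c - z i‖) ≤ ∑ i ∈ K, (2 : ℝ) :=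
          Finset.sum_le_sum fun i hi => by rw [← sub_mul]; exact (hφle i hi).2
      _ = 2 * K.card := by simp [mul_comm]
  linarith

theorem gmEpsC_le_one {N : ℕ} {εGM : ℝ} (h0 : 0 < εGM) (h1 : εGM < 1) : gmEpsC N εGM ≤ 1 := by
  have hv0 : 0 ≤ gmEpsV N εGM / 36 := by rw [gmEpsV]; positivity
  refine Real.rpow_le_one hv0 ?_ (by norm_num)
  have hx : εGM / 3 / (7 * N) ≤ 1 := by
    rcases Nat.eq_zero_or_pos N with rfl | hN
    · simp
    · have : (1 : ℝ) ≤ N := by exact_mod_cast hN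
      rw [div_le_one (by positivity)]
      linarith
  have hx0 : 0 ≤ εGM / 3 / (7 * N) := by positivity
  rw [gmEpsV, div_le_one (by norm_num)]
  nlinarith

/-- If all the points have norm at most `R`, the output of a successful run is, in objective value,
within `2400 N² R (600/601)^T` of the optimum. -/
theorem gmObjective_approxGM_le {K : Finset ι} {z : ι → E} {εGM : ℝ} (h0 : 0 < εGM) (h1 : εGM < 1)
    {T : ℕ} {x : ℕ → E} (hx : LineSearchesSucceed K z εGM T x) {R : ℝ} (hR : ∀ i ∈ K, ‖z i‖ ≤ R)
    (hR0 : 0 ≤ R) (y : E) :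
    gmObjective K z (approxGM K z T x) ≤
      gmObjective K z y + 2400 * K.card ^ 2 * R * (600 / 601) ^ T := by
  classical
  by_cases hf : gmObjective K z (gmStart K z) = 0
  · rw [approxGM, if_pos hf, hf]
    exact add_nonneg (gmObjective_nonneg _ _ _) (by positivity)
  rw [approxGM, if_neg hf]
  -- Only the accuracy of the final line search matters for the output.
  obtain ⟨c, hc, hxc⟩ := (hx.resolve_left hf) T le_rfl
  set f₀ := gmObjective K z (gmStart K z) with hf₀
  have hf₀pos : 0 < f₀ := lt_of_le_of_ne (gmObjective_nonneg _ _ _) (Ne.symm hf)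
  set s := gmPathParam K z T with hs
  have hspos : 0 < s := by rw [hs, gmPathParam]; positivity
  have hN : (0 : ℝ) < K.card := by
    rcases K.eq_empty_or_nonempty with rfl | h
    · simp [hf₀, gmObjective] at hf
    · exact_mod_cast h.card_pos
  have hmean : ‖gmStart K z‖ ≤ R := by
    rw [gmStart, norm_smul, norm_inv, Real.norm_natCast, inv_mul_le_iff₀ hN]
    refine (norm_sum_le _ _).trans ((Finset.sum_le_sum hR).trans ?_)
    simp
  have hf₀le : f₀ ≤ 2 * K.card * R := by
    rw [hf₀, gmObjective]
    calc ∑ i ∈ K, ‖gmStart K z - z i‖ ≤ ∑ i ∈ K, (2 * R) := Finset.sum_le_sum fun i hi => by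
          refine (norm_sub_le _ _).trans ?_
          linarith [hR i hi]
      _ = 2 * K.card * R := by simp; ring
  have hsinv : 1 / s ≤ 800 * K.card * R * (600 / 601) ^ T := by
    have : 1 / s = 400 * f₀ * (600 / 601) ^ T := by
      rw [hs, gmPathParam, ← hf₀]
      rw [show (600 / 601 : ℝ) = (1 + 1 / 600)⁻¹ by norm_num, inv_pow]
      field_simp
    rw [this]
    have : (0 : ℝ) ≤ (600 / 601) ^ T := by positivity
    nlinarith
  have hcy := gmObjective_le_of_isMinOn hspos hc y
  have hxle := gmObjective_le_add K z (x T) c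
  have hxc' : ‖x T - c‖ ≤ 1 / s := hxc.trans (by gcongr; exact gmEpsC_le_one h0 h1)
  have h4 : gmObjective K z c ≤ gmObjective K z y + 2 * K.card * (1 / s) := by
    rw [← mul_le_mul_iff_right₀ hspos]
    refine hcy.trans (le_of_eq ?_)
    field_simp
  have h5 : (K.card : ℝ) * ‖x T - c‖ ≤ K.card * (1 / s) := by gcongr
  -- The total gap is `3 N / s`: `2 N / s` for stopping on the central path at parameter `s`, and `N
  -- / s` for the centering error, where `ε_c ≤ 1` suffices.
  have h6 : 3 * K.card * (1 / s) ≤ 3 * K.card * (800 * K.card * R * (600 / 601) ^ T) := by gcongr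
  nlinarith

end GeometricMedianAccuracy

/-! ### Families of independent standard Gaussian variables -/

section Gaussian

variable {Ω : Type*} {mΩ : MeasurableSpace Ω} {P : Measure Ω} {α β : Type*}

/-- A family of independent standard Gaussian random variables. -/
structure IsStdGaussian (X : α → Ω → ℝ) (P : Measure Ω) : Prop where
  measurable : ∀ a, Measurable (X a)
  map_eq : ∀ a, P.map (X a) = gaussianReal 0 1
  indep : iIndepFun X P

theorem IsStdGaussian.precomp {X : α → Ω → ℝ} (hX : IsStdGaussian X P) {f : β → α}
    (hf : Function.Injective f) : IsStdGaussian (fun b => X (f b)) P where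
  measurable _ := hX.measurable _
  map_eq _ := hX.map_eq _
  indep := hX.indep.precomp hf

/-- Exponential Markov inequality. -/
theorem measure_le_of_lintegral_exp_le {f : Ω → ℝ} (hf : Measurable f)
    (h : ∫⁻ ω, ENNReal.ofReal (Real.exp (f ω)) ∂P ≤ 1) (c : ℝ) :
    P {ω | c ≤ f ω} ≤ ENNReal.ofReal (Real.exp (-c)) := by
  have hm := mul_meas_ge_le_lintegral (μ := P) (f := fun ω => ENNReal.ofReal (Real.exp (f ω)))
    (by fun_prop) (ENNReal.ofReal (Real.exp c))
  have hset : {ω | c ≤ f ω} =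
      {ω | ENNReal.ofReal (Real.exp c) ≤ ENNReal.ofReal (Real.exp (f ω))} := by
    ext ω
    simp [ENNReal.ofReal_le_ofReal_iff (Real.exp_pos _).le]
  rw [hset, Real.exp_neg, ENNReal.ofReal_inv_of_pos (Real.exp_pos _), ENNReal.le_inv_iff_mul_le,
    mul_comm]
  exact hm.trans h

theorem lintegral_exp_gaussianReal (c : ℝ) :
    ∫⁻ x, ENNReal.ofReal (Real.exp (c * x - c ^ 2 / 2)) ∂(gaussianReal 0 1) = 1 := by
  have hi := (integrable_exp_mul_gaussianReal (μ := 0) (v := 1) c).mul_const (Real.exp (-(c ^ 2 / 2)))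
  have he : ∀ x : ℝ, Real.exp (c * x - c ^ 2 / 2) =
      Real.exp (c * x) * Real.exp (-(c ^ 2 / 2)) := fun x => by
    rw [← Real.exp_add, sub_eq_add_neg]
  simp_rw [he]
  rw [← ofReal_integral_eq_lintegral_ofReal hi (Filter.Eventually.of_forall fun x => by positivity),
    integral_mul_const]
  have hmgf := congrFun (mgf_fun_id_gaussianReal (μ := 0) (v := 1)) c
  rw [mgf] at hmgf
  rw [hmgf, ← Real.exp_add]
  simp

theorem IsStdGaussian.lintegral_exp_sum [Fintype α] {X : α → Ω → ℝ} (hX : IsStdGaussian X P)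
    (c : α → ℝ) :
    ∫⁻ ω, ENNReal.ofReal (Real.exp (∑ a, c a * X a ω - (∑ a, c a ^ 2) / 2)) ∂P = 1 := by
  have he : ∀ ω, ENNReal.ofReal (Real.exp (∑ a, c a * X a ω - (∑ a, c a ^ 2) / 2)) =
      ∏ a, ENNReal.ofReal (Real.exp (c a * X a ω - c a ^ 2 / 2)) := fun ω => by
    rw [← ENNReal.ofReal_prod_of_nonneg fun _ _ => (Real.exp_pos _).le, ← Real.exp_sum,
      Finset.sum_sub_distrib, Finset.sum_div]
  simp_rw [he]
  have hm := hX.measurable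
  rw [lintegral_prod_eq_prod_lintegral_of_indepFun Finset.univ
    (fun a ω => ENNReal.ofReal (Real.exp (c a * X a ω - c a ^ 2 / 2)))
    (hX.indep.comp (fun a x => ENNReal.ofReal (Real.exp (c a * x - c a ^ 2 / 2)))
      (fun a => by fun_prop)) (fun a => by fun_prop)]
  refine Finset.prod_eq_one fun a _ => ?_
  rw [← lintegral_exp_gaussianReal (c a), ← hX.map_eq a, lintegral_map (by fun_prop) (hm a)]

theorem IsStdGaussian.memLp {X : α → Ω → ℝ} (hX : IsStdGaussian X P) (a : α) :
    MemLp (X a) 2 P := by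
  have := memLp_id_gaussianReal (μ := 0) (v := 1) 2
  rw [← hX.map_eq a] at this
  exact this.comp_of_map (hX.measurable a).aemeasurable

theorem IsStdGaussian.covariance [Fintype α] [DecidableEq α] {X : α → Ω → ℝ}
    (hX : IsStdGaussian X P) (a b : α) : cov[X a, X b; P] = if a = b then 1 else 0 := by
  have := hX.indep.isProbabilityMeasure
  split_ifs with h
  · subst h
    rw [covariance_self (hX.measurable a).aemeasurable]
    have h1 := variance_id_gaussianReal (μ := 0) (v := 1)
    rw [← hX.map_eq a, variance_map aemeasurable_id (hX.measurable a).aemeasurable] at h1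
    simpa using h1
  · exact (hX.indep.indepFun h).covariance_eq_zero (hX.memLp a) (hX.memLp b)

theorem IsStdGaussian.covariance_linear [Fintype α] {X : α → Ω → ℝ} (hX : IsStdGaussian X P)
    (c d : α → ℝ) :
    cov[fun ω => ∑ a, c a * X a ω, fun ω => ∑ a, d a * X a ω; P] = ∑ a, c a * d a := by
  classical
  have := hX.indep.isProbabilityMeasure
  rw [covariance_fun_sum_fun_sum (fun a => (hX.memLp a).const_mul _)
    (fun a => (hX.memLp a).const_mul _)]
  refine Finset.sum_congr rfl fun a _ => ?_
  simp_rw [covariance_const_mul_left, covariance_const_mul_right, hX.covariance]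
  simp

theorem IsStdGaussian.hasGaussianLaw [Finite α] {X : α → Ω → ℝ} (hX : IsStdGaussian X P) :
    HasGaussianLaw (fun ω a => X a ω) P := by
  have := Fintype.ofFinite α
  refine iIndepFun.hasGaussianLaw (fun a => ?_) hX.indep
  have : IsGaussian (P.map (X a)) := by rw [hX.map_eq a]; infer_instance
  exact IsGaussian.hasGaussianLaw

theorem IsStdGaussian.map_linear [Fintype α] {X : α → Ω → ℝ} (hX : IsStdGaussian X P)
    (c : α → ℝ) :
    P.map (fun ω => ∑ a, c a * X a ω) = gaussianReal 0 (∑ a, c a ^ 2).toNNReal := by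
  have := hX.indep.isProbabilityMeasure
  have hg : HasGaussianLaw (fun ω => ∑ a, c a * X a ω) P := by
    have := hX.hasGaussianLaw.map_fun
      (∑ a, c a • ContinuousLinearMap.proj (R := ℝ) (φ := fun _ : α => ℝ) a)
    simpa using this
  rw [hg.map_eq_gaussianReal]
  congr 1
  · rw [integral_finsetSum _ fun a _ => ((hX.memLp a).integrable one_le_two).const_mul _]
    refine Finset.sum_eq_zero fun a _ => ?_
    rw [integral_const_mul]
    have h1 := integral_id_gaussianReal (μ := 0) (v := 1)
    rw [← hX.map_eq a, integral_map (hX.measurable a).aemeasurable (by fun_prop)] at h1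
    rw [h1, mul_zero]
  · rw [← covariance_self hg.aemeasurable, hX.covariance_linear]
    simp_rw [pow_two]

/-- Orthogonal families of linear forms in independent Gaussians are independent. -/
theorem IsStdGaussian.indepFun_linear [Fintype α] {ι κ : Type*} [Finite ι] [Finite κ]
    {X : α → Ω → ℝ} (hX : IsStdGaussian X P) (c : ι → α → ℝ) (d : κ → α → ℝ)
    (h : ∀ i k, ∑ a, c i a * d k a = 0) :
    IndepFun (fun ω i => ∑ a, c i a * X a ω) (fun ω k => ∑ a, d k a * X a ω) P := by
  have := Fintype.ofFinite ι
  have := Fintype.ofFinite κ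
  refine HasGaussianLaw.indepFun_of_covariance_eval (X := fun i ω => ∑ a, c i a * X a ω)
    (Y := fun k ω => ∑ a, d k a * X a ω) ?_ fun i k => by rw [hX.covariance_linear, h]
  have := hX.hasGaussianLaw.map_fun
    ((ContinuousLinearMap.pi fun i =>
        ∑ a, c i a • ContinuousLinearMap.proj (R := ℝ) (φ := fun _ : α => ℝ) a).prod
      (ContinuousLinearMap.pi fun k =>
        ∑ a, d k a • ContinuousLinearMap.proj (R := ℝ) (φ := fun _ : α => ℝ) a))
  refine this.congr (Filter.Eventually.of_forall fun ω => ?_)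
  ext <;> simp

/-- For jointly Gaussian blocks, vanishing covariances between blocks already give mutual
independence. -/
theorem IsStdGaussian.iIndepFun_rows {J : Type*} [Finite J] [Finite β] {X : J → β → Ω → ℝ}
    (hX : IsStdGaussian (fun p : J × β => X p.1 p.2) P) : iIndepFun (fun j ω b => X j b ω) P := by
  classical
  have := Fintype.ofFinite J
  have := Fintype.ofFinite β
  refine HasGaussianLaw.iIndepFun_of_covariance_eval (κ := fun _ => β) (X := X) ?_ ?_
  · have := hX.hasGaussianLaw.map_fun
      (ContinuousLinearMap.pi fun j => ContinuousLinearMap.pi fun b =>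
        ContinuousLinearMap.proj (R := ℝ) (φ := fun _ : J × β => ℝ) (j, b))
    exact this
  · intro i j hij k l
    have := hX.covariance (i, k) (j, l)
    rw [if_neg (by simp [hij])] at this
    exact this

/-! ### Exponential moments of products of Gaussians -/

/-- The Gaussian integral gives `E exp(s x²) = (1 - 2 s)^(-1/2)`, which for `|s| ≤ 1/4` is at most
`exp(s + 2 s²)`. -/
theorem lintegral_exp_sq_gaussianReal {s : ℝ} (hs : |s| ≤ 1 / 4) :
    ∫⁻ x, ENNReal.ofReal (Real.exp (s * x ^ 2 - (s + 2 * s ^ 2))) ∂(gaussianReal 0 1) ≤ 1 := by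
  have hs' := abs_le.1 hs
  have hb : 0 < 1 / 2 - s := by linarith
  have hm : Measurable fun x : ℝ => ENNReal.ofReal (Real.exp (s * x ^ 2 - (s + 2 * s ^ 2))) := by
    fun_prop
  rw [gaussianReal_of_var_ne_zero 0 one_ne_zero,
    lintegral_withDensity_eq_lintegral_mul _ (measurable_gaussianPDF 0 1) hm]
  have he : ∀ x : ℝ, (gaussianPDF 0 1 * fun x : ℝ =>
      ENNReal.ofReal (Real.exp (s * x ^ 2 - (s + 2 * s ^ 2)))) x =
      ENNReal.ofReal ((Real.sqrt (2 * Real.pi))⁻¹ * Real.exp (-(s + 2 * s ^ 2)) *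
        Real.exp (-(1 / 2 - s) * x ^ 2)) := fun x => by
    rw [Pi.mul_apply, gaussianPDF, ← ENNReal.ofReal_mul (gaussianPDFReal_nonneg _ _ _),
      gaussianPDFReal]
    congr 1
    simp only [NNReal.coe_one, mul_one, sub_zero]
    rw [mul_assoc, mul_assoc, ← Real.exp_add, ← Real.exp_add]
    congr 2
    ring
  simp_rw [he]
  rw [← ofReal_integral_eq_lintegral_ofReal ((integrable_exp_neg_mul_sq hb).const_mul _)
    (Filter.Eventually.of_forall fun x => by positivity), integral_const_mul, integral_gaussian]
  refine ENNReal.ofReal_le_one.2 ?_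
  have h1 : Real.sqrt (Real.pi / (1 / 2 - s)) =
      Real.sqrt (2 * Real.pi) * Real.sqrt ((1 - 2 * s)⁻¹) := by
    rw [← Real.sqrt_mul (by positivity)]
    congr 1
    have : 1 - 2 * s ≠ 0 := by linarith
    field_simp
  have hpi : 0 < Real.sqrt (2 * Real.pi) := by positivity
  rw [h1, show (Real.sqrt (2 * Real.pi))⁻¹ * Real.exp (-(s + 2 * s ^ 2)) *
    (Real.sqrt (2 * Real.pi) * Real.sqrt ((1 - 2 * s)⁻¹)) =
    Real.exp (-(s + 2 * s ^ 2)) * Real.sqrt ((1 - 2 * s)⁻¹) by field_simp]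
  rw [Real.exp_neg, inv_mul_le_iff₀ (Real.exp_pos _), mul_one]
  refine Real.sqrt_le_iff.2 ⟨(Real.exp_pos _).le, ?_⟩
  rw [← Real.exp_nat_mul, inv_le_comm₀ (by linarith) (Real.exp_pos _), ← Real.exp_neg]
  -- `exp (-(x + x²)) ≤ 1 - x` for `|x| ≤ 1/2`, where `x = 2 s`
  set x := 2 * s with hx
  have hx1 : -(1 / 2) ≤ x := by linarith
  have hx2 : x ≤ 1 / 2 := by linarith
  have e : -(((2 : ℕ) : ℝ) * (s + 2 * s ^ 2)) = -(x + x ^ 2) := by rw [hx]; push_cast; ring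
  rw [e, Real.exp_neg, inv_le_comm₀ (Real.exp_pos _) (by linarith)]
  have h2 := Real.quadratic_le_exp_of_nonneg (x := x + x ^ 2)
  rcases le_or_gt 0 x with h0 | h0
  · refine le_trans ?_ (h2 (by positivity))
    rw [inv_le_iff_one_le_mul₀ (by linarith)]
    nlinarith [mul_nonneg h0 h0, mul_nonneg (mul_nonneg h0 h0) h0,
      mul_nonneg (mul_nonneg h0 h0) (sub_nonneg.2 hx2)]
  · refine le_trans ?_ (Real.add_one_le_exp _)
    rw [inv_le_iff_one_le_mul₀ (by linarith)]
    nlinarith [mul_nonneg (sq_nonneg x) (neg_nonneg.2 h0.le)]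

theorem IsStdGaussian.lintegral_exp_sq_linear [Fintype α] {X : α → Ω → ℝ}
    (hX : IsStdGaussian X P) (c : α → ℝ) {s : ℝ} (hs : |s| * vnorm c ^ 2 ≤ 1 / 4) :
    ∫⁻ ω, ENNReal.ofReal (Real.exp (s * (∑ a, c a * X a ω) ^ 2 -
      (s * vnorm c ^ 2 + 2 * s ^ 2 * vnorm c ^ 4))) ∂P ≤ 1 := by
  have hm := hX.measurable
  have hv : ∑ a, c a ^ 2 = vnorm c ^ 2 := by rw [vnorm_sq, dotProduct]; simp_rw [pow_two]
  have hlaw : P.map (fun ω => ∑ a, c a * X a ω) =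
      (gaussianReal 0 1).map (fun x => vnorm c * x) := by
    rw [hX.map_linear c, gaussianReal_map_const_mul]
    congr 1
    · simp
    · rw [hv]; ext; simp [sq_nonneg]
  have h1 := lintegral_map (μ := P) (f := fun x : ℝ => ENNReal.ofReal (Real.exp (s * x ^ 2 -
      (s * vnorm c ^ 2 + 2 * s ^ 2 * vnorm c ^ 4)))) (g := fun ω => ∑ a, c a * X a ω)
      (by fun_prop) (by fun_prop)
  rw [← h1, hlaw, lintegral_map (by fun_prop) (by fun_prop)]
  have h2 := lintegral_exp_sq_gaussianReal (s := s * vnorm c ^ 2)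
    (by rw [abs_mul, abs_of_nonneg (sq_nonneg (vnorm c))]; exact hs)
  refine le_trans (le_of_eq ?_) h2
  refine lintegral_congr fun x => ?_
  congr 2
  ring

/-- Polarization writes the product of two linear forms as a quarter of the difference of the
squares of their sum and difference. The two squares are separated by `exp((A + B)/2) ≤ (exp A + exp
B)/2`, so no independence of the two forms is needed. -/
theorem IsStdGaussian.lintegral_exp_mul_aux [Fintype α] {X : α → Ω → ℝ}
    (hX : IsStdGaussian X P) (w v : α → ℝ) {l N : ℝ} (hw : vnorm w ^ 2 = N) (hv : vnorm v ^ 2 = N)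
    (hl : |l| * N ≤ 1 / 8) :
    ∫⁻ ω, ENNReal.ofReal (Real.exp (l * ((∑ a, w a * X a ω) * (∑ a, v a * X a ω) - w ⬝ᵥ v) -
      4 * l ^ 2 * N ^ 2)) ∂P ≤ 1 := by
  have hp : vnorm (w + v) ^ 2 = 2 * N + 2 * w ⬝ᵥ v := by
    rw [vnorm_sq] at *
    simp only [add_dotProduct, dotProduct_add, hw, hv, dotProduct_comm v w]; ring
  have hq : vnorm (w - v) ^ 2 = 2 * N - 2 * w ⬝ᵥ v := by
    rw [vnorm_sq] at *
    simp only [sub_dotProduct, dotProduct_sub, hw, hv, dotProduct_comm v w]; ring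
  set b := w ⬝ᵥ v
  have hp0 : 0 ≤ 2 * N + 2 * b := hp ▸ sq_nonneg _
  have hq0 : 0 ≤ 2 * N - 2 * b := hq ▸ sq_nonneg _
  have hl0 := abs_nonneg l
  have hm := hX.measurable
  have h1 := hX.lintegral_exp_sq_linear (w + v) (s := l / 2) (by
    rw [hp, abs_div, abs_two]; nlinarith)
  have h2 := hX.lintegral_exp_sq_linear (w - v) (s := -(l / 2)) (by
    rw [hq, abs_neg, abs_div, abs_two]; nlinarith)
  set A : Ω → ℝ := fun ω => l / 2 * (∑ a, (w + v) a * X a ω) ^ 2 -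
    (l / 2 * vnorm (w + v) ^ 2 + 2 * (l / 2) ^ 2 * vnorm (w + v) ^ 4) with hA
  set B : Ω → ℝ := fun ω => -(l / 2) * (∑ a, (w - v) a * X a ω) ^ 2 -
    (-(l / 2) * vnorm (w - v) ^ 2 + 2 * (-(l / 2)) ^ 2 * vnorm (w - v) ^ 4) with hB
  have hAm : Measurable A := by fun_prop
  have hBm : Measurable B := by fun_prop
  have hle : ∀ ω, ENNReal.ofReal (Real.exp (l * ((∑ a, w a * X a ω) * (∑ a, v a * X a ω) - b) -
      4 * l ^ 2 * N ^ 2)) ≤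
      2⁻¹ * (ENNReal.ofReal (Real.exp (A ω)) + ENNReal.ofReal (Real.exp (B ω))) := fun ω => by
    have e1 : l * ((∑ a, w a * X a ω) * (∑ a, v a * X a ω) - b) - 4 * l ^ 2 * N ^ 2 ≤
        (A ω + B ω) / 2 := by
      simp only [hA, hB, Pi.add_apply, Pi.sub_apply, add_mul, sub_mul, Finset.sum_add_distrib,
        Finset.sum_sub_distrib]
      rw [show vnorm (w + v) ^ 4 = (vnorm (w + v) ^ 2) ^ 2 by ring,
        show vnorm (w - v) ^ 4 = (vnorm (w - v) ^ 2) ^ 2 by ring, hp, hq]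
      nlinarith [mul_nonneg (sq_nonneg l) (mul_nonneg hp0 hq0)]
    have e2 : Real.exp ((A ω + B ω) / 2) ≤ 2⁻¹ * (Real.exp (A ω) + Real.exp (B ω)) := by
      have h3 : Real.exp ((A ω + B ω) / 2) = Real.exp (A ω / 2) * Real.exp (B ω / 2) := by
        rw [← Real.exp_add]; ring_nf
      have h4 : Real.exp (A ω) = Real.exp (A ω / 2) ^ 2 := by
        rw [← Real.exp_nat_mul]; congr 1; push_cast; ring
      have h5 : Real.exp (B ω) = Real.exp (B ω / 2) ^ 2 := by
        rw [← Real.exp_nat_mul]; congr 1; push_cast; ring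
      rw [h3, h4, h5]
      nlinarith [sq_nonneg (Real.exp (A ω / 2) - Real.exp (B ω / 2))]
    calc _ ≤ ENNReal.ofReal (2⁻¹ * (Real.exp (A ω) + Real.exp (B ω))) :=
          ENNReal.ofReal_le_ofReal ((Real.exp_le_exp.2 e1).trans e2)
      _ = _ := by
          rw [ENNReal.ofReal_mul (by norm_num), ENNReal.ofReal_add (Real.exp_pos _).le
            (Real.exp_pos _).le, ENNReal.ofReal_inv_of_pos (by norm_num)]
          simp
  refine (lintegral_mono hle).trans ?_
  rw [lintegral_const_mul _ (by fun_prop), lintegral_add_left (by fun_prop)]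
  calc _ ≤ (2 : ENNReal)⁻¹ * (1 + 1) := by gcongr
    _ = 1 := by rw [one_add_one_eq_two, ENNReal.inv_mul_cancel (by simp) (by simp)]

theorem IsStdGaussian.lintegral_exp_mul [Fintype α] {X : α → Ω → ℝ}
    (hX : IsStdGaussian X P) (w v : α → ℝ) {l : ℝ} (hl : |l| * (vnorm w * vnorm v) ≤ 1 / 8) :
    ∫⁻ ω, ENNReal.ofReal (Real.exp (l * ((∑ a, w a * X a ω) * (∑ a, v a * X a ω) - w ⬝ᵥ v) -
      4 * l ^ 2 * (vnorm w * vnorm v) ^ 2)) ∂P ≤ 1 := by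
  have := hX.indep.isProbabilityMeasure
  by_cases hw : w = 0
  · subst hw; simp [vnorm_zero]
  by_cases hv : v = 0
  · subst hv; simp [vnorm_zero]
  have hw' : 0 < vnorm w := lt_of_le_of_ne (vnorm_nonneg _) (Ne.symm (mt vnorm_eq_zero.1 hw))
  have hv' : 0 < vnorm v := lt_of_le_of_ne (vnorm_nonneg _) (Ne.symm (mt vnorm_eq_zero.1 hv))
  -- Rescaling `w` by `t` and `v` by `t⁻¹` makes the norms equal without changing the product of the
  -- forms or the inner product.
  set t := Real.sqrt (vnorm v / vnorm w) with ht
  have ht0 : 0 < t := by positivity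
  have ht2 : t ^ 2 = vnorm v / vnorm w := Real.sq_sqrt (by positivity)
  have h1 : vnorm (t • w) ^ 2 = vnorm w * vnorm v := by
    rw [vnorm_smul, mul_pow, sq_abs, ht2]; field_simp
  have h2 : vnorm (t⁻¹ • v) ^ 2 = vnorm w * vnorm v := by
    rw [vnorm_smul, mul_pow, sq_abs, inv_pow, ht2]; field_simp
  refine le_trans (le_of_eq ?_) (hX.lintegral_exp_mul_aux (t • w) (t⁻¹ • v) h1 h2 hl)
  refine lintegral_congr fun ω => ?_
  have e1 : ∑ a, (t • w) a * X a ω = t * ∑ a, w a * X a ω := by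
    rw [Finset.mul_sum]; exact Finset.sum_congr rfl fun a _ => by simp [mul_assoc]
  have e2 : ∑ a, (t⁻¹ • v) a * X a ω = t⁻¹ * ∑ a, v a * X a ω := by
    rw [Finset.mul_sum]; exact Finset.sum_congr rfl fun a _ => by simp [mul_assoc]
  rw [e1, e2, smul_dotProduct, dotProduct_smul, smul_smul, mul_inv_cancel₀ ht0.ne', one_smul]
  congr 4
  field_simp

/-- Bernstein-type bound for the exponential moments of `∑ⱼ ⟨aⱼ, wⱼ⟩ ⟨aⱼ, vⱼ⟩`. -/
theorem IsStdGaussian.lintegral_exp_sum_mul {J : Type*} [Fintype J] [Fintype β]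
    {X : J → β → Ω → ℝ} (hX : IsStdGaussian (fun p : J × β => X p.1 p.2) P) (w v : J → β → ℝ)
    {l : ℝ} (hl : ∀ j, |l| * (vnorm (w j) * vnorm (v j)) ≤ 1 / 8) :
    ∫⁻ ω, ENNReal.ofReal (Real.exp (l * ∑ j,
      ((∑ b, w j b * X j b ω) * (∑ b, v j b * X j b ω) - w j ⬝ᵥ v j) -
      4 * l ^ 2 * ∑ j, (vnorm (w j) * vnorm (v j)) ^ 2)) ∂P ≤ 1 := by
  have hm : ∀ j b, Measurable (X j b) := fun j b => hX.measurable (j, b)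
  set f : J → (β → ℝ) → ENNReal := fun j x => ENNReal.ofReal (Real.exp (l *
    ((∑ b, w j b * x b) * (∑ b, v j b * x b) - w j ⬝ᵥ v j) -
      4 * l ^ 2 * (vnorm (w j) * vnorm (v j)) ^ 2)) with hf
  have he : ∀ ω, ENNReal.ofReal (Real.exp (l * ∑ j,
      ((∑ b, w j b * X j b ω) * (∑ b, v j b * X j b ω) - w j ⬝ᵥ v j) -
      4 * l ^ 2 * ∑ j, (vnorm (w j) * vnorm (v j)) ^ 2)) = ∏ j, f j (fun b => X j b ω) := fun ω => by
    rw [← ENNReal.ofReal_prod_of_nonneg fun _ _ => (Real.exp_pos _).le, ← Real.exp_sum,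
      Finset.mul_sum, Finset.mul_sum, ← Finset.sum_sub_distrib]
  simp_rw [he]
  rw [lintegral_prod_eq_prod_lintegral_of_indepFun Finset.univ
    (fun j ω => f j (fun b => X j b ω))
    (hX.iIndepFun_rows.comp f (fun j => by fun_prop)) (fun j => by fun_prop)]
  refine Finset.prod_le_one' fun j _ => ?_
  have hj : IsStdGaussian (X j) P := hX.precomp (f := fun b => (j, b)) (Prod.mk_right_injective j)
  exact hj.lintegral_exp_mul (w j) (v j) (hl j)

/-- Bernstein-type tail bound. -/
theorem IsStdGaussian.measure_sum_mul_le {J : Type*} [Fintype J] [Fintype β]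
    {X : J → β → Ω → ℝ} (hX : IsStdGaussian (fun p : J × β => X p.1 p.2) P) (w v : J → β → ℝ)
    {l : ℝ} (hl0 : 0 < l) (hl : ∀ j, l * (vnorm (w j) * vnorm (v j)) ≤ 1 / 8) {S : ℝ}
    (hS : ∑ j, (vnorm (w j) * vnorm (v j)) ^ 2 ≤ S) (t : ℝ) :
    P {ω | t < ∑ j, ((∑ b, w j b * X j b ω) * (∑ b, v j b * X j b ω) - w j ⬝ᵥ v j)} ≤
      ENNReal.ofReal (Real.exp (-(l * t - 4 * l ^ 2 * S))) := by
  have hm : ∀ j b, Measurable (X j b) := fun j b => hX.measurable (j, b)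
  have h := measure_le_of_lintegral_exp_le (by fun_prop)
    (hX.lintegral_exp_sum_mul w v (l := l) (by rwa [abs_of_pos hl0])) (l * t - 4 * l ^ 2 * S)
  refine le_trans (measure_mono fun ω hω => ?_) h
  have h1 : 4 * l ^ 2 * ∑ j, (vnorm (w j) * vnorm (v j)) ^ 2 ≤ 4 * l ^ 2 * S := by gcongr
  have h2 := mul_le_mul_of_nonneg_left (le_of_lt (Set.mem_ofPred.1 hω)) hl0.le
  simp only [Set.mem_ofPred_eq]
  linarith

/-! ### Conditioning on an independent variable -/

theorem lintegral_le_of_indepFun {𝓧 𝓨 : Type*} [MeasurableSpace 𝓧] [MeasurableSpace 𝓨]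
    [IsProbabilityMeasure P] {X : Ω → 𝓧} {Y : Ω → 𝓨} (hX : Measurable X) (hY : Measurable Y)
    (hXY : IndepFun X Y P) {f : 𝓧 × 𝓨 → ENNReal} (hf : Measurable f) {c : ENNReal}
    (h : ∀ x, ∫⁻ ω, f (x, Y ω) ∂P ≤ c) : ∫⁻ ω, f (X ω, Y ω) ∂P ≤ c := by
  have : IsProbabilityMeasure (P.map X) := Measure.isProbabilityMeasure_map hX.aemeasurable
  have : IsProbabilityMeasure (P.map Y) := Measure.isProbabilityMeasure_map hY.aemeasurable
  have h1 := lintegral_map (μ := P) hf (hX.prodMk hY)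
  rw [← h1, (indepFun_iff_map_prod_eq_prod_map_map hX.aemeasurable hY.aemeasurable).1 hXY,
    lintegral_prod _ hf.aemeasurable]
  calc ∫⁻ x, ∫⁻ y, f (x, y) ∂(P.map Y) ∂(P.map X) ≤ ∫⁻ _, c ∂(P.map X) := by
        refine lintegral_mono fun x => ?_
        exact (lintegral_map (hf.comp measurable_prodMk_left) hY).trans_le (h x)
    _ = c := by simp

theorem measure_le_of_indepFun {𝓧 𝓨 : Type*} [MeasurableSpace 𝓧] [MeasurableSpace 𝓨]
    [IsProbabilityMeasure P] {X : Ω → 𝓧} {Y : Ω → 𝓨} (hX : Measurable X) (hY : Measurable Y)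
    (hXY : IndepFun X Y P) {S : Set (𝓧 × 𝓨)} (hS : MeasurableSet S) {c : ENNReal}
    (h : ∀ x, P {ω | (x, Y ω) ∈ S} ≤ c) : P {ω | (X ω, Y ω) ∈ S} ≤ c := by
  have h1 := lintegral_le_of_indepFun hX hY hXY (f := S.indicator 1)
    (measurable_one.indicator hS) (c := c) (fun x => by
      refine le_trans (le_of_eq ?_) (h x)
      have hSx : MeasurableSet {ω | (x, Y ω) ∈ S} := hS.preimage (by fun_prop)
      rw [← lintegral_indicator_one hSx]
      rfl)
  refine le_trans (le_of_eq ?_) h1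
  have hSx : MeasurableSet {ω | (X ω, Y ω) ∈ S} := hS.preimage (by fun_prop)
  rw [← lintegral_indicator_one hSx]
  rfl

end Gaussian

/-! ### Nets of the unit ball -/

section Net

/-- A largest `1`-separated subset of the ball of radius `2` has at most `5 ^ d` points by volume
comparison, and by maximality it is a `1`-net of that ball. Scaled by one half, it tests the norm of
`y` up to a factor `2`: the net point `c` near `2 y / ‖y‖` satisfies `y ⬝ᵥ c ≥ ‖y‖`. -/
theorem exists_net (ι : Type*) [Fintype ι] :
    ∃ N : Finset (ι → ℝ), N.card ≤ 5 ^ Fintype.card ι ∧ (∀ z ∈ N, vnorm z ≤ 1) ∧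
      ∀ y : ι → ℝ, ∃ z ∈ N, vnorm y ≤ 2 * (y ⬝ᵥ z) := by
  classical
  let E := EuclideanSpace ℝ ι
  let Q : ℕ → Prop := fun k => ∃ s : Finset E, s.card = k ∧ (∀ c ∈ s, ‖c‖ ≤ 2) ∧
    ∀ c ∈ s, ∀ d ∈ s, c ≠ d → 1 ≤ ‖c - d‖
  have hbound : ∀ k, Q k → k ≤ 5 ^ Fintype.card ι := by
    rintro k ⟨s, rfl, h1, h2⟩
    simpa [E] using Besicovitch.card_le_of_separated s h1 h2
  have hQ0 : Q 1 := ⟨{0}, by simp, by simp, by simp⟩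
  obtain ⟨s, hs, h1, h2⟩ := Nat.findGreatest_spec (P := Q)
    (hbound 1 hQ0) hQ0
  set k := Nat.findGreatest Q (5 ^ Fintype.card ι) with hk
  have hmax : ∀ x : E, ‖x‖ ≤ 2 → ∃ c ∈ s, ‖x - c‖ < 1 := by
    intro x hx
    by_contra hcon
    push Not at hcon
    have hxs : x ∉ s := fun h => by have := hcon x h; simp at this; linarith
    have hQ : Q (k + 1) := by
      refine ⟨insert x s, by rw [Finset.card_insert_of_notMem hxs, hs], ?_, ?_⟩
      · intro c hc
        rcases Finset.mem_insert.1 hc with rfl | hc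
        · exact hx
        · exact h1 c hc
      · intro c hc d hd hcd
        rcases Finset.mem_insert.1 hc with rfl | hc' <;> rcases Finset.mem_insert.1 hd with rfl | hd'
        · exact absurd rfl hcd
        · exact hcon d hd'
        · rw [norm_sub_rev]; exact hcon c hc'
        · exact h2 c hc' d hd' hcd
    have := Nat.le_findGreatest (hbound _ hQ) hQ
    omega
  refine ⟨s.image fun c => (2 : ℝ)⁻¹ • WithLp.ofLp c, ?_, ?_, ?_⟩
  · refine Finset.card_image_le.trans ?_
    rw [hs]; exact Nat.findGreatest_le _
  · intro z hz
    obtain ⟨c, hc, rfl⟩ := Finset.mem_image.1 hz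
    rw [vnorm_smul]
    have := h1 c hc
    have e : vnorm (WithLp.ofLp c) = ‖c‖ := by simp [vnorm]
    rw [e, abs_of_pos (by norm_num)]
    linarith
  · intro y
    set x : E := (2 / vnorm y) • WithLp.toLp 2 y with hxdef
    have hy := vnorm_nonneg y
    have hx : ‖x‖ ≤ 2 := by
      rw [hxdef, norm_smul, Real.norm_of_nonneg (by positivity)]
      change 2 / vnorm y * vnorm y ≤ 2
      by_cases h0 : vnorm y = 0
      · rw [h0]; simp
      · rw [div_mul_cancel₀ _ h0]
    obtain ⟨c, hc, hxc⟩ := hmax x hx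
    refine ⟨(2 : ℝ)⁻¹ • WithLp.ofLp c, Finset.mem_image_of_mem _ hc, ?_⟩
    rw [dotProduct_smul, smul_eq_mul, ← mul_assoc, mul_inv_cancel₀ two_ne_zero, one_mul]
    by_cases h0 : vnorm y = 0
    · rw [h0, vnorm_eq_zero.1 h0]; simp
    have hpos : 0 < vnorm y := lt_of_le_of_ne hy (Ne.symm h0)
    have h3 := dotProduct_le_vnorm y ((2 / vnorm y) • y - WithLp.ofLp c)
    have h4 : vnorm ((2 / vnorm y) • y - WithLp.ofLp c) < 1 := by
      have : ‖x - c‖ = vnorm ((2 / vnorm y) • y - WithLp.ofLp c) := by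
        rw [vnorm, hxdef]; rfl
      rw [← this]; exact hxc
    rw [dotProduct_sub, dotProduct_smul, ← vnorm_sq, smul_eq_mul,
      show 2 / vnorm y * vnorm y ^ 2 = 2 * vnorm y by field_simp] at h3
    nlinarith

theorem exists_matrix_net (ι κ : Type*) [Fintype ι] [Fintype κ] :
    ∃ N : Finset (Matrix ι κ ℝ), N.card ≤ 5 ^ (Fintype.card ι * Fintype.card κ) ∧
      (∀ D ∈ N, ‖D‖ ≤ 1) ∧ ∀ Y : Matrix ι κ ℝ, ∃ D ∈ N, ‖Y‖ ≤ 2 * ∑ i, ∑ j, Y i j * D i j := by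
  classical
  obtain ⟨N, h1, h2, h3⟩ := exists_net (ι × κ)
  have e (y : ι × κ → ℝ) : ‖(Matrix.of fun i j => y (i, j) : Matrix ι κ ℝ)‖ = vnorm y := by
    rw [← sq_eq_sq₀ (norm_nonneg _) (vnorm_nonneg _), frob_sq, vnorm_sq, dotProduct,
      Fintype.sum_prod_type]
    simp [pow_two]
  refine ⟨N.image fun y => Matrix.of fun i j => y (i, j), ?_, ?_, ?_⟩
  · exact Finset.card_image_le.trans (by rwa [Fintype.card_prod] at h1)
  · intro D hD
    obtain ⟨y, hy, rfl⟩ := Finset.mem_image.1 hD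
    rw [e]; exact h2 y hy
  · intro Y
    obtain ⟨z, hz, h⟩ := h3 (fun p => Y p.1 p.2)
    refine ⟨_, Finset.mem_image_of_mem _ hz, ?_⟩
    rw [← e, dotProduct, Fintype.sum_prod_type] at h
    exact h

end Net

/-! ### Measurability of matrix-valued maps -/

section Measurability

variable {𝓧 ι κ ν : Type*} [MeasurableSpace 𝓧]

/-- All the entries of the matrix-valued map are measurable. -/
def EntrywiseMeasurable (M : 𝓧 → Matrix ι κ ℝ) : Prop := ∀ i j, Measurable fun x => M x i j

theorem EntrywiseMeasurable.const (M : Matrix ι κ ℝ) :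
    EntrywiseMeasurable fun _ : 𝓧 => M := fun _ _ => measurable_const

theorem EntrywiseMeasurable.transpose {M : 𝓧 → Matrix ι κ ℝ} (hM : EntrywiseMeasurable M) :
    EntrywiseMeasurable fun x => (M x)ᵀ := fun i j => hM j i

theorem EntrywiseMeasurable.mul [Fintype κ] {M : 𝓧 → Matrix ι κ ℝ} {N : 𝓧 → Matrix κ ν ℝ}
    (hM : EntrywiseMeasurable M) (hN : EntrywiseMeasurable N) :
    EntrywiseMeasurable fun x => M x * N x := fun i j => by
  simp only [Matrix.mul_apply]
  exact Finset.measurable_sum _ fun k _ => (hM i k).mul (hN k j)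

theorem EntrywiseMeasurable.sub {M N : 𝓧 → Matrix ι κ ℝ}
    (hM : EntrywiseMeasurable M) (hN : EntrywiseMeasurable N) :
    EntrywiseMeasurable fun x => M x - N x := fun i j => (hM i j).sub (hN i j)

theorem EntrywiseMeasurable.const_smul {M : 𝓧 → Matrix ι κ ℝ}
    (hM : EntrywiseMeasurable M) (c : ℝ) :
    EntrywiseMeasurable fun x => c • M x := fun i j => (hM i j).const_mul c

theorem EntrywiseMeasurable.sum {J : Type*} {s : Finset J} {M : J → 𝓧 → Matrix ι κ ℝ}
    (hM : ∀ j ∈ s, EntrywiseMeasurable (M j)) :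
    EntrywiseMeasurable fun x => ∑ j ∈ s, M j x := fun i k => by
  simp only [Matrix.sum_apply]
  exact Finset.measurable_sum _ fun j hj => hM j hj i k

theorem EntrywiseMeasurable.mulVec [Fintype κ] {M : 𝓧 → Matrix ι κ ℝ} {v : 𝓧 → κ → ℝ}
    (hM : EntrywiseMeasurable M) (hv : Measurable v) : Measurable fun x => M x *ᵥ v x := by
  refine measurable_pi_lambda _ fun i => ?_
  simp only [Matrix.mulVec, dotProduct]
  exact Finset.measurable_sum _ fun k _ => (hM i k).mul ((measurable_pi_apply k).comp hv)

theorem EntrywiseMeasurable.vecMulVec {v : 𝓧 → ι → ℝ} {w : 𝓧 → κ → ℝ} (hv : Measurable v)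
    (hw : Measurable w) : EntrywiseMeasurable fun x => Matrix.vecMulVec (v x) (w x) := fun i j =>
  ((measurable_pi_apply i).comp hv).mul ((measurable_pi_apply j).comp hw)

theorem EntrywiseMeasurable.det [Fintype ι] [DecidableEq ι] {M : 𝓧 → Matrix ι ι ℝ}
    (hM : EntrywiseMeasurable M) : Measurable fun x => (M x).det := by
  simp only [Matrix.det_apply']
  exact Finset.measurable_sum _ fun s _ => measurable_const.mul
    (Finset.measurable_prod _ fun i _ => hM _ _)

theorem EntrywiseMeasurable.inv [Fintype ι] [DecidableEq ι] {M : 𝓧 → Matrix ι ι ℝ}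
    (hM : EntrywiseMeasurable M) : EntrywiseMeasurable fun x => (M x)⁻¹ := fun i j => by
  simp only [Matrix.inv_def, Ring.inverse_eq_inv', Matrix.smul_apply, smul_eq_mul,
    Matrix.adjugate_apply]
  refine hM.det.inv.mul (EntrywiseMeasurable.det (M := fun x => (M x).updateRow j (Pi.single i 1))
    fun k l => ?_)
  by_cases h : k = j
  · subst h; simp only [Matrix.updateRow_self]; exact measurable_const
  · simp only [Matrix.updateRow_ne h]; exact hM k l

theorem EntrywiseMeasurable.pinv {m r : ℕ} {M : 𝓧 → Matrix (Fin m) (Fin r) ℝ}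
    (hM : EntrywiseMeasurable M) : EntrywiseMeasurable fun x => pinv (M x) :=
  (hM.transpose.mul hM).inv.mul hM.transpose

theorem EntrywiseMeasurable.norm [Fintype ι] [Fintype κ] {M : 𝓧 → Matrix ι κ ℝ}
    (hM : EntrywiseMeasurable M) : Measurable fun x => ‖M x‖ := by
  have : (fun x => ‖M x‖) = fun x => √(∑ i, ∑ j, M x i j ^ 2) := by
    funext x
    rw [← frob_sq, Real.sqrt_sq (norm_nonneg _)]
  rw [this]
  have h := hM
  unfold EntrywiseMeasurable at h
  fun_prop

theorem measurable_vnorm [Fintype ι] {v : 𝓧 → ι → ℝ} (hv : Measurable v) :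
    Measurable fun x => vnorm (v x) := by
  have : (fun x => vnorm (v x)) = fun x => √(∑ i, v x i * v x i) := by
    funext x
    rw [← Real.sqrt_sq (vnorm_nonneg (v x)), vnorm_sq, dotProduct]
  rw [this]
  fun_prop

end Measurability

/-! ### Least squares with a well-conditioned matrix -/

section LeastSquares

variable {m n r : ℕ}

/-- The smallest singular value of `W` is at least `√(m/2)`. -/
def WellConditioned (W : Matrix (Fin m) (Fin r) ℝ) : Prop :=
  ∀ z, (m : ℝ) / 2 * vnorm z ^ 2 ≤ vnorm (W *ᵥ z) ^ 2

/-- Closedness yields measurability, although the condition involves uncountably many `z`. -/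
theorem isClosed_wellConditioned :
    IsClosed {W : Fin m → Fin r → ℝ | WellConditioned (Matrix.of W)} := by
  simp only [WellConditioned, Set.ofPred_forall, vnorm_sq]
  refine isClosed_iInter fun z => isClosed_le continuous_const ?_
  simp only [Matrix.mulVec, dotProduct, Matrix.of_apply]
  fun_prop

theorem vnorm_sq_mulVec_eq (W : Matrix (Fin m) (Fin r) ℝ) (z : Fin r → ℝ) :
    vnorm (W *ᵥ z) ^ 2 = z ⬝ᵥ ((Wᵀ * W) *ᵥ z) := by
  rw [vnorm_sq, ← Matrix.mulVec_mulVec, Matrix.dotProduct_mulVec, ← Matrix.mulVec_transpose,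
    dotProduct_comm]

theorem WellConditioned.isUnit_det (hm : 0 < m) {W : Matrix (Fin m) (Fin r) ℝ}
    (hW : WellConditioned W) : IsUnit (Wᵀ * W).det := by
  rw [← Matrix.isUnit_iff_isUnit_det, ← Matrix.mulVec_injective_iff_isUnit]
  refine (injective_iff_map_eq_zero (Matrix.mulVecLin (Wᵀ * W))).2 fun z hz => ?_
  have h := hW z
  rw [vnorm_sq_mulVec_eq, show (Wᵀ * W) *ᵥ z = 0 from hz, dotProduct_zero] at h
  have hm' : (0 : ℝ) < m := by exact_mod_cast hm
  have : vnorm z ^ 2 ≤ 0 := by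
    by_contra hcon
    push Not at hcon
    have : 0 < (m : ℝ) / 2 * vnorm z ^ 2 := by positivity
    linarith
  exact vnorm_eq_zero.1 (pow_eq_zero_iff two_ne_zero |>.1 (le_antisymm this (sq_nonneg _)))

/-- The vector `y = pinv W v` solves the normal equations, so `(m/2) ‖y‖² ≤ ‖W y‖² = y ⬝ᵥ Wᵀ v`.
This reduces the least squares error to the `r`-dimensional vector `Wᵀ v`. -/
theorem WellConditioned.vnorm_pinv_mulVec_le (hm : 0 < m) {W : Matrix (Fin m) (Fin r) ℝ}
    (hW : WellConditioned W) (v : Fin m → ℝ) :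
    vnorm (pinv W *ᵥ v) ≤ 2 / m * vnorm (Wᵀ *ᵥ v) := by
  have hm' : (0 : ℝ) < m := by exact_mod_cast hm
  set y := pinv W *ᵥ v with hy
  have h1 : (Wᵀ * W) *ᵥ y = Wᵀ *ᵥ v := by
    rw [hy, pinv, Matrix.mulVec_mulVec, ← Matrix.mul_assoc,
      Matrix.mul_nonsing_inv _ (hW.isUnit_det hm), Matrix.one_mul]
  have h2 := hW y
  rw [vnorm_sq_mulVec_eq W, h1] at h2
  have h3 := dotProduct_le_vnorm y (Wᵀ *ᵥ v)
  have h4 := vnorm_nonneg y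
  rcases h4.eq_or_lt with h0 | h0
  · rw [← h0]; exact mul_nonneg (by positivity) (vnorm_nonneg _)
  have h5 : (m : ℝ) / 2 * vnorm y ≤ vnorm (Wᵀ *ᵥ v) := by
    by_contra hcon
    push Not at hcon
    nlinarith
  calc vnorm y = 2 / m * ((m : ℝ) / 2 * vnorm y) := by field_simp
    _ ≤ _ := by gcongr

/-- The left side is `hᵀ (Wᵀ W)⁻¹ h`. It is the variance of `(pinv W v) ⬝ᵥ h` for fixed `W` and
standard Gaussian `v`. -/
theorem WellConditioned.vnorm_sq_mulVec_inv_le (hm : 0 < m) {W : Matrix (Fin m) (Fin r) ℝ}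
    (hW : WellConditioned W) (h : Fin r → ℝ) :
    vnorm (W *ᵥ ((Wᵀ * W)⁻¹ *ᵥ h)) ^ 2 ≤ 2 / m * vnorm h ^ 2 := by
  have hm' : (0 : ℝ) < m := by exact_mod_cast hm
  set y := (Wᵀ * W)⁻¹ *ᵥ h with hy
  have h1 : (Wᵀ * W) *ᵥ y = h := by
    rw [hy, Matrix.mulVec_mulVec, Matrix.mul_nonsing_inv _ (hW.isUnit_det hm), Matrix.one_mulVec]
  have h2 := hW y
  have h3 := dotProduct_le_vnorm y h
  have e := vnorm_sq_mulVec_eq W y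
  rw [h1] at e
  have h4 := vnorm_nonneg y
  have h5 := vnorm_nonneg h
  rw [e] at h2 ⊢
  have h6 : (m : ℝ) / 2 * (y ⬝ᵥ h) ≤ vnorm h ^ 2 := by
    have h7 : (m : ℝ) / 2 * vnorm y ≤ vnorm h := by
      rcases h4.eq_or_lt with h0 | h0
      · rw [← h0]; simpa using h5
      by_contra hcon
      push Not at hcon
      nlinarith
    calc (m : ℝ) / 2 * (y ⬝ᵥ h) ≤ (m : ℝ) / 2 * (vnorm y * vnorm h) := by gcongr
      _ = ((m : ℝ) / 2 * vnorm y) * vnorm h := by ring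
      _ ≤ vnorm h * vnorm h := by gcongr
      _ = _ := by ring
  calc y ⬝ᵥ h = 2 / m * ((m : ℝ) / 2 * (y ⬝ᵥ h)) := by field_simp
    _ ≤ _ := by gcongr

theorem pinv_mulVec_dotProduct (W : Matrix (Fin m) (Fin r) ℝ) (v : Fin m → ℝ) (h : Fin r → ℝ) :
    (pinv W *ᵥ v) ⬝ᵥ h = v ⬝ᵥ (W *ᵥ ((Wᵀ * W)⁻¹ *ᵥ h)) := by
  have : (pinv W)ᵀ = W * (Wᵀ * W)⁻¹ := by
    rw [pinv, Matrix.transpose_mul, Matrix.transpose_transpose, Matrix.transpose_nonsing_inv,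
      Matrix.transpose_mul, Matrix.transpose_transpose]
  rw [Matrix.mulVec_mulVec, ← this, Matrix.dotProduct_mulVec, Matrix.vecMul_transpose]

/-- Least squares recovers the part of `x` in the range of `U` exactly, so the error comes from the
residual alone. -/
theorem WellConditioned.lsCoeff_eq (hm : 0 < m) {A : Matrix (Fin m) (Fin n) ℝ}
    {U : Matrix (Fin n) (Fin r) ℝ} (hW : WellConditioned (A * U)) (x : Fin n → ℝ) :
    lsCoeff A U x = Uᵀ *ᵥ x + pinv (A * U) *ᵥ (A *ᵥ (x - U *ᵥ (Uᵀ *ᵥ x))) := by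
  have h1 : pinv (A * U) * (A * U) = 1 := by
    rw [pinv, Matrix.mul_assoc, Matrix.nonsing_inv_mul _ (hW.isUnit_det hm)]
  rw [lsCoeff, Matrix.mulVec_sub, Matrix.mulVec_sub, Matrix.mulVec_mulVec _ A U,
    Matrix.mulVec_mulVec _ (pinv (A * U)) (A * U), h1, Matrix.one_mulVec]
  abel

end LeastSquares

/-! ### Concentration for one measurement matrix -/

section SingleMatrix

variable {Ω : Type*} {mΩ : MeasurableSpace Ω} {P : Measure Ω} {m n r : ℕ}

theorem transpose_mulVec_dotProduct {ι κ : Type*} [Fintype ι] [Fintype κ] (M : Matrix ι κ ℝ)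
    (v : ι → ℝ) (z : κ → ℝ) : (Mᵀ *ᵥ v) ⬝ᵥ z = v ⬝ᵥ (M *ᵥ z) := by
  rw [Matrix.dotProduct_mulVec, Matrix.mulVec_transpose]

theorem mulVec_dotProduct_mulVec {ι κ : Type*} [Fintype ι] [Fintype κ] [DecidableEq κ]
    {U : Matrix ι κ ℝ} (hU : Uᵀ * U = 1) (v w : κ → ℝ) : (U *ᵥ v) ⬝ᵥ (U *ᵥ w) = v ⬝ᵥ w := by
  rw [← transpose_mulVec_dotProduct, Matrix.mulVec_mulVec, hU, Matrix.one_mulVec]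

theorem mulVec_apply_eq_sum (A : Matrix (Fin m) (Fin n) ℝ) (v : Fin n → ℝ) (i : Fin m) :
    (A *ᵥ v) i = ∑ b, v b * A i b := by
  simp [Matrix.mulVec, dotProduct, mul_comm]

theorem measure_biUnion_le_of_card_le {ι : Type*} {N : Finset ι} {S : ι → Set Ω} {k p : ℝ}
    (hN : (N.card : ℝ) ≤ k) (h : ∀ z ∈ N, P (S z) ≤ ENNReal.ofReal p) :
    P (⋃ z ∈ N, S z) ≤ ENNReal.ofReal (k * p) := by
  refine (measure_biUnion_finset_le N S).trans ((Finset.sum_le_sum h).trans ?_)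
  rw [Finset.sum_const, nsmul_eq_mul, ENNReal.ofReal_mul (le_trans (Nat.cast_nonneg _) hN)]
  gcongr
  rw [← ENNReal.ofReal_natCast]
  exact ENNReal.ofReal_le_ofReal hN

/-- The net is applied twice to the symmetric matrix `Q = Wᵀ W - m`. Entries `m / 8` between net
points give `‖Q z‖ ≤ m / 4` for net points `z`, hence `‖Q y‖ ≤ (m / 2) ‖y‖` for all `y`. The pairs
of net points account for `25 ^ r`. -/
theorem measure_not_wellConditioned_le {A : Ω → Matrix (Fin m) (Fin n) ℝ}
    (hA : IsStdGaussian (fun (p : Fin m × Fin n) ω => A ω p.1 p.2) P)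
    {U : Matrix (Fin n) (Fin r) ℝ} (hU : Uᵀ * U = 1) :
    P {ω | ¬ WellConditioned (A ω * U)} ≤
      ENNReal.ofReal (25 ^ r * Real.exp (-(m / 1024))) := by
  obtain ⟨N, hN1, hN2, hN3⟩ := exists_net (Fin r)
  have hsub : {ω | ¬ WellConditioned (A ω * U)} ⊆ ⋃ z ∈ N ×ˢ N,
      {ω | (m : ℝ) / 8 < ∑ i, ((∑ b, (U *ᵥ z.1) b * A ω i b) * (∑ b, (U *ᵥ z.2) b * A ω i b) -
        (U *ᵥ z.1) ⬝ᵥ (U *ᵥ z.2))} := by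
    intro ω hω
    by_contra hcon
    refine hω fun y => ?_
    simp only [Set.mem_iUnion, not_exists, Set.mem_ofPred_eq, not_lt] at hcon
    set W := A ω * U with hW
    set Q := Wᵀ * W - (m : ℝ) • (1 : Matrix (Fin r) (Fin r) ℝ) with hQ
    have hQt : Qᵀ = Q := by simp [hQ]
    have hQz : ∀ z ∈ N, ∀ z' ∈ N, (Q *ᵥ z) ⬝ᵥ z' ≤ m / 8 := by
      intro z hz z' hz'
      have h := hcon (z, z') (Finset.mem_product.2 ⟨hz, hz'⟩)
      refine le_trans (le_of_eq ?_) h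
      simp only [← mulVec_apply_eq_sum, mulVec_dotProduct_mulVec hU]
      rw [Finset.sum_sub_distrib, Finset.sum_const, Finset.card_univ, Fintype.card_fin,
        nsmul_eq_mul, hQ, Matrix.sub_mulVec, sub_dotProduct, Matrix.smul_mulVec, smul_dotProduct,
        Matrix.one_mulVec, Matrix.mulVec_mulVec, Matrix.mulVec_mulVec, ← hW, smul_eq_mul,
        ← Matrix.mulVec_mulVec, transpose_mulVec_dotProduct]
      rfl
    have hQN : ∀ z ∈ N, vnorm (Q *ᵥ z) ≤ m / 4 := by
      intro z hz
      obtain ⟨z', hz', h⟩ := hN3 (Q *ᵥ z)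
      linarith [hQz z hz z' hz']
    have hQy : vnorm (Q *ᵥ y) ≤ m / 2 * vnorm y := by
      obtain ⟨z, hz, h⟩ := hN3 (Q *ᵥ y)
      have h1 : (Q *ᵥ y) ⬝ᵥ z = y ⬝ᵥ (Q *ᵥ z) := by
        rw [← transpose_mulVec_dotProduct, hQt]
      have h2 := dotProduct_le_vnorm y (Q *ᵥ z)
      have h3 := mul_le_mul_of_nonneg_left (hQN z hz) (vnorm_nonneg y)
      linarith
    have h1 := dotProduct_le_vnorm (-y) (Q *ᵥ y)
    have h2 : vnorm (-y) = vnorm y := by rw [← neg_one_smul ℝ, vnorm_smul]; simp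
    have h3 : y ⬝ᵥ (Q *ᵥ y) = vnorm (W *ᵥ y) ^ 2 - m * vnorm y ^ 2 := by
      rw [vnorm_sq_mulVec_eq, hQ, Matrix.sub_mulVec, dotProduct_sub, Matrix.smul_mulVec,
        dotProduct_smul, Matrix.one_mulVec, vnorm_sq, smul_eq_mul]
    rw [neg_dotProduct, h2, h3] at h1
    have h4 := mul_le_mul_of_nonneg_left hQy (vnorm_nonneg y)
    nlinarith
  refine (measure_mono hsub).trans (measure_biUnion_le_of_card_le ?_ ?_)
  · rw [Finset.card_product, Fintype.card_fin] at *
    calc ((N.card * N.card : ℕ) : ℝ) ≤ ((5 ^ r * 5 ^ r : ℕ) : ℝ) := by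
          exact_mod_cast Nat.mul_le_mul hN1 hN1
      _ = 25 ^ r := by push_cast; rw [← mul_pow]; norm_num
  · rintro ⟨z, z'⟩ hz
    obtain ⟨hz, hz'⟩ := Finset.mem_product.1 hz
    have hzz : vnorm (U *ᵥ z) * vnorm (U *ᵥ z') ≤ 1 := by
      rw [vnorm_mulVec_of_orthonormal hU, vnorm_mulVec_of_orthonormal hU]
      exact mul_le_one₀ (hN2 z hz) (vnorm_nonneg _) (hN2 z' hz')
    have hzz0 : 0 ≤ vnorm (U *ᵥ z) * vnorm (U *ᵥ z') :=
      mul_nonneg (vnorm_nonneg _) (vnorm_nonneg _)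
    -- The value `l = t / (8 S)`, with `t = m / 8` and `S = m`, maximizes `l t - 4 l² S`.
    refine (IsStdGaussian.measure_sum_mul_le (X := fun i b ω => A ω i b) hA
      (fun _ => U *ᵥ z) (fun _ => U *ᵥ z') (l := 1 / 64) (by norm_num)
      (fun _ => by linarith) (S := m) ?_ (m / 8)).trans (le_of_eq ?_)
    · rw [Finset.sum_const, Finset.card_univ, Fintype.card_fin, nsmul_eq_mul]
      exact mul_le_of_le_one_right (Nat.cast_nonneg _) (pow_le_one₀ hzz0 hzz)
    · congr 2; ring

theorem measure_lt_vnorm_transpose_mulVec_le {A : Ω → Matrix (Fin m) (Fin n) ℝ}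
    (hA : IsStdGaussian (fun (p : Fin m × Fin n) ω => A ω p.1 p.2) P)
    {U : Matrix (Fin n) (Fin r) ℝ} (hU : Uᵀ * U = 1) {y : Fin n → ℝ} (hy : Uᵀ *ᵥ y = 0) :
    P {ω | m / 20 * vnorm y < vnorm ((A ω * U)ᵀ *ᵥ (A ω *ᵥ y))} ≤
      ENNReal.ofReal (5 ^ r * Real.exp (-(m / 25600))) := by
  by_cases hy0 : y = 0
  · subst hy0
    simp [vnorm_zero]
  have hypos : 0 < vnorm y :=
    lt_of_le_of_ne (vnorm_nonneg _) (Ne.symm (mt vnorm_eq_zero.1 hy0))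
  obtain ⟨N, hN1, hN2, hN3⟩ := exists_net (Fin r)
  have hsub : {ω | m / 20 * vnorm y < vnorm ((A ω * U)ᵀ *ᵥ (A ω *ᵥ y))} ⊆ ⋃ z ∈ N,
      {ω | (m : ℝ) / 40 * vnorm y < ∑ i, ((∑ b, y b * A ω i b) * (∑ b, (U *ᵥ z) b * A ω i b) -
        y ⬝ᵥ (U *ᵥ z))} := by
    intro ω hω
    obtain ⟨z, hz, h⟩ := hN3 ((A ω * U)ᵀ *ᵥ (A ω *ᵥ y))
    refine Set.mem_biUnion hz ?_
    simp only [Set.mem_ofPred_eq] at hω ⊢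
    simp only [← mulVec_apply_eq_sum, ← transpose_mulVec_dotProduct, hy, zero_dotProduct, sub_zero]
    rw [transpose_mulVec_dotProduct, ← Matrix.mulVec_mulVec] at h
    have : ∑ i, (A ω *ᵥ y) i * (A ω *ᵥ U *ᵥ z) i = (A ω *ᵥ y) ⬝ᵥ (A ω *ᵥ U *ᵥ z) := rfl
    rw [this]
    linarith
  refine (measure_mono hsub).trans (measure_biUnion_le_of_card_le ?_ ?_)
  · rw [Fintype.card_fin] at hN1
    exact_mod_cast hN1
  · intro z hz
    have hzz : vnorm (U *ᵥ z) ≤ 1 := by rw [vnorm_mulVec_of_orthonormal hU]; exact hN2 z hz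
    have h0 := vnorm_nonneg (U *ᵥ z)
    have h1 : vnorm y * vnorm (U *ᵥ z) ≤ vnorm y := mul_le_of_le_one_right hypos.le hzz
    -- Again `l = t / (8 S)`, now with `t = m ‖y‖ / 40` and `S = m ‖y‖²`. The products have mean
    -- zero because `Uᵀ y = 0`.
    refine (IsStdGaussian.measure_sum_mul_le (X := fun i b ω => A ω i b) hA
      (fun _ => y) (fun _ => U *ᵥ z) (l := 1 / (320 * vnorm y)) (by positivity)
      (fun _ => ?_) (S := m * vnorm y ^ 2) ?_ (m / 40 * vnorm y)).trans (le_of_eq ?_)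
    · rw [div_mul_eq_mul_div, one_mul, div_le_div_iff₀ (by positivity) (by norm_num)]
      linarith
    · rw [Finset.sum_const, Finset.card_univ, Fintype.card_fin, nsmul_eq_mul]
      gcongr
    · congr 2; field_simp; ring

/-- The least squares coefficients are accurate with overwhelming probability. -/
theorem measure_lsCoeff_le (hm : 0 < m) {A : Ω → Matrix (Fin m) (Fin n) ℝ}
    (hA : IsStdGaussian (fun (p : Fin m × Fin n) ω => A ω p.1 p.2) P)
    {U : Matrix (Fin n) (Fin r) ℝ} (hU : Uᵀ * U = 1) (x : Fin n → ℝ) :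
    P {ω | ¬ (WellConditioned (A ω * U) ∧
      vnorm (lsCoeff (A ω) U x - Uᵀ *ᵥ x) ≤ 0.1 * vnorm (x - U *ᵥ (Uᵀ *ᵥ x)))} ≤
      ENNReal.ofReal (2 * 25 ^ r * Real.exp (-(m / 25600))) := by
  set y := x - U *ᵥ (Uᵀ *ᵥ x) with hy
  have hUy : Uᵀ *ᵥ y = 0 := by
    rw [hy, Matrix.mulVec_sub, Matrix.mulVec_mulVec _ Uᵀ U, hU, Matrix.one_mulVec, sub_self]
  have hm' : (0 : ℝ) < m := by exact_mod_cast hm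
  have hsub : {ω | ¬ (WellConditioned (A ω * U) ∧
      vnorm (lsCoeff (A ω) U x - Uᵀ *ᵥ x) ≤ 0.1 * vnorm y)} ⊆
      {ω | ¬ WellConditioned (A ω * U)} ∪
        {ω | m / 20 * vnorm y < vnorm ((A ω * U)ᵀ *ᵥ (A ω *ᵥ y))} := by
    intro ω hω
    by_contra hcon
    simp only [Set.mem_union, Set.mem_ofPred_eq, not_or, not_not, not_lt] at hcon
    refine hω ⟨hcon.1, ?_⟩
    rw [hcon.1.lsCoeff_eq hm x, add_sub_cancel_left, ← hy]
    refine (hcon.1.vnorm_pinv_mulVec_le hm _).trans ?_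
    calc 2 / (m : ℝ) * vnorm ((A ω * U)ᵀ *ᵥ (A ω *ᵥ y)) ≤ 2 / m * (m / 20 * vnorm y) := by
          gcongr; exact hcon.2
      _ = 0.1 * vnorm y := by field_simp; ring
  refine (measure_mono hsub).trans ((measure_union_le _ _).trans ((add_le_add
    (measure_not_wellConditioned_le hA hU) (measure_lt_vnorm_transpose_mulVec_le hA hU hUy)).trans ?_))
  rw [← ENNReal.ofReal_add (by positivity) (by positivity)]
  refine ENNReal.ofReal_le_ofReal ?_
  have h1 : (25 : ℝ) ^ r * Real.exp (-(m / 1024)) ≤ 25 ^ r * Real.exp (-(m / 25600)) := by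
    gcongr; norm_num
  have h2 : (5 : ℝ) ^ r * Real.exp (-(m / 25600)) ≤ 25 ^ r * Real.exp (-(m / 25600)) := by
    gcongr; norm_num
  linarith

end SingleMatrix

/-! ### Concentration of sums over many measurement matrices -/

section Batch

variable {Ω : Type*} {mΩ : MeasurableSpace Ω} {P : Measure Ω} {J : Type*} [Fintype J] {m n r : ℕ}

theorem sum_vecMulVec_mul (v : Fin n → ℝ) (w : Fin r → ℝ) (D : Matrix (Fin n) (Fin r) ℝ) :
    ∑ i, ∑ j, Matrix.vecMulVec v w i j * D i j = v ⬝ᵥ (D *ᵥ w) := by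
  simp only [dotProduct, Matrix.mulVec, Matrix.vecMulVec_apply, Finset.mul_sum]
  exact Finset.sum_congr rfl fun i _ => Finset.sum_congr rfl fun j _ => by ring

theorem sum_sum_vecMulVec_mul (v : J → Fin n → ℝ) (w : J → Fin r → ℝ)
    (D : Matrix (Fin n) (Fin r) ℝ) :
    ∑ i, ∑ k, (∑ j, Matrix.vecMulVec (v j) (w j)) i k * D i k = ∑ j, v j ⬝ᵥ (D *ᵥ w j) := by
  simp only [← sum_vecMulVec_mul, Matrix.sum_apply, Finset.sum_mul]
  rw [Finset.sum_comm_cycle, Finset.sum_comm]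

/-- Concentration of the sum of the gradients of the columns, for fixed coefficients. -/
theorem measure_lt_norm_gradient_sub_le {A : J → Ω → Matrix (Fin m) (Fin n) ℝ}
    (hA : IsStdGaussian (fun (p : J × Fin m × Fin n) ω => A p.1 ω p.2.1 p.2.2) P)
    (w : J → Fin n → ℝ) (b : J → Fin r → ℝ) {l S : ℝ} (hl0 : 0 < l)
    (hl : ∀ j, l * (vnorm (w j) * vnorm (b j)) ≤ 1 / 8)
    (hS : ∀ D : Matrix (Fin n) (Fin r) ℝ, ‖D‖ ≤ 1 →
      m * ∑ j, (vnorm (w j) * vnorm (D *ᵥ b j)) ^ 2 ≤ S) (t : ℝ) :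
    P {ω | 2 * t < ‖∑ j, Matrix.vecMulVec ((A j ω)ᵀ *ᵥ (A j ω *ᵥ w j)) (b j) -
      (m : ℝ) • ∑ j, Matrix.vecMulVec (w j) (b j)‖} ≤
      ENNReal.ofReal (5 ^ (n * r) * Real.exp (-(l * t - 4 * l ^ 2 * S))) := by
  obtain ⟨N, hN1, hN2, hN3⟩ := exists_matrix_net (Fin n) (Fin r)
  have hA' : IsStdGaussian (fun (p : (J × Fin m) × Fin n) ω => A p.1.1 ω p.1.2 p.2) P :=
    hA.precomp (f := fun p : (J × Fin m) × Fin n => (p.1.1, p.1.2, p.2))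
      (fun p p' h => by simp only [Prod.mk.injEq] at h; ext <;> simp [h])
  have hsub : {ω | 2 * t < ‖∑ j, Matrix.vecMulVec ((A j ω)ᵀ *ᵥ (A j ω *ᵥ w j)) (b j) -
      (m : ℝ) • ∑ j, Matrix.vecMulVec (w j) (b j)‖} ⊆ ⋃ D ∈ N,
      {ω | t < ∑ p : J × Fin m, ((∑ c, w p.1 c * A p.1 ω p.2 c) *
        (∑ c, (D *ᵥ b p.1) c * A p.1 ω p.2 c) - w p.1 ⬝ᵥ (D *ᵥ b p.1))} := by
    intro ω hω
    obtain ⟨D, hD, h⟩ := hN3 (∑ j, Matrix.vecMulVec ((A j ω)ᵀ *ᵥ (A j ω *ᵥ w j)) (b j) -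
      (m : ℝ) • ∑ j, Matrix.vecMulVec (w j) (b j))
    refine Set.mem_biUnion hD ?_
    simp only [Set.mem_ofPred_eq] at hω ⊢
    have e : ∑ i, ∑ j, (∑ j, Matrix.vecMulVec ((A j ω)ᵀ *ᵥ (A j ω *ᵥ w j)) (b j) -
        (m : ℝ) • ∑ j, Matrix.vecMulVec (w j) (b j)) i j * D i j =
        ∑ p : J × Fin m, ((∑ c, w p.1 c * A p.1 ω p.2 c) *
        (∑ c, (D *ᵥ b p.1) c * A p.1 ω p.2 c) - w p.1 ⬝ᵥ (D *ᵥ b p.1)) := by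
      simp only [Matrix.sub_apply, Matrix.smul_apply, sub_mul, smul_eq_mul, mul_assoc,
        Finset.sum_sub_distrib, ← Finset.mul_sum, sum_sum_vecMulVec_mul]
      rw [Fintype.sum_prod_type, Fintype.sum_prod_type, Finset.mul_sum]
      congr 1
      · refine Finset.sum_congr rfl fun j _ => ?_
        simp only [← mulVec_apply_eq_sum]
        rw [transpose_mulVec_dotProduct]
        rfl
      · simp
    rw [e] at h
    linarith
  refine (measure_mono hsub).trans (measure_biUnion_le_of_card_le ?_ ?_)
  · rw [Fintype.card_fin, Fintype.card_fin] at hN1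
    exact_mod_cast hN1
  · intro D hD
    have hDn := hN2 D hD
    refine IsStdGaussian.measure_sum_mul_le (X := fun (p : J × Fin m) c ω => A p.1 ω p.2 c) hA'
      (fun p => w p.1) (fun p => D *ᵥ b p.1) hl0 (fun p => ?_) ?_ t
    · refine le_trans ?_ (hl p.1)
      gcongr
      · exact vnorm_nonneg _
      · exact (vnorm_mulVec_le D _).trans (mul_le_of_le_one_left (vnorm_nonneg _) hDn)
    · refine le_trans (le_of_eq ?_) (hS D hDn)
      rw [Fintype.sum_prod_type, Finset.mul_sum]
      simp

/-- Concentration of the sum of the least squares errors, weighted by the vectors `g j`. -/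
theorem measure_lt_norm_lsError_le (hm : 0 < m) {A : J → Ω → Matrix (Fin m) (Fin n) ℝ}
    (hA : IsStdGaussian (fun (p : J × Fin m × Fin n) ω => A p.1 ω p.2.1 p.2.2) P)
    (U : Matrix (Fin n) (Fin r) ℝ) (y : J → Fin n → ℝ)
    (hy : ∀ j, Uᵀ *ᵥ y j = 0) (g : J → Fin r → ℝ) {l S : ℝ} (hl0 : 0 < l)
    (hS : ∀ D : Matrix (Fin r) (Fin r) ℝ, ‖D‖ ≤ 1 →
      ∑ j, vnorm (y j) ^ 2 * vnorm (D *ᵥ g j) ^ 2 ≤ S) (t : ℝ) :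
    P {ω | (∀ j, WellConditioned (A j ω * U)) ∧ 2 * t <
      ‖∑ j, Matrix.vecMulVec (pinv (A j ω * U) *ᵥ (A j ω *ᵥ y j)) (g j)‖} ≤
      ENNReal.ofReal (5 ^ (r * r) * Real.exp (-(l * t - l ^ 2 * S / m))) := by
  classical
  have hprob := hA.indep.isProbabilityMeasure
  have hm' : (0 : ℝ) < m := by exact_mod_cast hm
  have hAm : ∀ j i c, Measurable fun ω => A j ω i c := fun j i c => hA.measurable (j, i, c)
  obtain ⟨N, hN1, hN2, hN3⟩ := exists_matrix_net (Fin r) (Fin r)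
  -- the vectors `W (Wᵀ W)⁻¹ D g` as functions of the entries of the matrices `W = A U`
  set c : Matrix (Fin r) (Fin r) ℝ → (J × Fin m × Fin r → ℝ) → J → Fin m → ℝ := fun D W j =>
    (Matrix.of fun i k => W (j, i, k)) *ᵥ (((Matrix.of fun i k => W (j, i, k))ᵀ *
      (Matrix.of fun i k => W (j, i, k)))⁻¹ *ᵥ (D *ᵥ g j)) with hc
  set good : Set (J × Fin m × Fin r → ℝ) := {W | ∀ j, WellConditioned (Matrix.of fun i k => W (j, i, k))}
    with hgood
  set WW : Ω → J × Fin m × Fin r → ℝ := fun ω p => (A p.1 ω * U) p.2.1 p.2.2 with hWW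
  set vv : Ω → J × Fin m → ℝ := fun ω p => (A p.1 ω *ᵥ y p.1) p.2 with hvv
  have hgoodm : MeasurableSet good := by
    rw [hgood, Set.ofPred_forall]
    refine MeasurableSet.iInter fun j => ?_
    exact (isClosed_wellConditioned.measurableSet).preimage
      (f := fun (W : J × Fin m × Fin r → ℝ) (i : Fin m) (k : Fin r) => W (j, i, k)) (by fun_prop)
  have hWW_lin : WW = fun ω p => ∑ a : J × Fin m × Fin n,
      (if a.1 = p.1 then (if a.2.1 = p.2.1 then U a.2.2 p.2.2 else 0) else 0) *
        A a.1 ω a.2.1 a.2.2 := by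
    funext ω p
    simp [hWW, Fintype.sum_prod_type, Finset.sum_ite_irrel, Matrix.mul_apply, mul_comm]
  have hvv_lin : vv = fun ω p => ∑ a : J × Fin m × Fin n,
      (if a.1 = p.1 then (if a.2.1 = p.2 then y p.1 a.2.2 else 0) else 0) *
        A a.1 ω a.2.1 a.2.2 := by
    funext ω p
    simp [hvv, Fintype.sum_prod_type, ite_mul, Finset.sum_ite_irrel, mulVec_apply_eq_sum]
  -- Each row of `A j` is isotropic, so `Uᵀ y j = 0` makes `A j U` and `A j (y j)` uncorrelated;
  -- entries from different rows or different `j` are uncorrelated anyway.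
  have hindep : IndepFun WW vv P := by
    rw [hWW_lin, hvv_lin]
    refine hA.indepFun_linear
      (fun (p : J × Fin m × Fin r) a => if a.1 = p.1 then
        (if a.2.1 = p.2.1 then U a.2.2 p.2.2 else 0) else 0)
      (fun (p : J × Fin m) a => if a.1 = p.1 then
        (if a.2.1 = p.2 then y p.1 a.2.2 else 0) else 0) fun p p' => ?_
    have h0 : ∑ b, U b p.2.2 * y p'.1 b = 0 := congrFun (hy p'.1) p.2.2
    simp only [Fintype.sum_prod_type, ite_mul, mul_ite, zero_mul, mul_zero, Finset.sum_ite_irrel,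
      Finset.sum_const_zero, Finset.sum_ite_eq', Finset.mem_univ, if_true]
    split_ifs <;> simp [h0]
  have hWWm : Measurable WW := by rw [hWW_lin]; fun_prop
  have hvvm : Measurable vv := by rw [hvv_lin]; fun_prop
  have hcm : ∀ D j i, Measurable fun W => c D W j i := by
    intro D j i
    have hW : EntrywiseMeasurable (fun W : J × Fin m × Fin r → ℝ =>
      (Matrix.of fun i k => W (j, i, k) : Matrix (Fin m) (Fin r) ℝ)) := fun i k => by
        simp only [Matrix.of_apply]; fun_prop
    exact (measurable_pi_apply i).comp
      (hW.mulVec ((hW.transpose.mul hW).inv.mulVec measurable_const))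
  -- exponential moments
  have hexp : ∀ D : Matrix (Fin r) (Fin r) ℝ, ‖D‖ ≤ 1 →
      ∫⁻ ω, good.indicator (fun W => ENNReal.ofReal (Real.exp
        (l * ∑ p : J × Fin m, c D W p.1 p.2 * vv ω p - l ^ 2 * S / m))) (WW ω) ∂P ≤ 1 := by
    intro D hD
    refine lintegral_le_of_indepFun hWWm hvvm hindep
      (f := fun x => good.indicator (fun W => ENNReal.ofReal (Real.exp
        (l * ∑ p : J × Fin m, c D W p.1 p.2 * x.2 p - l ^ 2 * S / m))) x.1) ?_ fun W => ?_
    · have : (fun x : (J × Fin m × Fin r → ℝ) × (J × Fin m → ℝ) => good.indicator (fun W =>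
          ENNReal.ofReal (Real.exp
          (l * ∑ p : J × Fin m, c D W p.1 p.2 * x.2 p - l ^ 2 * S / m))) x.1) =
          (Prod.fst ⁻¹' good).indicator (fun x : (J × Fin m × Fin r → ℝ) × (J × Fin m → ℝ) =>
          ENNReal.ofReal (Real.exp
          (l * ∑ p : J × Fin m, c D x.1 p.1 p.2 * x.2 p - l ^ 2 * S / m))) := by
        funext x
        by_cases hx : x.1 ∈ good
        · rw [Set.indicator_of_mem hx, Set.indicator_of_mem (by exact hx)]
        · rw [Set.indicator_of_notMem hx, Set.indicator_of_notMem (by exact hx)]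
      rw [this]
      refine Measurable.indicator ?_ (hgoodm.preimage measurable_fst)
      have h1 : ∀ p : J × Fin m, Measurable
          fun x : (J × Fin m × Fin r → ℝ) × (J × Fin m → ℝ) => c D x.1 p.1 p.2 :=
        fun p => (hcm D p.1 p.2).comp measurable_fst
      fun_prop
    · by_cases hW : W ∈ good
      swap
      · simp [Set.indicator_of_notMem hW]
      simp only [Set.indicator_of_mem hW]
      -- With `W` frozen, the exponent is linear in the Gaussian entries and half its variance is at
      -- most `l² S / m`. The indicator of `good` removes the `W` for which this variance is not
      -- controlled.
      have hlin : ∀ ω, l * ∑ p : J × Fin m, c D W p.1 p.2 * vv ω p =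
          ∑ a : J × Fin m × Fin n, (l * c D W a.1 a.2.1 * y a.1 a.2.2) * A a.1 ω a.2.1 a.2.2 := by
        intro ω
        simp only [hvv, mulVec_apply_eq_sum, Fintype.sum_prod_type, Finset.mul_sum, mul_assoc]
      have hvar : (∑ a : J × Fin m × Fin n, (l * c D W a.1 a.2.1 * y a.1 a.2.2) ^ 2) / 2 ≤
          l ^ 2 * S / m := by
        have e : ∑ a : J × Fin m × Fin n, (l * c D W a.1 a.2.1 * y a.1 a.2.2) ^ 2 =
            l ^ 2 * ∑ j, vnorm (c D W j) ^ 2 * vnorm (y j) ^ 2 := by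
          simp only [Fintype.sum_prod_type, vnorm_sq, dotProduct, Finset.mul_sum, Finset.sum_mul]
          refine Finset.sum_congr rfl fun j _ => ?_
          rw [Finset.sum_comm]
          refine Finset.sum_congr rfl fun i _ => Finset.sum_congr rfl fun b _ => by ring
        rw [e]
        have h1 : ∑ j, vnorm (c D W j) ^ 2 * vnorm (y j) ^ 2 ≤ 2 / m * S := by
          calc ∑ j, vnorm (c D W j) ^ 2 * vnorm (y j) ^ 2
              ≤ ∑ j, 2 / m * (vnorm (y j) ^ 2 * vnorm (D *ᵥ g j) ^ 2) := by
                refine Finset.sum_le_sum fun j _ => ?_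
                have := (hW j).vnorm_sq_mulVec_inv_le hm (D *ᵥ g j)
                calc vnorm (c D W j) ^ 2 * vnorm (y j) ^ 2
                    ≤ (2 / m * vnorm (D *ᵥ g j) ^ 2) * vnorm (y j) ^ 2 := by gcongr
                  _ = _ := by ring
            _ ≤ 2 / m * S := by rw [← Finset.mul_sum]; gcongr; exact hS D hD
        calc l ^ 2 * (∑ j, vnorm (c D W j) ^ 2 * vnorm (y j) ^ 2) / 2
            ≤ l ^ 2 * (2 / m * S) / 2 := by gcongr
          _ = l ^ 2 * S / m := by field_simp
      refine le_trans (lintegral_mono fun ω => ?_) (hA.lintegral_exp_sum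
        (fun a => l * c D W a.1 a.2.1 * y a.1 a.2.2)).le
      rw [hlin]
      gcongr
  have hsub : {ω | (∀ j, WellConditioned (A j ω * U)) ∧ 2 * t <
      ‖∑ j, Matrix.vecMulVec (pinv (A j ω * U) *ᵥ (A j ω *ᵥ y j)) (g j)‖} ⊆ ⋃ D ∈ N,
      {ω | WW ω ∈ good ∧ t < ∑ p : J × Fin m, c D (WW ω) p.1 p.2 * vv ω p} := by
    rintro ω ⟨hω1, hω2⟩
    obtain ⟨D, hD, h⟩ := hN3 (∑ j, Matrix.vecMulVec (pinv (A j ω * U) *ᵥ (A j ω *ᵥ y j)) (g j))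
    refine Set.mem_biUnion hD ⟨hω1, ?_⟩
    rw [sum_sum_vecMulVec_mul] at h
    simp only [pinv_mulVec_dotProduct] at h
    have e : ∑ p : J × Fin m, c D (WW ω) p.1 p.2 * vv ω p =
        ∑ j, (A j ω *ᵥ y j) ⬝ᵥ ((A j ω * U) *ᵥ (((A j ω * U)ᵀ * (A j ω * U))⁻¹ *ᵥ (D *ᵥ g j))) := by
      rw [Fintype.sum_prod_type]
      refine Finset.sum_congr rfl fun j _ => Finset.sum_congr rfl fun i _ => mul_comm _ _
    rw [e]
    linarith
  refine (measure_mono hsub).trans (measure_biUnion_le_of_card_le ?_ ?_)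
  · rw [Fintype.card_fin] at hN1
    exact_mod_cast hN1
  · intro D hD
    set F : Ω → ENNReal := fun ω => good.indicator (fun W => ENNReal.ofReal (Real.exp
        (l * ∑ p : J × Fin m, c D W p.1 p.2 * vv ω p - l ^ 2 * S / m))) (WW ω) with hF
    have hFm : Measurable F := by
      have : F = (WW ⁻¹' good).indicator (fun ω => ENNReal.ofReal (Real.exp
          (l * ∑ p : J × Fin m, c D (WW ω) p.1 p.2 * vv ω p - l ^ 2 * S / m))) := by
        funext ω
        by_cases hx : WW ω ∈ good
        · rw [hF]; simp only; rw [Set.indicator_of_mem hx, Set.indicator_of_mem (by exact hx)]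
        · rw [hF]; simp only; rw [Set.indicator_of_notMem hx, Set.indicator_of_notMem (by exact hx)]
      rw [this]
      refine Measurable.indicator ?_ (hgoodm.preimage hWWm)
      have h1 : ∀ p : J × Fin m, Measurable fun ω => c D (WW ω) p.1 p.2 :=
        fun p => (hcm D p.1 p.2).comp hWWm
      fun_prop
    have hmk := mul_meas_ge_le_lintegral (μ := P) hFm
      (ENNReal.ofReal (Real.exp (l * t - l ^ 2 * S / m)))
    have h1 : ENNReal.ofReal (Real.exp (l * t - l ^ 2 * S / m)) *
        P {ω | WW ω ∈ good ∧ t < ∑ p : J × Fin m, c D (WW ω) p.1 p.2 * vv ω p} ≤ 1 := by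
      refine le_trans (mul_le_mul_right (measure_mono ?_) _) (hmk.trans (hexp D (hN2 D hD)))
      rintro ω ⟨h1, h2⟩
      simp only [Set.mem_ofPred_eq, hF, Set.indicator_of_mem h1]
      gcongr
    rw [Real.exp_neg, ENNReal.ofReal_inv_of_pos (Real.exp_pos _), ENNReal.le_inv_iff_mul_le,
      mul_comm]
    exact h1

end Batch

/-! ### Size of the columns and of their residuals -/

section Residuals

variable {n q r : ℕ} {X : Matrix (Fin n) (Fin q) ℝ} {Ustar : Matrix (Fin n) (Fin r) ℝ}
  {σ : Fin r → ℝ} {V : Matrix (Fin q) (Fin r) ℝ} {U : Matrix (Fin n) (Fin r) ℝ} {δ : ℝ}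

/-- The residual of `x` with respect to the range of `U`. -/
def resid (U : Matrix (Fin n) (Fin r) ℝ) (x : Fin n → ℝ) : Fin n → ℝ := x - U *ᵥ (Uᵀ *ᵥ x)

theorem resid_eq (U : Matrix (Fin n) (Fin r) ℝ) (x : Fin n → ℝ) :
    resid U x = (1 - U * Uᵀ) *ᵥ x := by
  rw [resid, Matrix.sub_mulVec, Matrix.one_mulVec, Matrix.mulVec_mulVec]

theorem transpose_mulVec_resid (hU : Uᵀ * U = 1) (x : Fin n → ℝ) : Uᵀ *ᵥ resid U x = 0 := by
  rw [resid, Matrix.mulVec_sub, Matrix.mulVec_mulVec _ Uᵀ U, hU, Matrix.one_mulVec, sub_self]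

theorem vnorm_resid_le (hU : Uᵀ * U = 1) (x : Fin n → ℝ) : vnorm (resid U x) ≤ vnorm x := by
  rw [resid_eq]; exact vnorm_proj_compl_le hU x

theorem IsReducedSVD.col_eq (hX : IsReducedSVD X Ustar σ V) (k : Fin q) :
    X.col k = Ustar *ᵥ (Matrix.diagonal σ * Vᵀ).col k := by
  have : X = Ustar * (Matrix.diagonal σ * Vᵀ) := by rw [hX.eq, Matrix.mul_assoc]
  conv_lhs => rw [this]
  ext i
  simp only [Matrix.col_apply, Matrix.mul_apply, Matrix.mulVec, dotProduct]

theorem IsReducedSVD.vnorm_col (hX : IsReducedSVD X Ustar σ V) (k : Fin q) :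
    vnorm (X.col k) = vnorm ((Matrix.diagonal σ * Vᵀ).col k) := by
  rw [hX.col_eq, vnorm_mulVec_of_orthonormal hX.left_orthonormal]

/-- A column is `Ustar b` with `‖b‖` equal to its own norm, so its residual is `(1 - U Uᵀ) Ustar b`.
-/
theorem IsReducedSVD.vnorm_resid_col_le (hX : IsReducedSVD X Ustar σ V) (hU : Uᵀ * U = 1)
    (hδ : subspaceDist Ustar U ≤ δ) (k : Fin q) :
    vnorm (resid U (X.col k)) ≤ δ * vnorm (X.col k) := by
  rw [resid_eq, hX.vnorm_col]
  conv_lhs => rw [hX.col_eq]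
  rw [Matrix.mulVec_mulVec]
  refine (ByzAltGDmin.vnorm_mulVec_le _ _).trans (mul_le_mul_of_nonneg_right ?_ (vnorm_nonneg _))
  rw [subspaceDist_comm hX.left_orthonormal hU] at hδ
  exact hδ

theorem IsReducedSVD.norm_mul_le (hX : IsReducedSVD X Ustar σ V) (hr : 0 < r) {p : ℕ}
    (M : Matrix (Fin p) (Fin n) ℝ) : ‖M * X‖ ≤ ‖M * Ustar‖ * sigmaMax σ := by
  rw [hX.eq, ← Matrix.mul_assoc, ← Matrix.mul_assoc]
  refine (frob_mul_transpose_le hX.right_orthonormal _).trans ?_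
  rw [← Matrix.frobenius_norm_transpose, Matrix.transpose_mul, Matrix.diagonal_transpose,
    ← Matrix.frobenius_norm_transpose (M * Ustar), mul_comm]
  exact frob_mul_le_of_vnorm_le (hX.sigmaMax_pos hr).le
    (vnorm_diagonal_mulVec_le hX.abs_le_sigmaMax (hX.sigmaMax_pos hr).le) _

theorem col_mul {ι κ ν : Type*} [Fintype κ] (M : Matrix ι κ ℝ) (N : Matrix κ ν ℝ) (k : ν) :
    (M * N).col k = M *ᵥ N.col k := by
  ext i; simp [Matrix.mul_apply, Matrix.mulVec, dotProduct]

theorem IsReducedSVD.sum_vnorm_sq_resid_le (hX : IsReducedSVD X Ustar σ V) (hr : 0 < r)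
    (hU : Uᵀ * U = 1) (hδ : subspaceDist Ustar U ≤ δ) :
    ∑ k, vnorm (resid U (X.col k)) ^ 2 ≤ δ ^ 2 * sigmaMax σ ^ 2 := by
  simp only [resid_eq, ← col_mul, ← frob_sq_eq_sum_col]
  rw [← mul_pow]
  refine pow_le_pow_left₀ (norm_nonneg _) ((hX.norm_mul_le hr _).trans ?_) 2
  rw [subspaceDist_comm hX.left_orthonormal hU] at hδ
  exact mul_le_mul_of_nonneg_right hδ (hX.sigmaMax_pos hr).le

theorem IsReducedSVD.sum_vnorm_sq_mulVec_le (hX : IsReducedSVD X Ustar σ V) (hr : 0 < r)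
    (hU : Uᵀ * U = 1) {p : ℕ} {D : Matrix (Fin p) (Fin r) ℝ} (hD : ‖D‖ ≤ 1) :
    ∑ k, vnorm (D *ᵥ (Uᵀ *ᵥ X.col k)) ^ 2 ≤ sigmaMax σ ^ 2 := by
  simp only [← col_mul, ← frob_sq_eq_sum_col]
  refine pow_le_pow_left₀ (norm_nonneg _) ?_ 2
  rw [← Matrix.mul_assoc]
  refine (hX.norm_mul_le hr _).trans (mul_le_of_le_one_left (hX.sigmaMax_pos hr).le ?_)
  exact (frob_mul_orthonormal_le hX.left_orthonormal _).trans
    ((frob_mul_transpose_le hU D).trans hD)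

theorem RightIncoherent.vnorm_col_le {μ : ℝ} (hμ : RightIncoherent σ V μ)
    (hX : IsReducedSVD X Ustar σ V) (k : Fin q) :
    vnorm (X.col k) ≤ μ * √((r : ℝ) / q) * sigmaMax σ := by
  rw [hX.vnorm_col]; exact hμ k

/-- This form of the ideal gradient allows a column by column comparison with the gradients of the
nodes. -/
theorem sub_mul_transpose_eq_sum (U : Matrix (Fin n) (Fin r) ℝ) (X : Matrix (Fin n) (Fin q) ℝ) :
    (U * (Uᵀ * X) - X) * (Uᵀ * X)ᵀ =
      -∑ k, Matrix.vecMulVec (resid U (X.col k)) (Uᵀ *ᵥ X.col k) := by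
  ext i j
  rw [Matrix.mul_apply, Matrix.neg_apply, Matrix.sum_apply, ← Finset.sum_neg_distrib]
  refine Finset.sum_congr rfl fun k _ => ?_
  rw [Matrix.vecMulVec_apply, Matrix.transpose_apply, ← col_mul, Matrix.col_apply, resid, ← col_mul,
    ← col_mul, Pi.sub_apply, Matrix.sub_apply, Matrix.col_apply, Matrix.col_apply]
  ring

end Residuals

/-! ### One batch -/

section OneBatch

instance : Fintype Phase where
  elems := ⟨[Phase.updateB, Phase.updateU], by simp⟩
  complete x := by cases x <;> simp

variable {Ω : Type*} {mΩ : MeasurableSpace Ω} {P : Measure Ω}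
variable {m n q r ρ : ℕ} {X : Matrix (Fin n) (Fin q) ℝ} {Ustar : Matrix (Fin n) (Fin r) ℝ}
  {σ : Fin r → ℝ} {V : Matrix (Fin q) (Fin r) ℝ} {U : Matrix (Fin n) (Fin r) ℝ} {δ μ : ℝ}

theorem EntrywiseMeasurable.lsCoeff {𝓧 : Type*} [MeasurableSpace 𝓧]
    {A : 𝓧 → Matrix (Fin m) (Fin n) ℝ} {U : 𝓧 → Matrix (Fin n) (Fin r) ℝ}
    (hA : EntrywiseMeasurable A) (hU : EntrywiseMeasurable U) (x : Fin n → ℝ) :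
    Measurable fun ω => lsCoeff (A ω) (U ω) x :=
  (hA.mul hU).pinv.mulVec (hA.mulVec measurable_const)

theorem sum_prod_snd {M : Type*} [AddCommMonoid M] (f : Fin q → M) :
    ∑ j : Fin ρ × Fin q, f j.2 = ρ • ∑ k, f k := by
  simp [Fintype.sum_prod_type]

/-- The number of samples relative to the number required. -/
def sampleRatio (σ : Fin r → ℝ) (μ : ℝ) (m q ρ : ℕ) : ℝ :=
  (ρ * m * q : ℝ) / (kappa σ ^ 4 * μ ^ 2 * r)

/-- This is the term linear in the least squares errors. Adding up norms would give a bound in terms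
of `σ_max` and `‖X‖`, too weak for the target `δ σ_min²`. The cancellation between columns and nodes
supplies the gain, and incoherence prevents a single column from dominating the variance. -/
theorem IsReducedSVD.measure_lsError_le (hX : IsReducedSVD X Ustar σ V) (hr : 0 < r) (hm : 0 < m)
    (hq : 0 < q) (hμ1 : 1 ≤ μ) (hμ : RightIncoherent σ V μ) (hU : Uᵀ * U = 1) (hδ0 : 0 < δ)
    (hδ : subspaceDist Ustar U ≤ δ)
    {A : Fin ρ × Fin q → Ω → Matrix (Fin m) (Fin n) ℝ}
    (hA : IsStdGaussian
      (fun (p : (Fin ρ × Fin q) × Fin m × Fin n) ω => A p.1 ω p.2.1 p.2.2) P) :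
    P {ω | (∀ j, WellConditioned (A j ω * U)) ∧ 0.01 * δ * sigmaMin σ ^ 2 * ρ <
      ‖∑ j, Matrix.vecMulVec (pinv (A j ω * U) *ᵥ (A j ω *ᵥ resid U (X.col j.2)))
        (Uᵀ *ᵥ X.col j.2)‖} ≤
      ENNReal.ofReal (5 ^ (r * r) * Real.exp (-(sampleRatio σ μ m q ρ / 160000))) := by
  have hmin := hX.sigmaMin_pos hr
  have hmax := hX.sigmaMax_pos hr
  have hm' : (0 : ℝ) < m := by exact_mod_cast hm
  have hq' : (0 : ℝ) < q := by exact_mod_cast hq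
  have hr' : (0 : ℝ) < r := by exact_mod_cast hr
  have hκ : 0 < kappa σ := one_pos.trans_le (hX.one_le_kappa hr)
  have hμ0 : 0 < μ := one_pos.trans_le hμ1
  set a := μ * √((r : ℝ) / q) * sigmaMax σ with ha
  have ha2 : a ^ 2 = μ ^ 2 * (r / q) * sigmaMax σ ^ 2 := by
    rw [ha, mul_pow, mul_pow, Real.sq_sqrt (by positivity)]
  have ha0 : 0 < a := by positivity
  -- The value of `l` is the maximizer `t m / (2 S)` of `l t - l² S / m`; here `a` is the
  -- incoherence bound on the norm of a column.
  have h := measure_lt_norm_lsError_le hm hA U (fun j => resid U (X.col j.2))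
    (fun j => transpose_mulVec_resid hU _) (fun j => Uᵀ *ᵥ X.col j.2)
    (l := 1 / 400 * m / (δ * a ^ 2 * kappa σ ^ 2)) (S := ρ * (δ ^ 2 * a ^ 2 * sigmaMax σ ^ 2))
    (by positivity) ?_ (0.005 * δ * sigmaMin σ ^ 2 * ρ)
  · rw [show 2 * (0.005 * δ * sigmaMin σ ^ 2 * ρ) = 0.01 * δ * sigmaMin σ ^ 2 * ρ by ring] at h
    refine h.trans (le_of_eq ?_)
    congr 4
    have hk : sigmaMax σ = kappa σ * sigmaMin σ := by rw [kappa]; field_simp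
    rw [sampleRatio, ha2, hk]
    field_simp
    ring
  · intro D hD
    rw [sum_prod_snd fun k => vnorm (resid U (X.col k)) ^ 2 * vnorm (D *ᵥ (Uᵀ *ᵥ X.col k)) ^ 2,
      nsmul_eq_mul]
    gcongr
    calc ∑ k, vnorm (resid U (X.col k)) ^ 2 * vnorm (D *ᵥ (Uᵀ *ᵥ X.col k)) ^ 2
        ≤ ∑ k, (δ ^ 2 * a ^ 2) * vnorm (D *ᵥ (Uᵀ *ᵥ X.col k)) ^ 2 := by
          refine Finset.sum_le_sum fun k _ => mul_le_mul_of_nonneg_right ?_ (sq_nonneg _)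
          rw [← mul_pow]
          refine pow_le_pow_left₀ (vnorm_nonneg _) ((hX.vnorm_resid_col_le hU hδ k).trans ?_) 2
          exact mul_le_mul_of_nonneg_left (hμ.vnorm_col_le hX k) hδ0.le
      _ ≤ _ := by
          rw [← Finset.mul_sum]
          exact mul_le_mul_of_nonneg_left (hX.sum_vnorm_sq_mulVec_le hr hU hD) (by positivity)

/-- The vectors `b` are close to the exact coefficients of the columns of `X`. -/
def CoeffsAccurate (X : Matrix (Fin n) (Fin q) ℝ) (U : Matrix (Fin n) (Fin r) ℝ)
    (b : Fin ρ × Fin q → Fin r → ℝ) : Prop :=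
  ∀ j, vnorm (b j - Uᵀ *ᵥ X.col j.2) ≤ 0.1 * vnorm (resid U (X.col j.2))

theorem CoeffsAccurate.sum_vnorm_sq_le {b : Fin ρ × Fin q → Fin r → ℝ}
    (hb : CoeffsAccurate X U b) (hX : IsReducedSVD X Ustar σ V) (hr : 0 < r)
    (hU : Uᵀ * U = 1) (hδ1 : δ ≤ 0.1) (hδ : subspaceDist Ustar U ≤ δ) (i : Fin ρ) {p : ℕ}
    {D : Matrix (Fin p) (Fin r) ℝ} (hD : ‖D‖ ≤ 1) :
    ∑ k, vnorm (D *ᵥ b (i, k)) ^ 2 ≤ 3 * sigmaMax σ ^ 2 := by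
  have hδ0 : 0 ≤ δ := (subspaceDist_nonneg _ _).trans hδ
  have h1 : ∀ k, vnorm (D *ᵥ b (i, k)) ^ 2 ≤ 2 * vnorm (D *ᵥ (Uᵀ *ᵥ X.col k)) ^ 2 +
      0.02 * vnorm (resid U (X.col k)) ^ 2 := by
    intro k
    have e : D *ᵥ b (i, k) = D *ᵥ (Uᵀ *ᵥ X.col k) + D *ᵥ (b (i, k) - Uᵀ *ᵥ X.col k) := by
      rw [← Matrix.mulVec_add, add_sub_cancel]
    have h2 := vnorm_add_le (D *ᵥ (Uᵀ *ᵥ X.col k)) (D *ᵥ (b (i, k) - Uᵀ *ᵥ X.col k))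
    have h3 : vnorm (D *ᵥ (b (i, k) - Uᵀ *ᵥ X.col k)) ≤ 0.1 * vnorm (resid U (X.col k)) :=
      (vnorm_mulVec_le _ _).trans ((mul_le_of_le_one_left (vnorm_nonneg _) hD).trans (hb (i, k)))
    rw [← e] at h2
    have h4 := pow_le_pow_left₀ (vnorm_nonneg _) h2 2
    have h5 := pow_le_pow_left₀ (vnorm_nonneg _) h3 2
    nlinarith [sq_nonneg (vnorm (D *ᵥ (Uᵀ *ᵥ X.col k)) -
      vnorm (D *ᵥ (b (i, k) - Uᵀ *ᵥ X.col k)))]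
  refine (Finset.sum_le_sum fun k _ => h1 k).trans ?_
  rw [Finset.sum_add_distrib, ← Finset.mul_sum, ← Finset.mul_sum]
  have h6 := hX.sum_vnorm_sq_mulVec_le hr hU hD
  have h7 := hX.sum_vnorm_sq_resid_le hr hU hδ
  nlinarith [sq_nonneg (sigmaMax σ), mul_le_mul_of_nonneg_right
    (show δ ^ 2 ≤ 1 by nlinarith) (sq_nonneg (sigmaMax σ))]

theorem CoeffsAccurate.vnorm_sub_le {b : Fin ρ × Fin q → Fin r → ℝ}
    (hb : CoeffsAccurate X U b) (hU : Uᵀ * U = 1) (j : Fin ρ × Fin q) :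
    vnorm (U *ᵥ b j - X.col j.2) ≤ 1.1 * vnorm (resid U (X.col j.2)) := by
  have e : U *ᵥ b j - X.col j.2 = U *ᵥ (b j - Uᵀ *ᵥ X.col j.2) - resid U (X.col j.2) := by
    rw [resid, Matrix.mulVec_sub]; abel
  rw [e]
  refine (ByzAltGDmin.vnorm_sub_le _ _).trans ?_
  rw [vnorm_mulVec_of_orthonormal hU]
  linarith [hb j]

theorem CoeffsAccurate.vnorm_le {b : Fin ρ × Fin q → Fin r → ℝ}
    (hb : CoeffsAccurate X U b) (hU : Uᵀ * U = 1) (j : Fin ρ × Fin q) :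
    vnorm (b j) ≤ 1.1 * vnorm (X.col j.2) := by
  have h := vnorm_add_le (Uᵀ *ᵥ X.col j.2) (b j - Uᵀ *ᵥ X.col j.2)
  rw [add_sub_cancel] at h
  linarith [hb j, vnorm_resid_le hU (X.col j.2), vnorm_transpose_mulVec_le hU (X.col j.2)]

theorem CoeffsAccurate.measure_gradient_le {b : Fin ρ × Fin q → Fin r → ℝ}
    (hb : CoeffsAccurate X U b) (hX : IsReducedSVD X Ustar σ V) (hr : 0 < r) (hm : 0 < m)
    (hq : 0 < q) (hμ1 : 1 ≤ μ) (hμ : RightIncoherent σ V μ) (hU : Uᵀ * U = 1) (hδ0 : 0 < δ)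
    (hδ1 : δ ≤ 0.1) (hδ : subspaceDist Ustar U ≤ δ)
    {A : Fin ρ × Fin q → Ω → Matrix (Fin m) (Fin n) ℝ}
    (hA : IsStdGaussian
      (fun (p : (Fin ρ × Fin q) × Fin m × Fin n) ω => A p.1 ω p.2.1 p.2.2) P) :
    P {ω | 0.01 * δ * sigmaMin σ ^ 2 * (ρ * m) <
      ‖∑ j, Matrix.vecMulVec ((A j ω)ᵀ *ᵥ (A j ω *ᵥ (U *ᵥ b j - X.col j.2))) (b j) -
        (m : ℝ) • ∑ j, Matrix.vecMulVec (U *ᵥ b j - X.col j.2) (b j)‖} ≤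
      ENNReal.ofReal (5 ^ (n * r) * Real.exp (-(sampleRatio σ μ m q ρ / 2560000))) := by
  have hmin := hX.sigmaMin_pos hr
  have hmax := hX.sigmaMax_pos hr
  have hm' : (0 : ℝ) < m := by exact_mod_cast hm
  have hq' : (0 : ℝ) < q := by exact_mod_cast hq
  have hr' : (0 : ℝ) < r := by exact_mod_cast hr
  have hκ1 := hX.one_le_kappa hr
  have hκ : 0 < kappa σ := one_pos.trans_le hκ1
  have hμ0 : 0 < μ := one_pos.trans_le hμ1
  set a := μ * √((r : ℝ) / q) * sigmaMax σ with ha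
  have ha2 : a ^ 2 = μ ^ 2 * (r / q) * sigmaMax σ ^ 2 := by
    rw [ha, mul_pow, mul_pow, Real.sq_sqrt (by positivity)]
  have ha0 : 0 < a := by positivity
  have hw : ∀ j : Fin ρ × Fin q, vnorm (U *ᵥ b j - X.col j.2) ≤ 1.1 * (δ * a) := fun j =>
    (hb.vnorm_sub_le hU j).trans (mul_le_mul_of_nonneg_left
      ((hX.vnorm_resid_col_le hU hδ j.2).trans
        (mul_le_mul_of_nonneg_left (hμ.vnorm_col_le hX j.2) hδ0.le)) (by norm_num))
  have hbj : ∀ j : Fin ρ × Fin q, vnorm (b j) ≤ 1.1 * a := fun j =>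
    (hb.vnorm_le hU j).trans (mul_le_mul_of_nonneg_left (hμ.vnorm_col_le hX j.2) (by norm_num))
  -- The value of `l` is the maximizer `t / (8 S)` of `l t - 4 l² S`. The factor `4` in `S` absorbs
  -- `1.1² · 3 = 3.63`.
  have h := measure_lt_norm_gradient_sub_le hA (fun j => U *ᵥ b j - X.col j.2) b
    (l := 1 / 6400 / (δ * a ^ 2 * kappa σ ^ 2)) (S := 4 * m * ρ * (δ ^ 2 * a ^ 2 * sigmaMax σ ^ 2))
    (by positivity) ?_ ?_ (0.005 * δ * sigmaMin σ ^ 2 * (ρ * m))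
  · rw [show 2 * (0.005 * δ * sigmaMin σ ^ 2 * (ρ * m)) =
      0.01 * δ * sigmaMin σ ^ 2 * (ρ * m) by ring] at h
    refine h.trans (le_of_eq ?_)
    congr 4
    have hk : sigmaMax σ = kappa σ * sigmaMin σ := by rw [kappa]; field_simp
    rw [sampleRatio, ha2, hk]
    field_simp
    ring
  · intro j
    have h1 : vnorm (U *ᵥ b j - X.col j.2) * vnorm (b j) ≤ (1.1 * (δ * a)) * (1.1 * a) :=
      mul_le_mul (hw j) (hbj j) (vnorm_nonneg _) (by positivity)
    calc 1 / 6400 / (δ * a ^ 2 * kappa σ ^ 2) * (vnorm (U *ᵥ b j - X.col j.2) * vnorm (b j))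
        ≤ 1 / 6400 / (δ * a ^ 2 * kappa σ ^ 2) * ((1.1 * (δ * a)) * (1.1 * a)) := by gcongr
      _ = 1.21 / 6400 / kappa σ ^ 2 := by field_simp; ring
      _ ≤ 1.21 / 6400 / 1 := by gcongr; exact one_le_pow₀ hκ1
      _ ≤ 1 / 8 := by norm_num
  · intro D hD
    have h1 : ∀ i : Fin ρ, ∑ k, (vnorm (U *ᵥ b (i, k) - X.col k) * vnorm (D *ᵥ b (i, k))) ^ 2 ≤
        (1.1 * (δ * a)) ^ 2 * (3 * sigmaMax σ ^ 2) := by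
      intro i
      refine le_trans ?_ (mul_le_mul_of_nonneg_left
        (hb.sum_vnorm_sq_le hX hr hU hδ1 hδ i hD) (sq_nonneg _))
      rw [Finset.mul_sum]
      refine Finset.sum_le_sum fun k _ => ?_
      rw [mul_pow]
      exact mul_le_mul_of_nonneg_right (pow_le_pow_left₀ (vnorm_nonneg _) (hw (i, k)) 2)
        (sq_nonneg _)
    rw [Fintype.sum_prod_type]
    calc (m : ℝ) * ∑ i : Fin ρ, ∑ k, (vnorm (U *ᵥ b (i, k) - X.col k) * vnorm (D *ᵥ b (i, k))) ^ 2
        ≤ m * ∑ _i : Fin ρ, (1.1 * (δ * a)) ^ 2 * (3 * sigmaMax σ ^ 2) := by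
          gcongr with i; exact h1 i
      _ = 3.63 * m * ρ * (δ ^ 2 * a ^ 2 * sigmaMax σ ^ 2) := by
          rw [Finset.sum_const, Finset.card_univ, Fintype.card_fin, nsmul_eq_mul]; ring
      _ ≤ _ := by gcongr; norm_num

/-- The expected batch gradient is close to the ideal one. -/
theorem CoeffsAccurate.norm_sub_le {b : Fin ρ × Fin q → Fin r → ℝ}
    (hb : CoeffsAccurate X U b) (hX : IsReducedSVD X Ustar σ V) (hr : 0 < r)
    (hU : Uᵀ * U = 1) (hδ1 : δ ≤ 0.1 / kappa σ ^ 2) (hδ : subspaceDist Ustar U ≤ δ)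
    (hS : ‖∑ j, Matrix.vecMulVec (b j - Uᵀ *ᵥ X.col j.2) (Uᵀ *ᵥ X.col j.2)‖ ≤
      0.01 * δ * sigmaMin σ ^ 2 * ρ) :
    ‖∑ j, Matrix.vecMulVec (U *ᵥ b j - X.col j.2) (b j) -
      (ρ : ℝ) • ((U * (Uᵀ * X) - X) * (Uᵀ * X)ᵀ)‖ ≤ 0.021 * δ * sigmaMin σ ^ 2 * ρ := by
  have hδ0 : 0 ≤ δ := (subspaceDist_nonneg _ _).trans hδ
  have hmin := hX.sigmaMin_pos hr
  have hκ : 0 < kappa σ := one_pos.trans_le (hX.one_le_kappa hr)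
  have hρ : (0 : ℝ) ≤ ρ := Nat.cast_nonneg _
  set e : Fin ρ × Fin q → Fin r → ℝ := fun j => b j - Uᵀ *ᵥ X.col j.2 with he
  -- This is where closeness of order `κ⁻²` is needed: it turns quadratic terms into a small
  -- multiple of `δ σ_min²`.
  have hsq : δ ^ 2 * sigmaMax σ ^ 2 ≤ 0.1 * δ * sigmaMin σ ^ 2 := by
    have hk : sigmaMax σ = kappa σ * sigmaMin σ := by rw [kappa]; field_simp
    rw [le_div_iff₀ (by positivity)] at hδ1
    calc δ ^ 2 * sigmaMax σ ^ 2 = (δ * kappa σ ^ 2) * (δ * sigmaMin σ ^ 2) := by rw [hk]; ring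
      _ ≤ 0.1 * (δ * sigmaMin σ ^ 2) := by gcongr
      _ = _ := by ring
  have hsum : ∑ j : Fin ρ × Fin q, vnorm (resid U (X.col j.2)) ^ 2 ≤
      ρ * (0.1 * δ * sigmaMin σ ^ 2) := by
    rw [sum_prod_snd fun k => vnorm (resid U (X.col k)) ^ 2, nsmul_eq_mul]
    gcongr
    exact (hX.sum_vnorm_sq_resid_le hr hU hδ).trans hsq
  -- With `b = Uᵀ x + e` one has `U b - x = U e - resid`, and the product of `-resid` with `Uᵀ x` is
  -- the ideal gradient. The three other terms contribute `0.01`, `0.001` and `0.01`; only the first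
  -- is linear in `e` and needs `hS`.
  have hdecomp : ∑ j, Matrix.vecMulVec (U *ᵥ b j - X.col j.2) (b j) -
      (ρ : ℝ) • ((U * (Uᵀ * X) - X) * (Uᵀ * X)ᵀ) =
      U * ∑ j, Matrix.vecMulVec (e j) (Uᵀ *ᵥ X.col j.2) +
      U * ∑ j, Matrix.vecMulVec (e j) (e j) -
      ∑ j : Fin ρ × Fin q, Matrix.vecMulVec (resid U (X.col j.2)) (e j) := by
    have h1 : (ρ : ℝ) • ((U * (Uᵀ * X) - X) * (Uᵀ * X)ᵀ) =
        -∑ j : Fin ρ × Fin q, Matrix.vecMulVec (resid U (X.col j.2)) (Uᵀ *ᵥ X.col j.2) := by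
      rw [sub_mul_transpose_eq_sum,
        sum_prod_snd fun k => Matrix.vecMulVec (resid U (X.col k)) (Uᵀ *ᵥ X.col k), smul_neg,
        Nat.cast_smul_eq_nsmul]
    rw [h1, sub_neg_eq_add, ← Finset.sum_add_distrib, ← Matrix.mul_add, ← Finset.sum_add_distrib,
      Matrix.mul_sum, ← Finset.sum_sub_distrib]
    refine Finset.sum_congr rfl fun j _ => ?_
    have h2 : U *ᵥ b j - X.col j.2 = U *ᵥ e j - resid U (X.col j.2) := by
      rw [he, resid, Matrix.mulVec_sub]; abel
    have h3 : b j = Uᵀ *ᵥ X.col j.2 + e j := by simp only [he]; rw [add_sub_cancel]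
    rw [h2, ← Matrix.vecMulVec_add, ← h3, Matrix.mul_vecMulVec, Matrix.sub_vecMulVec]
    conv_lhs => rw [h3]
    conv_rhs => rw [h3]
    simp only [Matrix.vecMulVec_add]
    abel
  rw [hdecomp]
  have hn1 : ‖∑ j, Matrix.vecMulVec (e j) (e j)‖ ≤ 0.01 * (ρ * (0.1 * δ * sigmaMin σ ^ 2)) := by
    refine (norm_sum_le _ _).trans (le_trans ?_ (mul_le_mul_of_nonneg_left hsum (by norm_num)))
    rw [Finset.mul_sum]
    refine Finset.sum_le_sum fun j _ => ?_
    rw [frob_vecMulVec]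
    have := hb j
    have h0 := vnorm_nonneg (e j)
    calc vnorm (e j) * vnorm (e j) ≤ (0.1 * vnorm (resid U (X.col j.2))) *
          (0.1 * vnorm (resid U (X.col j.2))) := mul_le_mul this this h0 (h0.trans this)
      _ = _ := by ring
  have hn2 : ‖∑ j : Fin ρ × Fin q, Matrix.vecMulVec (resid U (X.col j.2)) (e j)‖ ≤
      0.1 * (ρ * (0.1 * δ * sigmaMin σ ^ 2)) := by
    refine (norm_sum_le _ _).trans (le_trans ?_ (mul_le_mul_of_nonneg_left hsum (by norm_num)))
    rw [Finset.mul_sum]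
    refine Finset.sum_le_sum fun j _ => ?_
    rw [frob_vecMulVec]
    calc vnorm (resid U (X.col j.2)) * vnorm (e j) ≤ vnorm (resid U (X.col j.2)) *
          (0.1 * vnorm (resid U (X.col j.2))) := mul_le_mul_of_nonneg_left (hb j) (vnorm_nonneg _)
      _ = _ := by ring
  refine (_root_.norm_sub_le _ _).trans ?_
  have h4 := norm_add_le (U * ∑ j, Matrix.vecMulVec (e j) (Uᵀ *ᵥ X.col j.2))
    (U * ∑ j, Matrix.vecMulVec (e j) (e j))
  have h5 := frob_orthonormal_mul_le hU (∑ j, Matrix.vecMulVec (e j) (Uᵀ *ᵥ X.col j.2))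
  have h6 := frob_orthonormal_mul_le hU (∑ j, Matrix.vecMulVec (e j) (e j))
  have h7 : 0 ≤ ρ * (δ * sigmaMin σ ^ 2) := by positivity
  have h8 : ‖∑ j, Matrix.vecMulVec (e j) (Uᵀ *ᵥ X.col j.2)‖ ≤ 0.01 * δ * sigmaMin σ ^ 2 * ρ := hS
  nlinarith

end OneBatch

/-! ### Accuracy of one iteration -/

section Iteration

variable {Ω : Type*} {mΩ : MeasurableSpace Ω} {P : Measure Ω}
variable {m n q r ρ Lt : ℕ} {X : Matrix (Fin n) (Fin q) ℝ} {Ustar : Matrix (Fin n) (Fin r) ℝ}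
  {σ : Fin r → ℝ} {V : Matrix (Fin q) (Fin r) ℝ} {U : Matrix (Fin n) (Fin r) ℝ} {δ μ : ℝ}

theorem sum_nodeGradient (A₁ A₂ : Fin ρ × Fin q → Matrix (Fin m) (Fin n) ℝ)
    (X : Matrix (Fin n) (Fin q) ℝ) (U : Matrix (Fin n) (Fin r) ℝ) :
    ∑ i, nodeGradient (fun k => A₁ (i, k)) (fun k => A₂ (i, k)) X U =
      ∑ j : Fin ρ × Fin q, Matrix.vecMulVec
        ((A₂ j)ᵀ *ᵥ (A₂ j *ᵥ (U *ᵥ lsCoeff (A₁ j) U (X.col j.2) - X.col j.2)))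
        (lsCoeff (A₁ j) U (X.col j.2)) := by
  rw [Fintype.sum_prod_type]
  simp only [nodeGradient, Matrix.mulVec_sub]

/-- Sample splitting makes the coefficients independent of the measurements of phase `updateU`. They
can therefore be frozen, and the bound for deterministic accurate coefficients applies. -/
theorem IsReducedSVD.measure_gradient_le (hX : IsReducedSVD X Ustar σ V) (hr : 0 < r)
    (hm : 0 < m) (hq : 0 < q) (hμ1 : 1 ≤ μ) (hμ : RightIncoherent σ V μ) (hU : Uᵀ * U = 1)
    (hδ0 : 0 < δ) (hδ1 : δ ≤ 0.1) (hδ : subspaceDist Ustar U ≤ δ)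
    {A : Phase → Fin ρ × Fin q → Ω → Matrix (Fin m) (Fin n) ℝ}
    (hA : IsStdGaussian (fun (p : Phase × (Fin ρ × Fin q) × Fin m × Fin n) ω =>
      A p.1 p.2.1 ω p.2.2.1 p.2.2.2) P) :
    P {ω | CoeffsAccurate X U (fun j => lsCoeff (A .updateB j ω) U (X.col j.2)) ∧
      0.01 * δ * sigmaMin σ ^ 2 * (ρ * m) <
      ‖∑ j, Matrix.vecMulVec ((A .updateU j ω)ᵀ *ᵥ (A .updateU j ω *ᵥ
          (U *ᵥ lsCoeff (A .updateB j ω) U (X.col j.2) - X.col j.2)))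
          (lsCoeff (A .updateB j ω) U (X.col j.2)) -
        (m : ℝ) • ∑ j, Matrix.vecMulVec (U *ᵥ lsCoeff (A .updateB j ω) U (X.col j.2) - X.col j.2)
          (lsCoeff (A .updateB j ω) U (X.col j.2))‖} ≤
      ENNReal.ofReal (5 ^ (n * r) * Real.exp (-(sampleRatio σ μ m q ρ / 2560000))) := by
  classical
  have hprob := hA.indep.isProbabilityMeasure
  set Y : Phase → Ω → (Fin ρ × Fin q) × Fin m × Fin n → ℝ := fun f ω p => A f p.1 ω p.2.1 p.2.2
    with hY
  set mat : ((Fin ρ × Fin q) × Fin m × Fin n → ℝ) → Fin ρ × Fin q → Matrix (Fin m) (Fin n) ℝ :=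
    fun x j => Matrix.of fun i c => x (j, i, c) with hmat
  have hYm : ∀ f, Measurable (Y f) := fun f =>
    measurable_pi_lambda _ fun p => hA.measurable (f, p)
  have hmatm : ∀ j, EntrywiseMeasurable fun x => mat x j := fun j i c => by
    simp only [hmat, Matrix.of_apply]; fun_prop
  have hindep : IndepFun (Y .updateB) (Y .updateU) P := by
    have h := hA.indepFun_linear
      (fun (p : (Fin ρ × Fin q) × Fin m × Fin n) a => if a = (Phase.updateB, p) then 1 else 0)
      (fun (p : (Fin ρ × Fin q) × Fin m × Fin n) a => if a = (Phase.updateU, p) then 1 else 0)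
      (fun p p' => Finset.sum_eq_zero fun a _ => by
        by_cases h : a = (Phase.updateB, p)
        · subst h; simp
        · simp [h])
    simpa [ite_mul, Finset.sum_ite_eq'] using h
  set b : ((Fin ρ × Fin q) × Fin m × Fin n → ℝ) → Fin ρ × Fin q → Fin r → ℝ :=
    fun x j => lsCoeff (mat x j) U (X.col j.2) with hb
  have hbm : ∀ j, Measurable fun x => b x j := fun j =>
    (hmatm j).lsCoeff (EntrywiseMeasurable.const U) _
  set S : Set (((Fin ρ × Fin q) × Fin m × Fin n → ℝ) × ((Fin ρ × Fin q) × Fin m × Fin n → ℝ)) :=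
    {x | CoeffsAccurate X U (b x.1) ∧ 0.01 * δ * sigmaMin σ ^ 2 * (ρ * m) <
      ‖∑ j, Matrix.vecMulVec ((mat x.2 j)ᵀ *ᵥ (mat x.2 j *ᵥ (U *ᵥ b x.1 j - X.col j.2)))
          (b x.1 j) - (m : ℝ) • ∑ j, Matrix.vecMulVec (U *ᵥ b x.1 j - X.col j.2) (b x.1 j)‖} with hS
  have hSm : MeasurableSet S := by
    have hb1 : ∀ j, Measurable fun x : ((Fin ρ × Fin q) × Fin m × Fin n → ℝ) ×
        ((Fin ρ × Fin q) × Fin m × Fin n → ℝ) => b x.1 j := fun j => (hbm j).comp measurable_fst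
    have hA2 : ∀ j, EntrywiseMeasurable fun x : ((Fin ρ × Fin q) × Fin m × Fin n → ℝ) ×
        ((Fin ρ × Fin q) × Fin m × Fin n → ℝ) => mat x.2 j := fun j i c =>
      (hmatm j i c).comp measurable_snd
    have hw : ∀ j : Fin ρ × Fin q, Measurable fun x : ((Fin ρ × Fin q) × Fin m × Fin n → ℝ) ×
        ((Fin ρ × Fin q) × Fin m × Fin n → ℝ) => U *ᵥ b x.1 j - X.col j.2 := fun j =>
      ((EntrywiseMeasurable.const U).mulVec (hb1 j)).sub measurable_const
    rw [hS]
    refine MeasurableSet.inter ?_ ?_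
    · change MeasurableSet {x | ∀ j, _}
      rw [Set.ofPred_forall]
      exact MeasurableSet.iInter fun j => measurableSet_le
        (measurable_vnorm ((hb1 j).sub measurable_const)) measurable_const
    · refine measurableSet_lt measurable_const (EntrywiseMeasurable.norm ?_)
      exact (EntrywiseMeasurable.sum fun j _ => EntrywiseMeasurable.vecMulVec
        ((hA2 j).transpose.mulVec ((hA2 j).mulVec (hw j))) (hb1 j)).sub
        ((EntrywiseMeasurable.sum fun j _ =>
          EntrywiseMeasurable.vecMulVec (hw j) (hb1 j)).const_smul _)
  refine measure_le_of_indepFun (hYm .updateB) (hYm .updateU) hindep hSm fun x => ?_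
  by_cases hx : CoeffsAccurate X U (b x)
  · refine le_trans (measure_mono fun ω hω => ?_) (hx.measure_gradient_le hX hr hm hq hμ1 hμ hU hδ0
      hδ1 hδ (A := A .updateU) (P := P) (hA.precomp (f := fun p => (Phase.updateU, p))
        (Prod.mk_right_injective _)))
    exact hω.2
  · have : {ω | (x, Y .updateU ω) ∈ S} = ∅ :=
      Set.eq_empty_of_forall_notMem fun ω hω => hx hω.1
    rw [this]
    simp

/-- The deviation `0.031` combines `0.01` for the fluctuation of the gradient around its conditional
mean with `0.021` for the distance of this mean from the ideal gradient. -/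
theorem IsReducedSVD.measure_batch_le (hX : IsReducedSVD X Ustar σ V) (hr : 0 < r)
    (hm : 0 < m) (hq : 0 < q) (hrn : r ≤ n) (hμ1 : 1 ≤ μ) (hμ : RightIncoherent σ V μ)
    (hU : Uᵀ * U = 1)
    (hδ0 : 0 < δ) (hδ1 : δ ≤ 0.1 / kappa σ ^ 2) (hδ : subspaceDist Ustar U ≤ δ)
    {A : Phase → Fin ρ × Fin q → Ω → Matrix (Fin m) (Fin n) ℝ}
    (hA : IsStdGaussian (fun (p : Phase × (Fin ρ × Fin q) × Fin m × Fin n) ω =>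
      A p.1 p.2.1 ω p.2.2.1 p.2.2.2) P) :
    P {ω | (∀ j, WellConditioned (A .updateB j ω * U)) ∧
      CoeffsAccurate X U (fun j => lsCoeff (A .updateB j ω) U (X.col j.2)) ∧
      0.031 * δ * sigmaMin σ ^ 2 * (ρ * m) <
      ‖∑ i, nodeGradient (fun k => A .updateB (i, k) ω) (fun k => A .updateU (i, k) ω) X U -
        (ρ * m : ℝ) • ((U * (Uᵀ * X) - X) * (Uᵀ * X)ᵀ)‖} ≤
      ENNReal.ofReal (2 * 5 ^ (n * r) * Real.exp (-(sampleRatio σ μ m q ρ / 2560000))) := by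
  have hκ1 := hX.one_le_kappa hr
  have hδ1' : δ ≤ 0.1 := hδ1.trans (div_le_self (by norm_num) (one_le_pow₀ hκ1))
  have h1 := hX.measure_lsError_le hr hm hq hμ1 hμ hU hδ0 hδ (A := A .updateB) (P := P)
    (hA.precomp (f := fun p => (Phase.updateB, p)) (Prod.mk_right_injective _))
  have h2 := hX.measure_gradient_le hr hm hq hμ1 hμ hU hδ0 hδ1' hδ hA
  refine le_trans (measure_mono ?_) ((measure_union_le _ _).trans ((add_le_add h1 h2).trans ?_))
  · rintro ω ⟨hW, hb, hlt⟩
    by_contra hcon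
    simp only [Set.mem_union, Set.mem_ofPred_eq, not_or, not_and, not_lt] at hcon
    obtain ⟨hc1, hc2⟩ := hcon
    have hc1 := hc1 hW
    have hc2 := hc2 hb
    have e : ∀ j : Fin ρ × Fin q, pinv (A .updateB j ω * U) *ᵥ (A .updateB j ω *ᵥ
        resid U (X.col j.2)) = lsCoeff (A .updateB j ω) U (X.col j.2) - Uᵀ *ᵥ X.col j.2 := by
      intro j
      rw [(hW j).lsCoeff_eq hm, add_sub_cancel_left, resid]
    simp only [e] at hc1
    have h3 := hb.norm_sub_le hX hr hU hδ1 hδ hc1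
    refine absurd hlt (not_lt.2 ?_)
    rw [sum_nodeGradient (fun j => A .updateB j ω) (fun j => A .updateU j ω)]
    have hc3 : ‖(m : ℝ) •
        (∑ j, Matrix.vecMulVec (U *ᵥ lsCoeff (A .updateB j ω) U (X.col j.2) - X.col j.2)
          (lsCoeff (A .updateB j ω) U (X.col j.2)) -
          (ρ : ℝ) • ((U * (Uᵀ * X) - X) * (Uᵀ * X)ᵀ))‖ ≤
        (m : ℝ) * (0.021 * δ * sigmaMin σ ^ 2 * ρ) := by
      rw [norm_smul, Real.norm_of_nonneg (Nat.cast_nonneg _)]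
      gcongr
    have h4 := (norm_add_le _ _).trans (add_le_add hc2 hc3)
    rw [smul_sub, smul_smul, sub_add_sub_cancel, mul_comm (m : ℝ) (ρ : ℝ)] at h4
    refine h4.trans (le_of_eq ?_)
    ring
  · rw [← ENNReal.ofReal_add (by positivity) (by positivity)]
    refine ENNReal.ofReal_le_ofReal ?_
    have hR : 0 ≤ sampleRatio σ μ m q ρ := by rw [sampleRatio]; positivity
    have h5 : (5 : ℝ) ^ (r * r) * Real.exp (-(sampleRatio σ μ m q ρ / 160000)) ≤
        5 ^ (n * r) * Real.exp (-(sampleRatio σ μ m q ρ / 2560000)) := by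
      gcongr
      · norm_num
      · norm_num
    linarith

/-- All the nodes compute accurate coefficients, and all the honest batch gradients are close to
their ideal value. -/
def IterationAccurate (X : Matrix (Fin n) (Fin q) ℝ) (σ : Fin r → ℝ) (δ : ℝ)
    (A : Phase → Node Lt ρ → Fin q → Matrix (Fin m) (Fin n) ℝ) (U : Matrix (Fin n) (Fin r) ℝ) :
    Prop :=
  (∀ ℓ k, vnorm (lsCoeff (A .updateB ℓ k) U (X.col k) - Uᵀ *ᵥ X.col k) ≤
    0.1 * vnorm (resid U (X.col k))) ∧
  ∀ θ, ‖batchSum (fun ℓ => nodeGradient (A .updateB ℓ) (A .updateU ℓ) X U) θ -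
    (ρ * m : ℝ) • ((U * (Uᵀ * X) - X) * (Uᵀ * X)ᵀ)‖ ≤ 0.031 * δ * sigmaMin σ ^ 2 * (ρ * m)

/-- A union bound over the `Lt ρ q` least squares problems and the `Lt` batches. The batch bounds
are only needed on the event that all least squares problems are well behaved. -/
theorem IsReducedSVD.measure_not_iterationAccurate_le (hX : IsReducedSVD X Ustar σ V)
    (hr : 0 < r) (hm : 0 < m) (hq : 0 < q) (hrn : r ≤ n) (hμ1 : 1 ≤ μ)
    (hμ : RightIncoherent σ V μ) (hU : Uᵀ * U = 1)
    (hδ0 : 0 < δ) (hδ1 : δ ≤ 0.1 / kappa σ ^ 2) (hδ : subspaceDist Ustar U ≤ δ)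
    {A : Phase → Node Lt ρ → Fin q → Ω → Matrix (Fin m) (Fin n) ℝ}
    (hA : IsStdGaussian (fun (a : Phase × Node Lt ρ × Fin q × Fin m × Fin n) ω =>
      A a.1 a.2.1 a.2.2.1 ω a.2.2.2.1 a.2.2.2.2) P) :
    P {ω | ¬ IterationAccurate X σ δ (fun f ℓ k => A f ℓ k ω) U} ≤
      ENNReal.ofReal ((Lt * ρ * q) * (2 * 25 ^ r * Real.exp (-(m / 25600))) +
        Lt * (2 * 5 ^ (n * r) * Real.exp (-(sampleRatio σ μ m q ρ / 2560000)))) := by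
  set B₁ : Node Lt ρ × Fin q → Set Ω := fun p => {ω | ¬ (WellConditioned (A .updateB p.1 p.2 ω * U) ∧
      vnorm (lsCoeff (A .updateB p.1 p.2 ω) U (X.col p.2) - Uᵀ *ᵥ X.col p.2) ≤
        0.1 * vnorm (resid U (X.col p.2)))} with hB₁
  set B₂ : Fin Lt → Set Ω := fun θ =>
    {ω | (∀ j : Fin ρ × Fin q, WellConditioned (A .updateB (θ, j.1) j.2 ω * U)) ∧
      CoeffsAccurate X U (fun j : Fin ρ × Fin q => lsCoeff (A .updateB (θ, j.1) j.2 ω) U (X.col j.2)) ∧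
      0.031 * δ * sigmaMin σ ^ 2 * (ρ * m) <
      ‖∑ i, nodeGradient (fun k => A .updateB (θ, i) k ω) (fun k => A .updateU (θ, i) k ω) X U -
        (ρ * m : ℝ) • ((U * (Uᵀ * X) - X) * (Uᵀ * X)ᵀ)‖} with hB₂
  have hsub : {ω | ¬ IterationAccurate X σ δ (fun f ℓ k => A f ℓ k ω) U} ⊆
      (⋃ p ∈ (Finset.univ : Finset (Node Lt ρ × Fin q)), B₁ p) ∪
      ⋃ θ ∈ (Finset.univ : Finset (Fin Lt)), B₂ θ := by
    intro ω hω
    by_contra hcon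
    simp only [Set.mem_union, Set.mem_iUnion, Finset.mem_univ, exists_true_left, not_or,
      not_exists] at hcon
    obtain ⟨hc1, hc2⟩ := hcon
    have hc1' : ∀ ℓ k, WellConditioned (A .updateB ℓ k ω * U) ∧
      vnorm (lsCoeff (A .updateB ℓ k ω) U (X.col k) - Uᵀ *ᵥ X.col k) ≤
        0.1 * vnorm (resid U (X.col k)) := fun ℓ k => not_not.1 (hc1 (ℓ, k))
    refine hω ⟨fun ℓ k => (hc1' ℓ k).2, fun θ => ?_⟩
    by_contra hlt
    exact hc2 θ ⟨fun j => (hc1' _ _).1, fun j => (hc1' _ _).2, not_le.1 hlt⟩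
  have h1 : P (⋃ p ∈ (Finset.univ : Finset (Node Lt ρ × Fin q)), B₁ p) ≤
      ENNReal.ofReal ((Lt * ρ * q) * (2 * 25 ^ r * Real.exp (-(m / 25600)))) := by
    refine measure_biUnion_le_of_card_le (le_of_eq ?_) fun p _ => ?_
    · simp [Node]
    · exact measure_lsCoeff_le hm (A := A .updateB p.1 p.2) (hA.precomp
        (f := fun c => (Phase.updateB, p.1, p.2, c)) (fun c c' h => by simpa using h)) hU _
  have h2 : P (⋃ θ ∈ (Finset.univ : Finset (Fin Lt)), B₂ θ) ≤
      ENNReal.ofReal (Lt * (2 * 5 ^ (n * r) * Real.exp (-(sampleRatio σ μ m q ρ / 2560000)))) := by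
    refine measure_biUnion_le_of_card_le (le_of_eq ?_) fun θ _ => ?_
    · simp
    · exact hX.measure_batch_le hr hm hq hrn hμ1 hμ hU hδ0 hδ1 hδ
        (A := fun f j ω => A f (θ, j.1) j.2 ω) (hA.precomp
        (f := fun p : Phase × (Fin ρ × Fin q) × Fin m × Fin n =>
          (p.1, (θ, p.2.1.1), p.2.1.2, p.2.2.1, p.2.2.2)) (fun c c' h => by
            simp only [Prod.mk.injEq, true_and] at h
            obtain ⟨h1, h2, h3, h4, h5⟩ := h
            ext <;> simp [*]))
  refine (measure_mono hsub).trans ((measure_union_le _ _).trans ((add_le_add h1 h2).trans ?_))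
  rw [← ENNReal.ofReal_add (by positivity) (by positivity)]

/-- Under the sample complexity assumptions the failure probability of an iteration is small. -/
theorem failure_bound (hr : 0 < r) (hn : 2 ≤ n) (hq : 0 < q) (hLt : 0 < Lt) (hρ : 0 < ρ)
    (hκ : 1 ≤ kappa σ) (hμ1 : 1 ≤ μ)
    (hC₁ : (38400000 : ℝ) * Lt * kappa σ ^ 4 * μ ^ 2 * (n + r) * r ^ 2 ≤
        ((Lt * ρ : ℕ) : ℝ) * m * q)
    (hC₂ : (460800 : ℝ) * max (max (Real.log q) (Real.log n)) r ≤ m) :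
    (Lt * ρ * q : ℝ) * (2 * 25 ^ r * Real.exp (-(m / 25600))) +
      Lt * (2 * 5 ^ (n * r) * Real.exp (-(sampleRatio σ μ m q ρ / 2560000))) ≤
      ((Lt * ρ : ℕ) : ℝ) * ((n : ℝ) ^ 10)⁻¹ / 2 := by
  have hr' : (1 : ℝ) ≤ r := by exact_mod_cast hr
  have hn' : (2 : ℝ) ≤ n := by exact_mod_cast hn
  have hq' : (0 : ℝ) < q := by exact_mod_cast hq
  have hLt' : (0 : ℝ) < Lt := by exact_mod_cast hLt
  have hρ' : (1 : ℝ) ≤ ρ := by exact_mod_cast hρ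
  have hn0 : (0 : ℝ) < n := by linarith
  set M := max (max (Real.log q) (Real.log n)) (r : ℝ) with hM
  have hM1 : Real.log q ≤ M := (le_max_left _ _).trans (le_max_left _ _)
  have hM2 : Real.log n ≤ M := (le_max_right _ _).trans (le_max_left _ _)
  have hM3 : (r : ℝ) ≤ M := le_max_right _ _
  -- Of the exponent `13`, ten powers of `n` are the target and the other three give a factor `1/8`,
  -- since `n ≥ 2`.
  have hbase : 2 * Real.exp (-(13 * Real.log n)) ≤ ((n : ℝ) ^ 10)⁻¹ / 4 := by
    have e : Real.exp (-(13 * Real.log n)) = ((n : ℝ) ^ 10)⁻¹ * ((n : ℝ) ^ 3)⁻¹ := by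
      rw [Real.exp_neg, ← mul_inv, ← pow_add,
        show (13 : ℝ) * Real.log n = ((13 : ℕ) : ℝ) * Real.log n by norm_num, Real.exp_nat_mul,
        Real.exp_log hn0]
    rw [e]
    have h8 : ((n : ℝ) ^ 3)⁻¹ ≤ 1 / 8 := by
      rw [one_div]
      gcongr
      calc (8 : ℝ) = 2 ^ 3 := by norm_num
        _ ≤ (n : ℝ) ^ 3 := by gcongr
    have h10 : (0 : ℝ) ≤ ((n : ℝ) ^ 10)⁻¹ := by positivity
    nlinarith
  have he4 : (25 : ℝ) ≤ Real.exp 4 := by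
    have h1 : (2.7 : ℝ) ≤ Real.exp 1 := by linarith [Real.exp_one_gt_d9]
    calc (25 : ℝ) ≤ 2.7 ^ 4 := by norm_num
      _ ≤ Real.exp 1 ^ 4 := by gcongr
      _ = Real.exp 4 := by rw [← Real.exp_nat_mul]; norm_num
  have he2 : (5 : ℝ) ≤ Real.exp 2 := by
    have h1 : (2.7 : ℝ) ≤ Real.exp 1 := by linarith [Real.exp_one_gt_d9]
    calc (5 : ℝ) ≤ 2.7 ^ 2 := by norm_num
      _ ≤ Real.exp 1 ^ 2 := by gcongr
      _ = Real.exp 2 := by rw [← Real.exp_nat_mul]; norm_num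
  -- The constant is `460800 = 18 · 25600`, and `log q + 4 r + 13 log n ≤ 18 M`.
  have h1 : (q : ℝ) * (2 * 25 ^ r * Real.exp (-(m / 25600))) ≤ ((n : ℝ) ^ 10)⁻¹ / 4 := by
    refine le_trans ?_ hbase
    calc (q : ℝ) * (2 * 25 ^ r * Real.exp (-(m / 25600)))
        ≤ Real.exp (Real.log q) * (2 * Real.exp 4 ^ r * Real.exp (-(m / 25600))) := by
          rw [Real.exp_log hq']; gcongr
      _ = 2 * Real.exp (Real.log q + 4 * r - m / 25600) := by
          rw [← Real.exp_nat_mul, sub_eq_add_neg, Real.exp_add, Real.exp_add, mul_comm (r : ℝ) 4]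
          ring
      _ ≤ 2 * Real.exp (-(13 * Real.log n)) := by
          gcongr
          linarith
  have h2 : 2 * 5 ^ (n * r) * Real.exp (-(sampleRatio σ μ m q ρ / 2560000)) ≤
      ((n : ℝ) ^ 10)⁻¹ / 4 := by
    refine le_trans ?_ hbase
    -- The constant is `38400000 = 15 · 2560000`: two units of `n r` pay for the net of size `5 ^ (n
    -- r)`, and `13` units dominate `13 log n`.
    have hratio : 38400000 * ((n : ℝ) * r) ≤ sampleRatio σ μ m q ρ := by
      rw [sampleRatio, le_div_iff₀ (by positivity)]
      push_cast at hC₁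
      have h3 : (Lt : ℝ) * (38400000 * ((n : ℝ) * r) * (kappa σ ^ 4 * μ ^ 2 * r)) ≤
          Lt * (ρ * m * q) := by
        calc (Lt : ℝ) * (38400000 * ((n : ℝ) * r) * (kappa σ ^ 4 * μ ^ 2 * r))
            = 38400000 * Lt * kappa σ ^ 4 * μ ^ 2 * n * r ^ 2 := by ring
          _ ≤ 38400000 * Lt * kappa σ ^ 4 * μ ^ 2 * (n + r) * r ^ 2 := by gcongr; linarith
          _ ≤ _ := hC₁
          _ = _ := by ring
      exact le_of_mul_le_mul_left h3 hLt'
    have hlog : Real.log n ≤ n := (Real.log_le_sub_one_of_pos hn0).trans (by linarith)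
    calc 2 * 5 ^ (n * r) * Real.exp (-(sampleRatio σ μ m q ρ / 2560000))
        ≤ 2 * Real.exp 2 ^ (n * r) * Real.exp (-(sampleRatio σ μ m q ρ / 2560000)) := by gcongr
      _ = 2 * Real.exp (2 * (n * r) - sampleRatio σ μ m q ρ / 2560000) := by
          rw [← Real.exp_nat_mul, sub_eq_add_neg, Real.exp_add]
          push_cast
          ring_nf
      _ ≤ 2 * Real.exp (-(13 * Real.log n)) := by
          gcongr
          nlinarith
  push_cast
  have h10 : (0 : ℝ) ≤ ((n : ℝ) ^ 10)⁻¹ := by positivity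
  calc (Lt * ρ * q : ℝ) * (2 * 25 ^ r * Real.exp (-(m / 25600))) +
      Lt * (2 * 5 ^ (n * r) * Real.exp (-(sampleRatio σ μ m q ρ / 2560000)))
      = Lt * ρ * (q * (2 * 25 ^ r * Real.exp (-(m / 25600)))) +
      Lt * (2 * 5 ^ (n * r) * Real.exp (-(sampleRatio σ μ m q ρ / 2560000))) := by ring
    _ ≤ Lt * ρ * (((n : ℝ) ^ 10)⁻¹ / 4) + Lt * ρ * (((n : ℝ) ^ 10)⁻¹ / 4) := by
        gcongr
        exact le_mul_of_one_le_right hLt'.le hρ'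
    _ = _ := by ring

theorem measurableSet_iterationAccurate :
    MeasurableSet {x : (Fin n × Fin r → ℝ) × (Phase × Node Lt ρ × Fin q × Fin m × Fin n → ℝ) |
      IterationAccurate X σ δ (fun f ℓ k => Matrix.of fun i c => x.2 (f, ℓ, k, i, c))
        (Matrix.of fun i c => x.1 (i, c))} := by
  have hU : EntrywiseMeasurable fun x : (Fin n × Fin r → ℝ) ×
      (Phase × Node Lt ρ × Fin q × Fin m × Fin n → ℝ) =>
      (Matrix.of fun i c => x.1 (i, c) : Matrix (Fin n) (Fin r) ℝ) := fun i c => by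
    simp only [Matrix.of_apply]; fun_prop
  have hA : ∀ f ℓ k, EntrywiseMeasurable fun x : (Fin n × Fin r → ℝ) ×
      (Phase × Node Lt ρ × Fin q × Fin m × Fin n → ℝ) =>
      (Matrix.of fun i c => x.2 (f, ℓ, k, i, c) : Matrix (Fin m) (Fin n) ℝ) :=
    fun f ℓ k i c => by simp only [Matrix.of_apply]; fun_prop
  have hb := fun f ℓ k => (hA f ℓ k).lsCoeff hU (X.col k)
  refine MeasurableSet.inter ?_ ?_
  · change MeasurableSet {x | ∀ ℓ, _}
    rw [Set.ofPred_forall]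
    refine MeasurableSet.iInter fun ℓ => ?_
    rw [Set.ofPred_forall]
    refine MeasurableSet.iInter fun k => ?_
    refine measurableSet_le (measurable_vnorm ((hb .updateB ℓ k).sub
      (hU.transpose.mulVec measurable_const))) (measurable_const.mul (measurable_vnorm ?_))
    exact measurable_const.sub (hU.mulVec (hU.transpose.mulVec measurable_const))
  · change MeasurableSet {x | ∀ θ, _}
    rw [Set.ofPred_forall]
    refine MeasurableSet.iInter fun θ => ?_
    refine measurableSet_le (EntrywiseMeasurable.norm (EntrywiseMeasurable.sub ?_ ?_))
      measurable_const
    · refine EntrywiseMeasurable.sum fun i _ => EntrywiseMeasurable.sum fun k _ =>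
        EntrywiseMeasurable.vecMulVec ((hA _ _ _).transpose.mulVec (Measurable.sub
          ((hA _ _ _).mulVec (hU.mulVec (hb _ _ _))) ((hA _ _ _).mulVec measurable_const)))
          (hb _ _ _)
    · have hG := hU.transpose.mul (EntrywiseMeasurable.const X)
      exact (((hU.mul hG).sub (EntrywiseMeasurable.const X)).mul hG.transpose).const_smul _

theorem measurableSet_orthonormal_subspaceDist_le :
    MeasurableSet {x : Fin n × Fin r → ℝ |
      (Matrix.of fun i c => x (i, c) : Matrix (Fin n) (Fin r) ℝ)ᵀ *
        (Matrix.of fun i c => x (i, c)) = 1 ∧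
      subspaceDist Ustar (Matrix.of fun i c => x (i, c)) ≤ δ} := by
  have hU : EntrywiseMeasurable fun x : Fin n × Fin r → ℝ =>
      (Matrix.of fun i c => x (i, c) : Matrix (Fin n) (Fin r) ℝ) := fun i c => by
    simp only [Matrix.of_apply]; fun_prop
  refine MeasurableSet.inter ?_ ?_
  · have : {x : Fin n × Fin r → ℝ | (Matrix.of fun i c => x (i, c) : Matrix (Fin n) (Fin r) ℝ)ᵀ *
        (Matrix.of fun i c => x (i, c)) = 1} = ⋂ i, ⋂ j, {x : Fin n × Fin r → ℝ |
        ((Matrix.of fun i c => x (i, c) : Matrix (Fin n) (Fin r) ℝ)ᵀ *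
        (Matrix.of fun i c => x (i, c))) i j = (1 : Matrix (Fin r) (Fin r) ℝ) i j} := by
      ext x
      simp only [Set.mem_iInter, Set.mem_ofPred_eq, ← Matrix.ext_iff]
    change MeasurableSet {x : Fin n × Fin r → ℝ | _ = _}
    rw [this]
    exact MeasurableSet.iInter fun i => MeasurableSet.iInter fun j =>
      measurableSet_eq_fun ((hU.transpose.mul hU) i j) measurable_const
  · exact measurableSet_le ((EntrywiseMeasurable.const _).mul hU).norm measurable_const

/-- With random subspace estimate and fresh data, an iteration that starts close to the truth is
accurate with high probability. -/
theorem IsSampleSplitGaussian.measure_not_iterationAccurate_le [IsProbabilityMeasure P]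
    {F : Filtration ℕ mΩ} {A : ℕ → Phase → Node Lt ρ → Fin q → Ω → Matrix (Fin m) (Fin n) ℝ}
    (hA : IsSampleSplitGaussian P F A) (hX : IsReducedSVD X Ustar σ V)
    (hr : 0 < r) (hm : 0 < m) (hq : 0 < q) (hrn : r ≤ n) (hμ1 : 1 ≤ μ)
    (hμ : RightIncoherent σ V μ) (hδ0 : 0 < δ) (hδ1 : δ ≤ 0.1 / kappa σ ^ 2) (s : ℕ)
    {U : Ω → Matrix (Fin n) (Fin r) ℝ} (hUm : ∀ i j, Measurable[F s] fun ω => U ω i j) :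
    P {ω | ((U ω)ᵀ * U ω = 1 ∧ subspaceDist Ustar (U ω) ≤ δ) ∧
      ¬ IterationAccurate X σ δ (fun f ℓ k => A s f ℓ k ω) (U ω)} ≤
      ENNReal.ofReal ((Lt * ρ * q) * (2 * 25 ^ r * Real.exp (-(m / 25600))) +
        Lt * (2 * 5 ^ (n * r) * Real.exp (-(sampleRatio σ μ m q ρ / 2560000)))) := by
  have hAs : IsStdGaussian (fun (a : Phase × Node Lt ρ × Fin q × Fin m × Fin n) ω =>
      A s a.1 a.2.1 a.2.2.1 ω a.2.2.2.1 a.2.2.2.2) P :=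
    { measurable := fun a => (hA.adapted s _ _ _ _ _).mono (F.le _) le_rfl
      map_eq := fun a => hA.gaussian s _ _ _ _ _
      indep := hA.indep_entries s }
  set Y : Ω → Phase × Node Lt ρ × Fin q × Fin m × Fin n → ℝ := fun ω a =>
    A s a.1 a.2.1 a.2.2.1 ω a.2.2.2.1 a.2.2.2.2 with hY
  have hYm : Measurable Y := measurable_pi_lambda _ hAs.measurable
  set W : Ω → Fin n × Fin r → ℝ := fun ω p => U ω p.1 p.2 with hW
  have hWs : Measurable[F s] W :=
    (@measurable_pi_iff _ _ _ (F s) _ _).2 fun p => hUm p.1 p.2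
  have hWm : Measurable W := hWs.mono (F.le s) le_rfl
  -- The current estimate is measurable with respect to the past, from which the data of iteration
  -- `s` are independent, so it can be frozen.
  have hind : IndepFun W Y P := by
    rw [IndepFun_iff_Indep]
    exact indep_of_indep_of_le_left (hA.fresh s).symm hWs.comap_le
  refine measure_le_of_indepFun hWm hYm hind
    (S := (Prod.fst ⁻¹' {x : Fin n × Fin r → ℝ |
      (Matrix.of fun i c => x (i, c) : Matrix (Fin n) (Fin r) ℝ)ᵀ *
        (Matrix.of fun i c => x (i, c)) = 1 ∧
      subspaceDist Ustar (Matrix.of fun i c => x (i, c)) ≤ δ}) ∩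
      {x : (Fin n × Fin r → ℝ) × (Phase × Node Lt ρ × Fin q × Fin m × Fin n → ℝ) |
      IterationAccurate X σ δ (fun f ℓ k => Matrix.of fun i c => x.2 (f, ℓ, k, i, c))
        (Matrix.of fun i c => x.1 (i, c))}ᶜ)
    ((measurableSet_orthonormal_subspaceDist_le.preimage measurable_fst).inter
      measurableSet_iterationAccurate.compl) fun x => ?_
  by_cases hx : (Matrix.of fun i c => x (i, c) : Matrix (Fin n) (Fin r) ℝ)ᵀ *
        (Matrix.of fun i c => x (i, c)) = 1 ∧
      subspaceDist Ustar (Matrix.of fun i c => x (i, c)) ≤ δ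
  · exact le_trans (measure_mono fun ω hω => hω.2)
      (hX.measure_not_iterationAccurate_le hr hm hq hrn hμ1 hμ hx.1 hδ0 hδ1 hx.2
        (A := A s) hAs)
  · refine le_trans (measure_mono fun ω hω => hx hω.1) (?_ : P ∅ ≤ _)
    simp

end Iteration

/-! ### The error bounds -/

section ErrorBound

variable {n q r : ℕ} {X : Matrix (Fin n) (Fin q) ℝ} {Ustar : Matrix (Fin n) (Fin r) ℝ}
  {σ : Fin r → ℝ} {V : Matrix (Fin q) (Fin r) ℝ} {η : ℝ}

theorem errorBound_zero (σ : Fin r → ℝ) (η : ℝ) : errorBound σ η 0 = 0.1 / kappa σ ^ 2 := by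
  simp [errorBound]

theorem IsReducedSVD.decay_eq (hX : IsReducedSVD X Ustar σ V) (hr : 0 < r) :
    η * sigmaMax σ ^ 2 * (0.12 / kappa σ ^ 2) = 0.12 * (η * sigmaMin σ ^ 2) := by
  have h1 := (hX.sigmaMin_pos hr).ne'
  have h2 := (hX.sigmaMax_pos hr).ne'
  rw [kappa]
  field_simp

theorem IsReducedSVD.mul_sigmaMax_sq_le (hX : IsReducedSVD X Ustar σ V) (hr : 0 < r)
    (hη1 : η ≤ 0.5 / sigmaMax σ ^ 2) : η * sigmaMax σ ^ 2 ≤ 0.5 := by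
  have h2 := hX.sigmaMax_pos hr
  rwa [le_div_iff₀ (by positivity)] at hη1

theorem IsReducedSVD.mul_sigmaMin_sq_le (hX : IsReducedSVD X Ustar σ V) (hr : 0 < r) (hη : 0 < η)
    (hη1 : η ≤ 0.5 / sigmaMax σ ^ 2) : η * sigmaMin σ ^ 2 ≤ 0.5 := by
  refine le_trans ?_ (hX.mul_sigmaMax_sq_le hr hη1)
  exact mul_le_mul_of_nonneg_left
    (pow_le_pow_left₀ (hX.sigmaMin_pos hr).le (sigmaMin_le_sigmaMax hr σ) 2) hη.le

theorem IsReducedSVD.errorBound_succ (hX : IsReducedSVD X Ustar σ V) (hr : 0 < r) (t : ℕ) :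
    errorBound σ η (t + 1) = (1 - 0.12 * (η * sigmaMin σ ^ 2)) * errorBound σ η t := by
  rw [errorBound, errorBound, hX.decay_eq hr, pow_succ]
  ring

theorem IsReducedSVD.errorBound_pos (hX : IsReducedSVD X Ustar σ V) (hr : 0 < r) (hη : 0 < η)
    (hη1 : η ≤ 0.5 / sigmaMax σ ^ 2) (t : ℕ) : 0 < errorBound σ η t := by
  have h := hX.mul_sigmaMin_sq_le hr hη hη1
  have hκ := hX.one_le_kappa hr
  rw [errorBound, hX.decay_eq hr]
  have : 0 < 1 - 0.12 * (η * sigmaMin σ ^ 2) := by linarith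
  positivity

theorem IsReducedSVD.errorBound_antitone (hX : IsReducedSVD X Ustar σ V) (hr : 0 < r) (hη : 0 < η)
    (hη1 : η ≤ 0.5 / sigmaMax σ ^ 2) : Antitone (errorBound σ η) := by
  refine antitone_nat_of_succ_le fun t => ?_
  rw [hX.errorBound_succ hr]
  refine mul_le_of_le_one_left (hX.errorBound_pos hr hη hη1 t).le ?_
  have := hX.sigmaMin_pos hr
  have : 0 < η * sigmaMin σ ^ 2 := by positivity
  linarith

theorem IsReducedSVD.errorBound_le (hX : IsReducedSVD X Ustar σ V) (hr : 0 < r) (hη : 0 < η)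
    (hη1 : η ≤ 0.5 / sigmaMax σ ^ 2) (t : ℕ) : errorBound σ η t ≤ 0.1 / kappa σ ^ 2 :=
  (hX.errorBound_antitone hr hη hη1 (Nat.zero_le t)).trans_eq (errorBound_zero σ η)

theorem IsReducedSVD.div_kappa_sq_le (hX : IsReducedSVD X Ustar σ V) (hr : 0 < r) :
    0.1 / kappa σ ^ 2 ≤ 0.1 :=
  div_le_self (by norm_num) (one_le_pow₀ (hX.one_le_kappa hr))

/-- The error bound drops below `ε` after `O(κ² / (η σ_max²) log (1/ε))` iterations. -/
theorem IsReducedSVD.exists_errorBound_le (hX : IsReducedSVD X Ustar σ V) (hr : 0 < r) (hη : 0 < η)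
    (hη1 : η ≤ 0.5 / sigmaMax σ ^ 2) {ε : ℝ} (hε : 0 < ε) (hε1 : ε < 1) :
    ∃ T : ℕ, errorBound σ η T ≤ ε ∧ (∀ t < T, ε ≤ errorBound σ η t) ∧
      (T : ℝ) ≤ 10 * (kappa σ ^ 2 / (η * sigmaMax σ ^ 2)) * Real.log (1 / ε) := by
  have hmin := hX.sigmaMin_pos hr
  have hmax := hX.sigmaMax_pos hr
  have hκ := hX.one_le_kappa hr
  have hlog : 0 < Real.log (1 / ε) := Real.log_pos (one_lt_one_div hε hε1)
  set c := η * sigmaMin σ ^ 2 with hc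
  have hc0 : 0 < c := by positivity
  have hc1 : c ≤ 0.5 := hX.mul_sigmaMin_sq_le hr hη hη1
  have hinv : kappa σ ^ 2 / (η * sigmaMax σ ^ 2) = 1 / c := by
    rw [kappa, hc]; field_simp
  have hle : ∀ t : ℕ, errorBound σ η t ≤ Real.exp (-(0.12 * c * t)) * 0.1 := fun t => by
    have h1 : (1 - 0.12 * c) ^ t ≤ Real.exp (-(0.12 * c * t)) := by
      calc (1 - 0.12 * c) ^ t ≤ Real.exp (-(0.12 * c)) ^ t :=
            pow_le_pow_left₀ (by linarith) (Real.one_sub_le_exp_neg _) t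
        _ = Real.exp (-(0.12 * c * t)) := by rw [← Real.exp_nat_mul]; ring_nf
    rw [errorBound, hX.decay_eq hr]
    exact mul_le_mul h1 (hX.div_kappa_sq_le hr) (by positivity) (Real.exp_pos _).le
  have hex : ∃ T, errorBound σ η T ≤ ε := by
    refine ⟨⌈Real.log (1 / ε) / (0.12 * c)⌉₊, (hle _).trans ?_⟩
    have h2 := Nat.le_ceil (Real.log (1 / ε) / (0.12 * c))
    rw [div_le_iff₀ (by positivity)] at h2
    calc _ ≤ Real.exp (-Real.log (1 / ε)) * 1 := by gcongr <;> linarith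
      _ = ε := by rw [one_div, Real.log_inv, neg_neg, Real.exp_log hε, mul_one]
  classical
  refine ⟨Nat.find hex, Nat.find_spec hex, fun t ht => (not_le.1 (Nat.find_min hex ht)).le, ?_⟩
  rw [hinv]
  rcases Nat.eq_zero_or_pos (Nat.find hex) with h0 | h0
  · rw [h0, Nat.cast_zero]; positivity
  · obtain ⟨t, ht⟩ := Nat.exists_eq_succ_of_ne_zero h0.ne'
    have h3 := (not_le.1 (Nat.find_min hex (ht ▸ Nat.lt_succ_self t))).trans_le (hle t)
    have hl := Real.log_lt_log hε h3
    rw [Real.log_mul (Real.exp_pos _).ne' (by norm_num), Real.log_exp] at hl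
    -- The index before the first success satisfies `0.12 c t ≤ log (1/ε) - 0.9`. The slack `0.9`,
    -- which comes from the initial factor `0.1`, pays for the extra iteration in `t + 1`.
    have h01 : Real.log 0.1 ≤ -0.9 := (Real.log_le_sub_one_of_pos (by norm_num)).trans (by norm_num)
    have hlog' : Real.log (1 / ε) = -Real.log ε := by rw [one_div, Real.log_inv]
    have ht0 : 0 ≤ 0.12 * c * t := by positivity
    have key : (t + 1) * c ≤ 10 * Real.log (1 / ε) := by rw [hlog']; linarith
    rw [ht, Nat.succ_eq_add_one, Nat.cast_add, Nat.cast_one, mul_one_div, div_mul_eq_mul_div,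
      le_div_iff₀ hc0]
    exact key

end ErrorBound

/-! ### Aggregation of the batches -/

section Aggregation

variable {m n q r ρ Lt : ℕ} {X : Matrix (Fin n) (Fin q) ℝ} {Ustar : Matrix (Fin n) (Fin r) ℝ}
  {σ : Fin r → ℝ} {V : Matrix (Fin q) (Fin r) ℝ} {U : Matrix (Fin n) (Fin r) ℝ} {δ : ℝ}

/-- Two factors bounded by `δ σ_max` and `σ_max`, combined with `δ ≤ 0.1 / κ²`. The bound keeps
honest batches below the threshold. -/
theorem IsReducedSVD.norm_expectedGradient_le (hX : IsReducedSVD X Ustar σ V) (hr : 0 < r)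
    (hU : Uᵀ * U = 1) (hδ : subspaceDist Ustar U ≤ δ) (hδ1 : δ ≤ 0.1 / kappa σ ^ 2) :
    ‖(U * (Uᵀ * X) - X) * (Uᵀ * X)ᵀ‖ ≤ 0.1 * sigmaMin σ ^ 2 := by
  have hmin := hX.sigmaMin_pos hr
  have hmax := hX.sigmaMax_pos hr
  have h1 : ‖U * (Uᵀ * X) - X‖ ≤ δ * sigmaMax σ := by
    have e : U * (Uᵀ * X) - X = -((1 - U * Uᵀ) * X) := by
      rw [Matrix.sub_mul, Matrix.one_mul, Matrix.mul_assoc, neg_sub]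
    rw [e, norm_neg]
    refine (hX.norm_mul_le hr _).trans (mul_le_mul_of_nonneg_right ?_ hmax.le)
    rw [subspaceDist_comm hX.left_orthonormal hU] at hδ
    exact hδ
  have h2 : ‖(U * (Uᵀ * X) - X) * (Uᵀ * X)ᵀ‖ ≤ sigmaMax σ * ‖U * (Uᵀ * X) - X‖ := by
    rw [← Matrix.frobenius_norm_transpose, Matrix.transpose_mul, Matrix.transpose_transpose,
      ← Matrix.frobenius_norm_transpose (U * (Uᵀ * X) - X)]
    refine frob_mul_le_of_vnorm_le hmax.le (fun v => ?_) _
    rw [← Matrix.mulVec_mulVec]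
    exact (vnorm_transpose_mulVec_le hU _).trans (hX.vnorm_mulVec_le hr v)
  calc _ ≤ sigmaMax σ * (0.1 / kappa σ ^ 2 * sigmaMax σ) := by
        refine h2.trans (mul_le_mul_of_nonneg_left (h1.trans ?_) hmax.le)
        gcongr
    _ = 0.1 * sigmaMin σ ^ 2 := by rw [kappa]; field_simp

/-- Each spoiled batch contains a Byzantine node, and distinct batches contain distinct ones. -/
theorem card_compl_filter_forall_mem_le (good : Finset (Node Lt ρ)) :
    (Finset.univ.filter fun θ => ∀ j, (θ, j) ∈ good)ᶜ.card ≤ goodᶜ.card := by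
  classical
  refine (Finset.card_le_card fun θ hθ => ?_).trans (Finset.card_image_le (f := Prod.fst))
  simp only [Finset.mem_compl, Finset.mem_filter, Finset.mem_univ, true_and, not_forall] at hθ
  obtain ⟨j, hj⟩ := hθ
  exact Finset.mem_image.2 ⟨(θ, j), Finset.mem_compl.2 hj, rfl⟩

/-- The aggregated gradient is close to the expected one, if the batches without Byzantine nodes
are accurate and form a majority of at least `60%`. -/
theorem IterationAccurate.norm_approxGM_sub_le
    {A : Phase → Node Lt ρ → Fin q → Matrix (Fin m) (Fin n) ℝ}
    (hacc : IterationAccurate X σ δ A U) (hX : IsReducedSVD X Ustar σ V) (hr : 0 < r)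
    (hU : Uᵀ * U = 1) (hδ0 : 0 < δ) (hδ1 : δ ≤ 0.1 / kappa σ ^ 2) (hδ : subspaceDist Ustar U ≤ δ)
    {good : Finset (Node Lt ρ)} (hgood : (goodᶜ.card : ℝ) < 0.4 * Lt)
    {Z : Node Lt ρ → Matrix (Fin n) (Fin r) ℝ}
    (hZ : ∀ ℓ ∈ good, Z ℓ = nodeGradient (A .updateB ℓ) (A .updateU ℓ) X U)
    {Cthr thr εGM : ℝ} (hC : 1 ≤ Cthr) (hthr : thr = Cthr * (ρ * m) * sigmaMin σ ^ 2)
    (hε0 : 0 < εGM) (hε1 : εGM < 1) {T : ℕ} {x : ℕ → Matrix (Fin n) (Fin r) ℝ}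
    (hx : LineSearchesSucceed (keptBatches thr Z) (batchSum Z) εGM T x)
    (hT : 12000 * Lt * Cthr * (600 / 601) ^ T ≤ 0.05 * δ) :
    ‖approxGM (keptBatches thr Z) (batchSum Z) T x -
      (ρ * m : ℝ) • ((U * (Uᵀ * X) - X) * (Uᵀ * X)ᵀ)‖ ≤
      0.3 * δ * sigmaMin σ ^ 2 * (ρ * m) := by
  classical
  have hmin := hX.sigmaMin_pos hr
  have hδ1' : δ ≤ 0.1 := hδ1.trans (hX.div_kappa_sq_le hr)
  have hρm : (0 : ℝ) ≤ ρ * m := by positivity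
  set K := keptBatches thr Z with hK
  set S : Finset (Fin Lt) := Finset.univ.filter fun θ => ∀ j, (θ, j) ∈ good with hS
  have hbad : (Sᶜ.card : ℝ) < 0.4 * Lt :=
    lt_of_le_of_lt (by exact_mod_cast card_compl_filter_forall_mem_le good) hgood
  have hcard : (S.card : ℝ) + Sᶜ.card = Lt := by
    have := Finset.card_add_card_compl S
    rw [Fintype.card_fin] at this
    exact_mod_cast this
  have hclose : ∀ θ ∈ S, ‖batchSum Z θ - (ρ * m : ℝ) • ((U * (Uᵀ * X) - X) * (Uᵀ * X)ᵀ)‖ ≤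
      0.031 * δ * sigmaMin σ ^ 2 * (ρ * m) := fun θ hθ => by
    have e : batchSum Z θ =
        batchSum (fun ℓ => nodeGradient (A .updateB ℓ) (A .updateU ℓ) X U) θ :=
      Finset.sum_congr rfl fun j _ => hZ _ ((Finset.mem_filter.1 hθ).2 j)
    rw [e]
    exact hacc.2 θ
  -- Relative to `ρ m σ_min²`, an honest batch has norm at most `0.1 + 0.0031`, well below `Cthr ≥
  -- 1`.
  have hSK : S ⊆ K := fun θ hθ => by
    rw [hK, keptBatches, Finset.mem_filter]
    refine ⟨Finset.mem_univ _, ?_⟩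
    have h1 := norm_le_norm_add_norm_sub' (batchSum Z θ)
      ((ρ * m : ℝ) • ((U * (Uᵀ * X) - X) * (Uᵀ * X)ᵀ))
    have h2 : ‖(ρ * m : ℝ) • ((U * (Uᵀ * X) - X) * (Uᵀ * X)ᵀ)‖ ≤
        (ρ * m) * (0.1 * sigmaMin σ ^ 2) := by
      rw [norm_smul, Real.norm_of_nonneg hρm]
      exact mul_le_mul_of_nonneg_left (hX.norm_expectedGradient_le hr hU hδ hδ1) hρm
    have h3 := hclose θ hθ
    have h4 : 0.031 * δ * sigmaMin σ ^ 2 * (ρ * m) ≤ 0.031 * 0.1 * sigmaMin σ ^ 2 * (ρ * m) := by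
      gcongr
    have h5 : 1 * (ρ * m) * sigmaMin σ ^ 2 ≤ thr := by rw [hthr]; gcongr
    have h6 : 0 ≤ (ρ * m) * sigmaMin σ ^ 2 := by positivity
    nlinarith
  have hKS : ((K \ S).card : ℝ) ≤ Sᶜ.card := by
    exact_mod_cast Finset.card_le_card fun θ hθ => Finset.mem_compl.2 (Finset.mem_sdiff.1 hθ).2
  have hKL : (K.card : ℝ) ≤ Lt := by
    have := Finset.card_le_univ K
    rw [Fintype.card_fin] at this
    exact_mod_cast this
  have hLt0 : (0 : ℝ) < Lt := by
    have : (0 : ℝ) ≤ goodᶜ.card := Nat.cast_nonneg _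
    linarith
  have hthr0 : 0 ≤ thr := by rw [hthr]; positivity
  have hS0 : 0.6 * (Lt : ℝ) ≤ S.card := by linarith
  -- Every surviving batch, corrupted or not, has norm at most `thr`, which serves as the radius of
  -- the input.
  have hobj := gmObjective_approxGM_le hε0 hε1 hx
    (fun θ hθ => (Finset.mem_filter.1 hθ).2) hthr0
    ((ρ * m : ℝ) • ((U * (Uᵀ * X) - X) * (Uᵀ * X)ᵀ))
  have hfin := norm_sub_le_of_gmObjective_le hSK hclose (by linarith)
    (by have : (0 : ℝ) < S.card := by linarith
        exact_mod_cast this) hobj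
  refine hfin.trans ?_
  -- The constant is `12000 = 3 · 2400 / 0.6`. The final error is `6 · 0.031 + 0.05 ≤ 0.3`.
  have hgap : 3 * (2400 * (K.card : ℝ) ^ 2 * thr * (600 / 601) ^ T) / S.card ≤
      12000 * Lt * thr * (600 / 601) ^ T := by
    rw [div_le_iff₀ (by linarith)]
    calc 3 * (2400 * (K.card : ℝ) ^ 2 * thr * (600 / 601) ^ T)
        ≤ 3 * (2400 * (Lt : ℝ) ^ 2 * thr * (600 / 601) ^ T) := by gcongr
      _ = 12000 * Lt * thr * (600 / 601) ^ T * (0.6 * Lt) := by ring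
      _ ≤ _ := by gcongr
  have hgap2 : 12000 * Lt * thr * (600 / 601) ^ T ≤ 0.05 * δ * ((ρ * m) * sigmaMin σ ^ 2) := by
    calc 12000 * Lt * thr * (600 / 601) ^ T
        = 12000 * Lt * Cthr * (600 / 601) ^ T * ((ρ * m) * sigmaMin σ ^ 2) := by rw [hthr]; ring
      _ ≤ _ := mul_le_mul_of_nonneg_right hT (by positivity)
  have h7 : 0 ≤ δ * sigmaMin σ ^ 2 * (ρ * m) := by positivity
  linarith

/-- The number of median iterations that suffices. -/
theorem gm_iterations_suffice {Cthr ε : ℝ} (hC : 1 ≤ Cthr) (hε : 0 < ε) (hε1 : ε ≤ 0.1)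
    (hLt : 0 < Lt) (hρ : 0 < ρ) (hr : 0 < r) {T : ℕ}
    (hT : 601 * (1 + Real.log (240000 * Cthr)) * Real.log (((Lt * ρ : ℕ) : ℝ) * r / ε) ≤ T) :
    12000 * Lt * Cthr * (600 / 601) ^ T ≤ 0.05 * ε := by
  have hLt' : (1 : ℝ) ≤ Lt := by exact_mod_cast hLt
  have hρ' : (1 : ℝ) ≤ ρ := by exact_mod_cast hρ
  have hr' : (1 : ℝ) ≤ r := by exact_mod_cast hr
  have hlogC : 0 ≤ Real.log (240000 * Cthr) := Real.log_nonneg (by linarith)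
  rw [Nat.cast_mul] at hT
  have hρr : 1 ≤ (ρ : ℝ) * r := one_le_mul_of_one_le_of_one_le hρ' hr'
  have hN1 : 1 ≤ (Lt : ℝ) * ρ * r := by
    rw [mul_assoc]; exact one_le_mul_of_one_le_of_one_le hLt' hρr
  have hN : 0 < (Lt : ℝ) * ρ * r / ε := by positivity
  set l := Real.log ((Lt : ℝ) * ρ * r / ε) with hl
  -- Since `ε ≤ 0.1` and `10 > e`. Then `(1 + log (240000 Cthr)) l` dominates `l + log (240000
  -- Cthr)`, where `240000 = 12000 / 0.05`.
  have hl1 : 1 ≤ l := by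
    rw [hl, Real.le_log_iff_exp_le hN, le_div_iff₀ hε]
    have := Real.exp_one_lt_d9
    have h := Real.exp_pos 1
    nlinarith
  have hexp : (600 / 601 : ℝ) ^ T ≤ Real.exp (-l - Real.log (240000 * Cthr)) := by
    calc (600 / 601 : ℝ) ^ T ≤ Real.exp (-(1 / 601)) ^ T := by
          refine pow_le_pow_left₀ (by norm_num) ?_ T
          have := Real.one_sub_le_exp_neg (1 / 601 : ℝ)
          norm_num at this ⊢
          exact this
      _ = Real.exp (-(T / 601)) := by rw [← Real.exp_nat_mul]; ring_nf
      _ ≤ _ := Real.exp_le_exp.2 (by nlinarith)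
  have hval : Real.exp (-l - Real.log (240000 * Cthr)) =
      ε / ((Lt : ℝ) * ρ * r) / (240000 * Cthr) := by
    rw [Real.exp_sub, Real.exp_neg, hl, Real.exp_log hN, Real.exp_log (by positivity), inv_div]
  rw [hval] at hexp
  calc 12000 * Lt * Cthr * (600 / 601) ^ T
      ≤ 12000 * Lt * Cthr * (ε / ((Lt : ℝ) * ρ * r) / (240000 * Cthr)) := by gcongr
    _ = 0.05 * ε / (ρ * r) := by field_simp; norm_num
    _ ≤ 0.05 * ε := div_le_self (by positivity) hρr

theorem IterationAccurate.vnorm_sub_columnEstimate_le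
    {A : Phase → Node Lt ρ → Fin q → Matrix (Fin m) (Fin n) ℝ}
    (hacc : IterationAccurate X σ δ A U) (hX : IsReducedSVD X Ustar σ V)
    (hU : Uᵀ * U = 1) (hδ0 : 0 < δ) (hδ : subspaceDist Ustar U ≤ δ) (ℓ : Node Lt ρ) (k : Fin q) :
    vnorm (X.col k - columnEstimate (A .updateB ℓ k) U (X.col k)) ≤ 1.4 * δ * vnorm (X.col k) := by
  have e : X.col k - columnEstimate (A .updateB ℓ k) U (X.col k) =
      resid U (X.col k) - U *ᵥ (lsCoeff (A .updateB ℓ k) U (X.col k) - Uᵀ *ᵥ X.col k) := by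
    rw [columnEstimate, resid, Matrix.mulVec_sub]; abel
  rw [e]
  refine (vnorm_sub_le _ _).trans ?_
  rw [vnorm_mulVec_of_orthonormal hU]
  have h1 := hacc.1 ℓ k
  have h2 := hX.vnorm_resid_col_le hU hδ k
  have h3 : 0 ≤ δ * vnorm (X.col k) := mul_nonneg hδ0.le (vnorm_nonneg _)
  linarith

end Aggregation

/-! ### The iterations -/

section Run

variable {Ω : Type*} {mΩ : MeasurableSpace Ω} {P : Measure Ω}
variable {m n q r ρ Lt : ℕ} {X : Matrix (Fin n) (Fin q) ℝ} {Ustar : Matrix (Fin n) (Fin r) ℝ}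
  {σ : Fin r → ℝ} {V : Matrix (Fin q) (Fin r) ℝ} {η thr : ℝ} {Tgm : ℕ}
  {F : Filtration ℕ mΩ} {A : ℕ → Phase → Node Lt ρ → Fin q → Ω → Matrix (Fin m) (Fin n) ℝ}
  {good : ℕ → Finset (Node Lt ρ)} {Z : ℕ → Node Lt ρ → Ω → Matrix (Fin n) (Fin r) ℝ}
  {x : ℕ → Ω → ℕ → Matrix (Fin n) (Fin r) ℝ} {U : ℕ → Ω → Matrix (Fin n) (Fin r) ℝ}

theorem IsRun.orthonormal (h : IsRun F A X good η thr Tgm Z x U) (s : ℕ) (ω : Ω) :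
    (U s ω)ᵀ * U s ω = 1 := by
  cases s with
  | zero => exact h.init ω
  | succ s => exact (h.update s ω).1

theorem card_le_of_transpose_mul_self_eq_one {M : Matrix (Fin n) (Fin r) ℝ} (hM : Mᵀ * M = 1) :
    r ≤ n := by
  have h := (Matrix.rank_mul_le_right Mᵀ M).trans (Matrix.rank_le_height M)
  rwa [hM, Matrix.rank_one, Fintype.card_fin] at h

/-- The deterministic part of an iteration: the median divided by `ρ m` satisfies the error
hypothesis of the contraction. -/
theorem IsRun.subspaceDist_succ_le (h : IsRun F A X good η thr Tgm Z x U)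
    (hX : IsReducedSVD X Ustar σ V) (hr : 0 < r) (hm : 0 < m) (hρ : 0 < ρ) (hη : 0 < η)
    (hη1 : η ≤ 0.5 / sigmaMax σ ^ 2) {s : ℕ} {ω : Ω}
    (hδ : subspaceDist Ustar (U s ω) ≤ errorBound σ η s)
    (hacc : IterationAccurate X σ (errorBound σ η s) (fun f ℓ k => A s f ℓ k ω) (U s ω))
    (hgood : ((good s)ᶜ.card : ℝ) < 0.4 * Lt) {Cthr εGM : ℝ} (hC : 1 ≤ Cthr)
    (hthr : thr = Cthr * (ρ * m) * sigmaMin σ ^ 2) (hε0 : 0 < εGM) (hε1 : εGM < 1)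
    (hx : GMSucceeds thr εGM Tgm Z x s ω)
    (hT : 12000 * Lt * Cthr * (600 / 601) ^ Tgm ≤ 0.05 * errorBound σ η s) :
    subspaceDist Ustar (U (s + 1) ω) ≤ errorBound σ η (s + 1) := by
  have hδ1 := hX.errorBound_le hr hη hη1 s
  have hρm : (0 : ℝ) < ρ * m := by positivity
  have hgm := hacc.norm_approxGM_sub_le hX hr (h.orthonormal s ω)
    (hX.errorBound_pos hr hη hη1 s) hδ1 hδ hgood (fun ℓ hℓ => h.honest s ℓ hℓ ω) hC hthr hε0 hε1
    hx hT
  rw [hX.errorBound_succ hr]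
  refine hX.subspaceDist_update_le hr (h.orthonormal s ω) hδ (hδ1.trans (hX.div_kappa_sq_le hr)) hη
    (hX.mul_sigmaMax_sq_le hr hη1) (Y := (ρ * m : ℝ)⁻¹ • approxGM (keptBatches thr fun ℓ => Z s ℓ ω)
      (batchSum fun ℓ => Z s ℓ ω) Tgm (x s ω)) ?_ ?_
  · rw [← inv_smul_smul₀ hρm.ne' ((U s ω * ((U s ω)ᵀ * X) - X) * ((U s ω)ᵀ * X)ᵀ), ← smul_sub,
      norm_smul, Real.norm_of_nonneg (by positivity), inv_mul_le_iff₀ hρm, mul_comm (ρ * m : ℝ)]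
    exact hgm
  · rw [smul_smul, ← div_eq_mul_inv]
    exact h.update s ω

theorem IsRun.measure_le [IsProbabilityMeasure P] (h : IsRun F A X good η thr Tgm Z x U)
    (hA : IsSampleSplitGaussian P F A) (hX : IsReducedSVD X Ustar σ V) (hr : 0 < r) (hm : 0 < m)
    (hρ : 0 < ρ) {μ : ℝ} (hμ1 : 1 ≤ μ) (hμ : RightIncoherent σ V μ) (hη : 0 < η)
    (hη1 : η ≤ 0.5 / sigmaMax σ ^ 2) (hgood : ∀ s, ((good s)ᶜ.card : ℝ) < 0.4 * Lt)
    {Cthr εGM ε : ℝ} (hC : 1 ≤ Cthr) (hthr : thr = Cthr * (ρ * m) * sigmaMin σ ^ 2)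
    (hε0 : 0 < εGM) (hε1 : εGM < 1) (hT : 12000 * Lt * Cthr * (600 / 601) ^ Tgm ≤ 0.05 * ε)
    (hinit : ∀ᵐ ω ∂P, subspaceDist Ustar (U 0 ω) ≤ 0.1 / kappa σ ^ 2) {t : ℕ}
    (ht : ε ≤ errorBound σ η t) {cgm p : ℝ} (hcgm : 0 ≤ cgm) (hp0 : 0 ≤ p)
    (hgm : P {ω | ¬ ∀ s ≤ t, GMSucceeds thr εGM Tgm Z x s ω} ≤ ENNReal.ofReal cgm)
    (hp : (Lt * ρ * q) * (2 * 25 ^ r * Real.exp (-(m / 25600))) +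
        Lt * (2 * 5 ^ (n * r) * Real.exp (-(sampleRatio σ μ m q ρ / 2560000))) ≤ p) :
    P {ω | ¬ (subspaceDist Ustar (U (t + 1) ω) ≤ errorBound σ η (t + 1) ∧
        ∀ ℓ ∈ good (t + 1), ∀ k, vnorm (X.col k - columnEstimate (A (t + 1) .updateB ℓ k ω)
          (U (t + 1) ω) (X.col k)) ≤ 1.4 * errorBound σ η (t + 1) * vnorm (X.col k))} ≤
      ENNReal.ofReal (cgm + (t + 2) * p) := by
  have hrn : r ≤ n := card_le_of_transpose_mul_self_eq_one hX.left_orthonormal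
  have hq : 0 < q := hr.trans_le (card_le_of_transpose_mul_self_eq_one hX.right_orthonormal)
  -- The bad event of iteration `s` includes that `U s` is still close to the truth. Its probability
  -- is thus bounded without conditioning on the success of earlier iterations.
  set B : ℕ → Set Ω := fun s => {ω | ((U s ω)ᵀ * U s ω = 1 ∧
    subspaceDist Ustar (U s ω) ≤ errorBound σ η s) ∧
      ¬ IterationAccurate X σ (errorBound σ η s) (fun f ℓ k => A s f ℓ k ω) (U s ω)} with hB
  have hBle : ∀ s, P (B s) ≤ ENNReal.ofReal p := fun s =>
    (hA.measure_not_iterationAccurate_le hX hr hm hq hrn hμ1 hμ (hX.errorBound_pos hr hη hη1 s)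
      (hX.errorBound_le hr hη hη1 s) s (h.adapted s)).trans (ENNReal.ofReal_le_ofReal hp)
  have hsub : {ω | ¬ (subspaceDist Ustar (U (t + 1) ω) ≤ errorBound σ η (t + 1) ∧
        ∀ ℓ ∈ good (t + 1), ∀ k, vnorm (X.col k - columnEstimate (A (t + 1) .updateB ℓ k ω)
          (U (t + 1) ω) (X.col k)) ≤ 1.4 * errorBound σ η (t + 1) * vnorm (X.col k))} ⊆
      {ω | ¬ subspaceDist Ustar (U 0 ω) ≤ 0.1 / kappa σ ^ 2} ∪
        -- Iterations `0, …, t` are needed for the distance of `U (t + 1)`; the data of iteration `t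
        -- + 1` enter the column estimates, whence `t + 2`.
        ({ω | ¬ ∀ s ≤ t, GMSucceeds thr εGM Tgm Z x s ω} ∪ ⋃ s ∈ Finset.range (t + 2), B s) := by
    intro ω hω
    by_contra hcon
    simp only [Set.mem_union, Set.mem_ofPred_eq, not_or, not_not, Set.mem_iUnion, exists_prop,
      Finset.mem_range, not_exists, not_and, hB] at hcon
    obtain ⟨h0, hsucc, hacc⟩ := hcon
    have hdist : ∀ s ≤ t + 1, subspaceDist Ustar (U s ω) ≤ errorBound σ η s := by
      intro s
      induction s with
      | zero => intro _; rwa [errorBound_zero]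
      | succ s ih =>
        intro hs
        have hd := ih (by omega)
        refine h.subspaceDist_succ_le hX hr hm hρ hη hη1 hd
          (hacc s (by omega) ⟨h.orthonormal s ω, hd⟩) (hgood s) hC hthr hε0 hε1
          (hsucc s (by omega)) (hT.trans ?_)
        have := hX.errorBound_antitone hr hη hη1 (show s ≤ t by omega)
        linarith
    have hlast := hdist (t + 1) le_rfl
    exact hω ⟨hlast, fun ℓ _ k => (hacc (t + 1) (by omega)
      ⟨h.orthonormal _ ω, hlast⟩).vnorm_sub_columnEstimate_le hX (h.orthonormal _ ω)
        (hX.errorBound_pos hr hη hη1 _) hlast ℓ k⟩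
  refine (measure_mono hsub).trans ((measure_union_le _ _).trans ?_)
  rw [ae_iff.1 hinit, zero_add]
  refine (measure_union_le _ _).trans ?_
  rw [ENNReal.ofReal_add hcgm (by positivity)]
  refine add_le_add hgm ((measure_biUnion_finset_le _ _).trans
    ((Finset.sum_le_sum fun s _ => hBle s).trans (le_of_eq ?_)))
  rw [Finset.sum_const, Finset.card_range, nsmul_eq_mul, ENNReal.ofReal_mul (by positivity)]
  congr 1
  rw [← ENNReal.ofReal_natCast]
  push_cast
  rfl

end Run

end

end ByzAltGDmin

/-! ### Choice of the constants and assembly. -/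

theorem mainTheorem3 :
    ∃ C₁ ≥ (1 : ℝ), ∃ C₂ ≥ (1 : ℝ), ∃ C₃ ≥ (1 : ℝ), ∀ Cthr ≥ (1 : ℝ), ∃ Cgm ≥ (1 : ℝ),
    ∀ (n q r mt Lt ρ : ℕ), 0 < r →
    -- the unknown matrix, its reduced SVD and its incoherence
    ∀ (X Ustar σ V) (_ : ByzAltGDmin.IsReducedSVD (n := n) (q := q) (r := r) X Ustar σ V)
      (μ : ℝ) (_ : 1 ≤ μ) (_ : ByzAltGDmin.RightIncoherent σ V μ)
    -- sample complexity, with `m = L mt` and `L = Lt ρ`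
      (_ : C₁ * Lt * ByzAltGDmin.kappa σ ^ 4 * μ ^ 2 * (n + r) * r ^ 2 ≤
        ((Lt * ρ : ℕ) : ℝ) * mt * q)
      (_ : C₂ * max (max (Real.log q) (Real.log n)) r ≤ mt)
    -- Byzantine nodes
      (τ : ℝ) (_ : 0 ≤ τ) (_ : τ < 0.4 * (Lt / ((Lt * ρ : ℕ) : ℝ)))
      (good : ℕ → Finset (ByzAltGDmin.Node Lt ρ))
      (_ : ∀ s, (((good s)ᶜ.card : ℕ) : ℝ) ≤ τ * ((Lt * ρ : ℕ) : ℝ))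
    -- algorithm parameters
      (η : ℝ) (_ : 0 < η) (_ : η ≤ 0.5 / ByzAltGDmin.sigmaMax σ ^ 2)
      (ε : ℝ) (_ : 0 < ε) (_ : ε < 1)
      (Tgm : ℕ) (_ : Cgm * Real.log (((Lt * ρ : ℕ) : ℝ) * r / ε) ≤ Tgm)
      (εGM : ℝ) (_ : 0 < εGM) (_ : εGM < 1)
      (thr : ℝ) (_ : thr = Cthr * (ρ * mt) * ByzAltGDmin.sigmaMin σ ^ 2),
    -- error decay: at iteration `t`, as long as `δ_t` has not fallen below `ε`
    (∀ (Ω : Type*) [mΩ : MeasurableSpace Ω] (P : Measure Ω) [IsProbabilityMeasure P]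
      (F : Filtration ℕ mΩ)
      (A : ℕ → ByzAltGDmin.Phase → ByzAltGDmin.Node Lt ρ → Fin q → Ω →
        Matrix (Fin mt) (Fin n) ℝ)
      (_ : ByzAltGDmin.IsSampleSplitGaussian P F A)
      (Z : ℕ → ByzAltGDmin.Node Lt ρ → Ω → Matrix (Fin n) (Fin r) ℝ)
      (x : ℕ → Ω → ℕ → Matrix (Fin n) (Fin r) ℝ)
      (U : ℕ → Ω → Matrix (Fin n) (Fin r) ℝ)
      (_ : ByzAltGDmin.IsRun F A X good η thr Tgm Z x U)
      (_ : ∀ᵐ ω ∂P, ByzAltGDmin.subspaceDist Ustar (U 0 ω) ≤ 0.1 / ByzAltGDmin.kappa σ ^ 2)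
      (t : ℕ) (_ : ε ≤ ByzAltGDmin.errorBound σ η t)
      (cgm : ℝ) (_ : 0 ≤ cgm)
      (_ : P {ω | ¬ ∀ s ≤ t, ByzAltGDmin.GMSucceeds thr εGM Tgm Z x s ω} ≤ ENNReal.ofReal cgm),
      P {ω | ¬ (ByzAltGDmin.subspaceDist Ustar (U (t + 1) ω) ≤
              ByzAltGDmin.errorBound σ η (t + 1) ∧
            ∀ ℓ ∈ good (t + 1), ∀ k,
              ‖WithLp.toLp 2 (X.col k - ByzAltGDmin.columnEstimate
                  (A (t + 1) .updateB ℓ k ω) (U (t + 1) ω) (X.col k))‖ ≤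
                1.4 * ByzAltGDmin.errorBound σ η (t + 1) * ‖WithLp.toLp 2 (X.col k)‖)} ≤
        ENNReal.ofReal (cgm + (t + 1) *
          (((Lt * ρ : ℕ) : ℝ) * ((n : ℝ) ^ 10)⁻¹ +
            Real.exp (-(((Lt * ρ : ℕ) : ℝ) *
              ByzAltGDmin.psi (0.4 - τ) ((n : ℝ) ^ 10)⁻¹))))) ∧
    -- communication cost of the iterations needed to reach accuracy `ε`
    (∃ T : ℕ, ByzAltGDmin.errorBound σ η T ≤ ε ∧
      (∀ t < T, ε ≤ ByzAltGDmin.errorBound σ η t) ∧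
      (ByzAltGDmin.scalarsExchanged n r T : ℝ) ≤
        C₃ * (ByzAltGDmin.kappa σ ^ 2 / (η * ByzAltGDmin.sigmaMax σ ^ 2)) *
          (n * r * Real.log (1 / ε))) := by
  -- The first two constants come from `failure_bound`. The third is `10 · 2`: the factor from the
  -- iteration count times the two `n × r` matrices exchanged per iteration.
  refine ⟨38400000, by norm_num, 460800, by norm_num, 20, by norm_num, fun Cthr hC =>
    ⟨601 * (1 + Real.log (240000 * Cthr)), ?_, ?_⟩⟩
  · have : 0 ≤ Real.log (240000 * Cthr) := Real.log_nonneg (by linarith)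
    linarith
  intro n q r mt Lt ρ hr X Ustar σ V hX μ hμ1 hμ hC₁ hC₂ τ hτ0 hτ good hgood η hη hη1 ε hε hε1 Tgm
    hT εGM hGM0 hGM1 thr hthr
  have hκ := hX.one_le_kappa hr
  -- Without nodes, `Lt / (Lt * ρ)` would be a division by zero with value `0`, contradicting `0 ≤
  -- τ`.
  have hLρ : 0 < Lt * ρ := by
    refine Nat.pos_of_ne_zero fun h0 => ?_
    rw [h0, Nat.cast_zero, div_zero, mul_zero] at hτ
    exact absurd hτ (not_lt.2 hτ0)
  have hLt : 0 < Lt := Nat.pos_of_mul_pos_right hLρ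
  have hρ : 0 < ρ := Nat.pos_of_mul_pos_left hLρ
  have hLρ' : (0 : ℝ) < ((Lt * ρ : ℕ) : ℝ) := by exact_mod_cast hLρ
  have hr' : (1 : ℝ) ≤ r := by exact_mod_cast hr
  have hm : 0 < mt := by
    have h1 : (r : ℝ) ≤ max (max (Real.log q) (Real.log n)) r := le_max_right _ _
    have h2 : (0 : ℝ) < mt := by linarith
    exact_mod_cast h2
  have hn : r ≤ n := ByzAltGDmin.card_le_of_transpose_mul_self_eq_one hX.left_orthonormal
  have hq : 0 < q :=
    hr.trans_le (ByzAltGDmin.card_le_of_transpose_mul_self_eq_one hX.right_orthonormal)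
  have hbad : ∀ s, ((good s)ᶜ.card : ℝ) < 0.4 * Lt := fun s => by
    refine (hgood s).trans_lt ?_
    rwa [← mul_div_assoc, lt_div_iff₀ hLρ'] at hτ
  refine ⟨?_, ?_⟩
  · intro Ω mΩ P _ F A hA Z x U hrun hinit t ht cgm hcgm hgm
    have hexp := (Real.exp_pos (-(((Lt * ρ : ℕ) : ℝ) *
      ByzAltGDmin.psi (0.4 - τ) ((n : ℝ) ^ 10)⁻¹))).le
    have ht1 : (1 : ℝ) ≤ (t : ℝ) + 1 := by linarith [(Nat.cast_nonneg t : (0 : ℝ) ≤ t)]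
    -- For `n = 1` the claimed failure probability is at least `L ≥ 1`, so the bound is trivial.
    rcases Nat.lt_or_ge n 2 with hn2 | hn2
    · obtain rfl : n = 1 := by omega
      refine prob_le_one.trans ?_
      rw [← ENNReal.ofReal_one]
      refine ENNReal.ofReal_le_ofReal ?_
      have hL1 : (1 : ℝ) ≤ ((Lt * ρ : ℕ) : ℝ) := by exact_mod_cast hLρ
      rw [Nat.cast_one] at hexp ⊢
      simp only [one_pow, inv_one, mul_one] at hexp ⊢
      nlinarith
    · have hTgm := ByzAltGDmin.gm_iterations_suffice hC hε (ht.trans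
        ((hX.errorBound_le hr hη hη1 t).trans (hX.div_kappa_sq_le hr))) hLt hρ hr hT
      refine (hrun.measure_le hA hX hr hm hρ hμ1 hμ hη hη1 hbad hC hthr hGM0 hGM1 hTgm hinit ht
        hcgm (by positivity) hgm
        (ByzAltGDmin.failure_bound hr hn2 hq hLt hρ hκ hμ1 hC₁ hC₂)).trans
        (ENNReal.ofReal_le_ofReal ?_)
      -- Each of the `t + 2` iterations fails with probability at most half of `L n⁻¹⁰`, and `(t +
      -- 2) / 2 ≤ t + 1`.
      have hp : 0 ≤ ((Lt * ρ : ℕ) : ℝ) * ((n : ℝ) ^ 10)⁻¹ := by positivity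
      nlinarith
  · obtain ⟨T, h1, h2, h3⟩ := hX.exists_errorBound_le hr hη hη1 hε hε1
    refine ⟨T, h1, h2, ?_⟩
    have e : (ByzAltGDmin.scalarsExchanged n r T : ℝ) = T * (2 * (n * r)) := by
      simp only [ByzAltGDmin.scalarsExchanged, Finset.sum_const, Finset.card_range,
        Fintype.card_prod, Fintype.card_fin, smul_eq_mul]
      push_cast
      ring
    rw [e]
    refine (mul_le_mul_of_nonneg_right h3 (by positivity)).trans (le_of_eq ?_)
    ring
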